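/- For $k\in\mathbb Z$ let $(z)_k$ denote the Pochhammer symbol, $(z)_k=z(z+1)\cdots(z+k-1)$ for $k\ge 0$ and $(z)_{-j}=1/\big((z-1)(z-2)\cdots(z-j)\big)$ for $j\ge 1$. Horn's function $H_5$ is defined by $$H_5(a,b,c,x,y)=\sum_{m,n=0}^\infty \frac{(a)_{2m+n}(b)_{n-m}}{(c)_n}\frac{x^m y^n}{m!\,n!}$$ on its region of convergence $D_0\subset\mathbb C^2$, i.e. the interior of the set of all $(x,y)$ at which the double series converges absolutely. Let $a,b,c\in\mathbb C$ be such that $b\notin\mathbb Z$, $a-b\notin\mathbb Z$, and none of $a,\ c,\ c-a,\ c-b$ is a non-positive integer. Put $$S_1(x,y)=\sum_{m,n=0}^\infty \frac{(a)_{2m+n}(a-c+1)_{2m+n}}{m!\,n!\,(a-b+1)_{3m+n}}\Big(-\frac{x}{y^2}\Big)^m\Big(\frac1y\Big)^n,\qquad S_2(x,y)=\sum_{m,n=0}^\infty \frac{(b)_{n-m}(b-c+1)_{n-m}}{m!\,n!\,(-a+b+1)_{n-3m}}(-xy)^m\Big(\frac1y\Big)^n .$$ Let $R_1$ be the set of all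 $(x,y)\in\mathbb C^2$ with $y\neq 0$, $$16\Big|\frac{x}{y^2}\Big|<27,\qquad \frac1{|y|}<1,\qquad \Big|\frac{x}{y^2}\Big|<\frac1{32}\Big(\Big(9-\frac8{|y|}\Big)^{3/2}-\frac{36}{|y|}+\frac8{|y|^2}+27\Big),$$ and let $R_2$ be the set of all $(x,y)\in\mathbb C^2$ with $27|xy|<1$, $|y|<|y|^2$ and $$|xy|<\min\Big(\tfrac1{32}\Big(\Big(9-\tfrac8{|y|}\Big)^{3/2}-\tfrac{36}{|y|}+\tfrac8{|y|^2}+27\Big)|y|^3,\ \tfrac1{32}|y|\big(-\sqrt{|y|}\,(9|y|+8)^{3/2}+36|y|+27|y|^2+8\big)\Big).$$ Then $S_1$ converges absolutely on $R_1$ and $S_2$ converges absolutely on $R_2$. Moreover $(0,0)\in D_0$, and there are a connected open set $U\subset\mathbb C^2$ and an analytic function $F:U\to\mathbb C$ such that $U$ contains $D_0$, all points $(0,y)$ with $y\in\mathbb C\setminus[1,\infty)$, and all points $(x,y)\in R_1\cap R_2$ with $y\notin[0,\infty)$, and such that: 1. $F(x,y)=H_5(a,b,c,x,y)$ for $(x,y)\in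 D_0$; that is, $F$ is an analytic continuation of $H_5$. 2. For all $(x,y)\in R_1\cap R_2$ with $y\notin[0,\infty)$, $$F(x,y)=(-y)^{-a}\,\frac{\Gamma(c)\Gamma(b-a)}{\Gamma(b)\Gamma(c-a)}\,S_1(x,y)+(-y)^{-b}\,\frac{\Gamma(c)\Gamma(a-b)}{\Gamma(a)\Gamma(c-b)}\,S_2(x,y),$$ where the powers of $-y$ have their principal values. 3. For $(x,y)\in R_1\cap R_2$ with $y$ real and positive, the same formula gives the boundary values of $F$ on the two sides of the cut: as $(x',y')\to(x,y)$ with $\operatorname{Im}y'>0$ (respectively $\operatorname{Im}y'<0$), $F(x',y')$ tends to the right-hand side of 2, with $(-y)^s$ read as $e^{s(\log y-i\pi)}$ (respectively $e^{s(\log y+i\pi)}$) for $s=-a,-b$. -/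

import Mathlib

open scoped Topology

noncomputable section

/-- The Pochhammer symbol `(z)_k` for an integer index `k`: it is `z (z+1) ⋯ (z+k-1)` for `k ≥ 0`, and
`(z)_{-j} = 1 / ((z-1)(z-2) ⋯ (z-j))` for `j ≥ 1`. -/
def poch (z : ℂ) : ℤ → ℂ
  | Int.ofNat k => (ascPochhammer ℂ k).eval z
  | Int.negSucc j => ((ascPochhammer ℂ (j + 1)).eval (z - (j + 1)))⁻¹

/-- Where `Γ` has no pole, `(z)_k = Γ(z + k) / Γ(z)`. -/
theorem poch_eq_Gamma_div (z : ℂ) (k : ℤ) (h : ∀ j : ℕ, z ≠ -j) (h' : ∀ j : ℕ, z + k ≠ -j) :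
    poch z k = Complex.Gamma (z + k) / Complex.Gamma z := by
  have key : ∀ (n : ℕ) (w : ℂ), (∀ j : ℕ, w ≠ -j) →
      (ascPochhammer ℂ n).eval w * Complex.Gamma w = Complex.Gamma (w + n) := by
    intro n w hw
    induction n with
    | zero => simp
    | succ n ih =>
      have hne : w + n ≠ 0 := fun e => hw n (eq_neg_of_add_eq_zero_left e)
      rw [ascPochhammer_succ_eval, mul_right_comm, ih, Nat.cast_succ, ← add_assoc,
        Complex.Gamma_add_one _ hne, mul_comm]
  cases k with
  | ofNat n =>
    have := key n z h
    have hz : Complex.Gamma z ≠ 0 := Complex.Gamma_ne_zero h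
    simp only [poch, Int.ofNat_eq_natCast, Int.cast_natCast]
    rw [eq_div_iff hz, this]
  | negSucc n =>
    have e : z + ((Int.negSucc n : ℤ) : ℂ) = z - (n + 1) := by
      rw [Int.cast_negSucc]; push_cast; ring
    rw [e] at h' ⊢
    have := key (n + 1) _ h'
    have e2 : z - (n + 1) + ((n + 1 : ℕ) : ℂ) = z := by push_cast; ring
    rw [e2] at this
    have hz : Complex.Gamma (z - (n + 1)) ≠ 0 := Complex.Gamma_ne_zero h'
    have hz' : Complex.Gamma z ≠ 0 := Complex.Gamma_ne_zero h
    have hp : (ascPochhammer ℂ (n + 1)).eval (z - (n + 1)) ≠ 0 := by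
      intro h0; rw [h0, zero_mul] at this; exact hz' this.symm
    simp only [poch]
    rw [← this]
    field_simp

/-- General term, with index `p = (m, n)`, of the double series defining Horn's function `H₅`. -/
def hornH5Term (a b c x y : ℂ) (p : ℕ × ℕ) : ℂ :=
  poch a (2 * p.1 + p.2) * poch b ((p.2 : ℤ) - p.1) / poch c p.2 *
    (x ^ p.1 * y ^ p.2 / ((p.1.factorial : ℂ) * (p.2.factorial : ℂ)))

/-- Horn's double series `H₅(a, b, c, x, y)`. -/
def hornH5 (a b c x y : ℂ) : ℂ := ∑' p : ℕ × ℕ, hornH5Term a b c x y p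

/-- The region of convergence of the series `H₅`: the interior of the set of its points of
(absolute) convergence. -/
def hornH5Region (a b c : ℂ) : Set (ℂ × ℂ) :=
  interior {q | Summable (hornH5Term a b c q.1 q.2)}

/-- General term of the series in `-x/y²` and `1/y`. -/
def firstTerm (a b c x y : ℂ) (p : ℕ × ℕ) : ℂ :=
  poch a (2 * p.1 + p.2) * poch (a - c + 1) (2 * p.1 + p.2) /
      ((p.1.factorial : ℂ) * (p.2.factorial : ℂ) * poch (a - b + 1) (3 * p.1 + p.2)) *
    (-(x / y ^ 2)) ^ p.1 * (1 / y) ^ p.2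

/-- General term of the series in `-xy` and `1/y`. -/
def secondTerm (a b c x y : ℂ) (p : ℕ × ℕ) : ℂ :=
  poch b ((p.2 : ℤ) - p.1) * poch (b - c + 1) ((p.2 : ℤ) - p.1) /
      ((p.1.factorial : ℂ) * (p.2.factorial : ℂ) * poch (-a + b + 1) ((p.2 : ℤ) - 3 * p.1)) *
    (-(x * y)) ^ p.1 * (1 / y) ^ p.2

/-- The region of convergence of the series in `-x/y²` and `1/y`. -/
def firstRegion : Set (ℂ × ℂ) :=
  {q | q.2 ≠ 0 ∧ 16 * ‖q.1 / q.2 ^ 2‖ < 27 ∧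
    ‖q.1 / q.2 ^ 2‖ <
      1 / 32 * ((9 - 8 / ‖q.2‖) ^ (3 / 2 : ℝ) - 36 / ‖q.2‖ + 8 / ‖q.2‖ ^ 2 + 27) ∧
    1 / ‖q.2‖ < 1}

/-- The region of convergence of the series in `-xy` and `1/y`. -/
def secondRegion : Set (ℂ × ℂ) :=
  {q | 27 * ‖q.1 * q.2‖ < 1 ∧ ‖q.2‖ < ‖q.2‖ ^ 2 ∧
    ‖q.1 * q.2‖ <
      min (1 / 32 * ((9 - 8 / ‖q.2‖) ^ (3 / 2 : ℝ) - 36 / ‖q.2‖ + 8 / ‖q.2‖ ^ 2 + 27) * ‖q.2‖ ^ 3)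
        (1 / 32 * ‖q.2‖ *
          (-(Real.sqrt ‖q.2‖ * (9 * ‖q.2‖ + 8) ^ (3 / 2 : ℝ)) + 36 * ‖q.2‖ + 27 * ‖q.2‖ ^ 2 + 8))}

/-- The sum of the two series with their prefactors. The value of the multivalued powers of `-y` is
fixed by a logarithm `l` of `-y`: `(-y)^s = exp (s * l)`. -/
def hornH5AtInfinity (a b c x y l : ℂ) : ℂ :=
  Complex.exp (-a * l) *
      (Complex.Gamma c * Complex.Gamma (b - a) / (Complex.Gamma b * Complex.Gamma (c - a))) *
      ∑' p : ℕ × ℕ, firstTerm a b c x y p +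
    Complex.exp (-b * l) *
      (Complex.Gamma c * Complex.Gamma (a - b) / (Complex.Gamma a * Complex.Gamma (c - b))) *
      ∑' p : ℕ × ℕ, secondTerm a b c x y p

/-- With the principal logarithm the prefactors are Mathlib's powers of `-y`. -/
theorem hornH5AtInfinity_log (a b c x y : ℂ) (hy : y ≠ 0) :
    hornH5AtInfinity a b c x y (Complex.log (-y)) =
      (-y) ^ (-a) *
          (Complex.Gamma c * Complex.Gamma (b - a) / (Complex.Gamma b * Complex.Gamma (c - a))) *
          ∑' p : ℕ × ℕ, firstTerm a b c x y p +
        (-y) ^ (-b) *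
          (Complex.Gamma c * Complex.Gamma (a - b) / (Complex.Gamma a * Complex.Gamma (c - b))) *
          ∑' p : ℕ × ℕ, secondTerm a b c x y p := by
  rw [Complex.cpow_def_of_ne_zero (neg_ne_zero.mpr hy),
    Complex.cpow_def_of_ne_zero (neg_ne_zero.mpr hy), mul_comm _ (-a), mul_comm _ (-b)]
  rfl

end

/-! Summing Horn's series over `n` first turns it into `∑ₘ xᵐ Rₘ(y)`, where `Rₘ(y) = (a)₂ₘ (b)₋ₘ /
m! · ₂F₁(a + 2m, b - m; c; y)` (`row`, `psum_hornCoef`). Every Gauss function continues to the plane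
cut along `[1, ∞)`, so the continuation `F` is the same sum with continued rows (`cont`). Its domain
`contDomain` consists of the points near which `rᵐ Rₘ` stays bounded for some `r > |x|`. Cauchy
estimates in `y` make such a sum a locally convergent double power series, hence analytic
(`analyticAt_tsum_pow_mul`).

That this domain is connected and contains `(0, y)` for every `y` off the cut needs a bound
exponential in `m` for `₂F₁(a + 2m, b - m; c; y)`, locally uniform on the slit plane. The map `w =
(1 - √(1 - y)) / (1 + √(1 - y))` takes the slit plane to the unit disc, and in this variable the
Gauss function is `(1 + w)^(2α)` times a power series convergent on the whole disc. The recurrence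
of its coefficients bounds them by `K^M ρ⁻ⁿ` when `|α|, |β| ≤ M` (`exists_quadCoef_bound`). Any
point of the domain is then joined to the origin by shrinking `x`, then `y`.

For `|y| > 1` each row is rewritten by the connection formula between `0` and `∞` (`hyp_eq_solInf`).
The Gamma quotients at the shifted parameters `a + 2m`, `b - m` combine with the Pochhammer symbols
into the coefficients of `S₁` and `S₂`, times prefactors free of `m` (`row_eq`). Summing over `m`
gives the formula wherever both double series converge absolutely. The connection formula comes from
the differential equation: a Wronskian argument shows that the two solutions at infinity span, a
contiguity relation compares the coefficient at `(α, β, γ)` with that at `(α, β + 1, γ + 1)`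
(`Connects.step`), and after many such steps the coefficient tends to `1` by Pfaff's transformation.
The accumulated ratio is Euler's product for the Gamma quotient (`Connects.eq_Gamma`).

Convergence on `R₁` and `R₂` is an entropy estimate. Up to polynomial factors the coefficients are
quotients of factorials, bounded by weighted Stirling inequalities whose weights `μ`, `ν`
parametrise the curves bounding the regions (`dominated_of_mem_firstRegion`,
`dominated_of_mem_secondRegion`). The same bounds put the points of `R₁ ∩ R₂` off the cut into the
domain and make both series continuous across the cut, so the boundary values depend only on the
one-sided limits of `log (-y)`. -/

noncomputable section
namespace HornH5
open Filter Metric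

/-! ### Power series on the unit disc -/

/-- The sum of the power series with coefficients `c`. -/
def psum (c : ℕ → ℂ) (z : ℂ) : ℂ := ∑' n, c n * z ^ n

/-- The coefficients `c` define a power series that converges on the unit disc. -/
def Tame (c : ℕ → ℂ) : Prop := ∀ r : ℝ, 0 < r → r < 1 → ∃ C : ℝ, ∀ n, ‖c n‖ * r ^ n ≤ C

theorem exists_bound_pow_mul_geometric (p : ℕ) {q : ℝ} (hq0 : 0 ≤ q) (hq : q < 1) :
    ∃ C : ℝ, 0 < C ∧ ∀ n : ℕ, ((n : ℝ) + 1) ^ p * q ^ n ≤ C := by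
  have h0 : Tendsto (fun n : ℕ => (n : ℝ) ^ p * q ^ n) atTop (𝓝 0) :=
    tendsto_pow_const_mul_const_pow_of_lt_one p hq0 hq
  obtain ⟨C, hC⟩ := h0.bddAbove_range
  have hC' : ∀ n : ℕ, (n : ℝ) ^ p * q ^ n ≤ C := fun n => hC ⟨n, rfl⟩
  have hCpos : 0 ≤ C := le_trans (by positivity) (hC' 0)
  refine ⟨2 ^ p * C + 1, by positivity, fun n => ?_⟩
  rcases Nat.eq_zero_or_pos n with rfl | hn
  · have : (1 : ℝ) ≤ 2 ^ p * C + 1 := le_add_of_nonneg_left (by positivity)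
    simpa using this
  · have h1 : ((n : ℝ) + 1) ^ p ≤ (2 * n) ^ p := by
      have : (1 : ℝ) ≤ n := by exact_mod_cast hn
      gcongr
      linarith
    calc ((n : ℝ) + 1) ^ p * q ^ n ≤ (2 * n) ^ p * q ^ n := by gcongr
      _ = 2 ^ p * ((n : ℝ) ^ p * q ^ n) := by rw [mul_pow]; ring
      _ ≤ 2 ^ p * C := by gcongr; exact hC' n
      _ ≤ _ := by linarith

/-- A polynomial factor is absorbed by the geometric gain from passing to a slightly larger radius.
-/
theorem Tame.of_le {c d : ℕ → ℂ} (hc : Tame c) (K : ℝ) (p : ℕ)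
    (h : ∀ n, ‖d n‖ ≤ K * ((n : ℝ) + 1) ^ p * ‖c n‖) : Tame d := by
  intro r hr0 hr1
  obtain ⟨s, hs1, hs2⟩ := exists_between hr1
  have hs0 : 0 < s := hr0.trans hs1
  obtain ⟨C, hC⟩ := hc s hs0 hs2
  obtain ⟨D, hD0, hD⟩ := exists_bound_pow_mul_geometric p (q := r / s) (by positivity)
    ((div_lt_one hs0).2 hs1)
  refine ⟨|K| * D * C, fun n => ?_⟩
  calc ‖d n‖ * r ^ n ≤ (|K| * ((n : ℝ) + 1) ^ p * ‖c n‖) * r ^ n := by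
        gcongr
        exact (h n).trans (by gcongr; exact le_abs_self K)
    _ = |K| * (((n : ℝ) + 1) ^ p * (r / s) ^ n) * (‖c n‖ * s ^ n) := by
        rw [div_pow]; field_simp
    _ ≤ |K| * D * C := by
        gcongr
        · exact hD n
        · exact hC n

theorem Tame.summable_norm {c : ℕ → ℂ} (hc : Tame c) {z : ℂ} (hz : ‖z‖ < 1) :
    Summable fun n => ‖c n * z ^ n‖ := by
  obtain ⟨r, h1, h2⟩ := exists_between hz
  have hr0 : 0 < r := (norm_nonneg z).trans_lt h1
  obtain ⟨C, hC⟩ := hc r hr0 h2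
  refine Summable.of_nonneg_of_le (fun n => norm_nonneg _) (fun n => ?_)
    ((summable_geometric_of_lt_one (by positivity) ((div_lt_one hr0).2 h1)).mul_left C)
  rw [norm_mul, norm_pow, div_pow]
  calc ‖c n‖ * ‖z‖ ^ n = (‖c n‖ * r ^ n) * (‖z‖ ^ n / r ^ n) := by field_simp
    _ ≤ _ := by gcongr; exact hC n

theorem Tame.summable {c : ℕ → ℂ} (hc : Tame c) {z : ℂ} (hz : ‖z‖ < 1) :
    Summable fun n => c n * z ^ n := (hc.summable_norm hz).of_norm

theorem Tame.nat_mul {c : ℕ → ℂ} (hc : Tame c) : Tame fun n => (n : ℂ) * c n :=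
  hc.of_le 1 1 fun n => by
    rw [norm_mul, Complex.norm_natCast, pow_one, one_mul]
    gcongr
    linarith

theorem Tame.const_mul {c : ℕ → ℂ} (hc : Tame c) (k : ℂ) : Tame fun n => k * c n :=
  hc.of_le ‖k‖ 0 fun n => by simp

theorem Tame.add {c d : ℕ → ℂ} (hc : Tame c) (hd : Tame d) : Tame fun n => c n + d n := by
  intro r h0 h1
  obtain ⟨C, hC⟩ := hc r h0 h1
  obtain ⟨D, hD⟩ := hd r h0 h1
  refine ⟨C + D, fun n => ?_⟩
  calc ‖c n + d n‖ * r ^ n ≤ (‖c n‖ + ‖d n‖) * r ^ n := by gcongr; exact norm_add_le _ _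
    _ ≤ _ := by rw [add_mul]; exact add_le_add (hC n) (hD n)

theorem psum_add {c d : ℕ → ℂ} (hc : Tame c) (hd : Tame d) {z : ℂ} (hz : ‖z‖ < 1) :
    psum (fun n => c n + d n) z = psum c z + psum d z := by
  simp only [psum, add_mul]
  exact (hc.summable hz).tsum_add (hd.summable hz)

theorem psum_const_mul (k : ℂ) (c : ℕ → ℂ) (z : ℂ) :
    psum (fun n => k * c n) z = k * psum c z := by
  simp only [psum, mul_assoc]
  exact tsum_mul_left

theorem psum_zero_right (c : ℕ → ℂ) : psum c 0 = c 0 := by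
  rw [psum, tsum_eq_single 0 (fun n hn => by simp [hn])]
  simp

/-- The coefficients of `z * psum c z`. -/
def shiftCoef (c : ℕ → ℂ) : ℕ → ℂ
  | 0 => 0
  | n + 1 => c n

theorem Tame.shiftCoef {c : ℕ → ℂ} (hc : Tame c) : Tame (shiftCoef c) := by
  intro r h0 h1
  obtain ⟨C, hC⟩ := hc r h0 h1
  have hC0 : 0 ≤ C := le_trans (by positivity) (hC 0)
  refine ⟨C, fun n => ?_⟩
  cases n with
  | zero => simpa [HornH5.shiftCoef] using hC0
  | succ n =>
    calc ‖c n‖ * r ^ (n + 1) = r * (‖c n‖ * r ^ n) := by ring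
      _ ≤ 1 * C := mul_le_mul h1.le (hC n) (by positivity) zero_le_one
      _ = C := one_mul C

theorem psum_shiftCoef {c : ℕ → ℂ} (hc : Tame c) {z : ℂ} (hz : ‖z‖ < 1) :
    psum (shiftCoef c) z = z * psum c z := by
  rw [psum, (hc.shiftCoef.summable hz).tsum_eq_zero_add]
  simp only [shiftCoef, zero_mul, zero_add, psum]
  rw [← tsum_mul_left]
  exact tsum_congr fun n => by ring

theorem norm_psum_le {c : ℕ → ℂ} {z : ℂ} {C r : ℝ} (hr : ‖z‖ < r)
    (hC : ∀ n, ‖c n‖ * r ^ n ≤ C) : ‖psum c z‖ ≤ C * (1 - ‖z‖ / r)⁻¹ := by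
  have hr0 : 0 < r := (norm_nonneg z).trans_lt hr
  refine tsum_of_norm_bounded
    ((hasSum_geometric_of_lt_one (by positivity) ((div_lt_one hr0).2 hr)).mul_left C) fun n => ?_
  rw [norm_mul, norm_pow, div_pow]
  calc ‖c n‖ * ‖z‖ ^ n = (‖c n‖ * r ^ n) * (‖z‖ ^ n / r ^ n) := by field_simp
    _ ≤ _ := by gcongr; exact hC n

theorem Tame.hasDerivAt {c : ℕ → ℂ} (hc : Tame c) {z : ℂ} (hz : ‖z‖ < 1) :
    HasDerivAt (psum c) (∑' n, c n * (n * z ^ (n - 1))) z := by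
  obtain ⟨r, h1, h2⟩ := exists_between hz
  have hr0 : 0 < r := (norm_nonneg z).trans_lt h1
  have hu : Summable fun n : ℕ => ‖c n‖ * (n * r ^ (n - 1)) := by
    have := (hc.nat_mul.summable_norm (z := (r : ℂ)) (by simpa [abs_of_pos hr0] using h2)).mul_left
      r⁻¹
    refine this.congr fun n => ?_
    cases n with
    | zero => simp
    | succ n =>
      simp only [norm_mul, Complex.norm_natCast, norm_pow, Complex.norm_real, Real.norm_eq_abs,
        abs_of_pos hr0, pow_succ, Nat.add_sub_cancel]
      field_simp
  refine hasDerivAt_tsum_of_isPreconnected (t := ball 0 r) (y₀ := 0) hu isOpen_ball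
    (convex_ball _ _).isPreconnected (g := fun n z => c n * z ^ n)
    (g' := fun n z => c n * (n * z ^ (n - 1))) ?_ ?_ ?_ ?_ ?_
  · intro n y _
    exact (hasDerivAt_pow n y).const_mul _
  · intro n y hy
    have hy' : ‖y‖ < r := by simpa using hy
    rw [norm_mul, norm_mul, norm_pow, Complex.norm_natCast]
    gcongr
  · simpa using hr0
  · exact hc.summable (by simp)
  · simpa using h1

/-- `g` is the image of `f` under the Euler operator `z d/dz` on `s`. -/
def ThetaOn (f g : ℂ → ℂ) (s : Set ℂ) : Prop := ∀ z ∈ s, ∃ f', HasDerivAt f f' z ∧ z * f' = g z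

theorem Tame.thetaOn {c : ℕ → ℂ} (hc : Tame c) :
    ThetaOn (psum c) (psum fun n => n * c n) (ball 0 1) := by
  intro z hz
  refine ⟨_, hc.hasDerivAt (by simpa using hz), ?_⟩
  rw [psum, ← tsum_mul_left]
  refine tsum_congr fun n => ?_
  cases n with
  | zero => simp
  | succ n => simp only [Nat.add_sub_cancel, pow_succ]; ring

theorem ThetaOn.mono {f g : ℂ → ℂ} {s t : Set ℂ} (h : ThetaOn f g s) (hts : t ⊆ s) :
    ThetaOn f g t := fun z hz => h z (hts hz)

theorem ThetaOn.eq_mul_deriv {f g : ℂ → ℂ} {s : Set ℂ} (h : ThetaOn f g s) {z : ℂ} (hz : z ∈ s) :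
    g z = z * deriv f z := by
  obtain ⟨f', h1, h2⟩ := h z hz
  rw [h1.deriv, h2]

theorem ThetaOn.differentiableOn {f g : ℂ → ℂ} {s : Set ℂ} (h : ThetaOn f g s) :
    DifferentiableOn ℂ f s := fun z hz => by
  obtain ⟨f', h1, -⟩ := h z hz
  exact h1.differentiableAt.differentiableWithinAt

theorem ThetaOn.congr {f f₁ g g₁ : ℂ → ℂ} {s : Set ℂ} (h : ThetaOn f g s) (hs : IsOpen s)
    (hf : ∀ z ∈ s, f₁ z = f z) (hg : ∀ z ∈ s, g₁ z = g z) : ThetaOn f₁ g₁ s := fun z hz => by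
  obtain ⟨f', h1, h2⟩ := h z hz
  refine ⟨f', h1.congr_of_eventuallyEq ?_, by rw [h2, hg z hz]⟩
  filter_upwards [hs.mem_nhds hz] with w hw using hf w hw

theorem ThetaOn.add {f f₁ g g₁ : ℂ → ℂ} {s : Set ℂ} (h : ThetaOn f f₁ s) (h' : ThetaOn g g₁ s) :
    ThetaOn (fun z => f z + g z) (fun z => f₁ z + g₁ z) s := fun z hz => by
  obtain ⟨f', h1, h2⟩ := h z hz
  obtain ⟨g', h3, h4⟩ := h' z hz
  exact ⟨_, h1.add h3, by rw [mul_add, h2, h4]⟩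

theorem ThetaOn.const_mul {f f₁ : ℂ → ℂ} {s : Set ℂ} (h : ThetaOn f f₁ s) (k : ℂ) :
    ThetaOn (fun z => k * f z) (fun z => k * f₁ z) s := fun z hz => by
  obtain ⟨f', h1, h2⟩ := h z hz
  exact ⟨_, h1.const_mul k, by beta_reduce; rw [← h2]; ring⟩

theorem ThetaOn.mul {f f₁ g g₁ : ℂ → ℂ} {s : Set ℂ} (h : ThetaOn f f₁ s) (h' : ThetaOn g g₁ s) :
    ThetaOn (fun z => f z * g z) (fun z => f₁ z * g z + f z * g₁ z) s := fun z hz => by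
  obtain ⟨f', h1, h2⟩ := h z hz
  obtain ⟨g', h3, h4⟩ := h' z hz
  exact ⟨_, h1.mul h3, by beta_reduce; rw [← h2, ← h4]; ring⟩

/-- Chain rule for the Euler operator: `z d/dz` of `f ∘ w` is `q · (θ f) ∘ w` if
`z w'(z) = q(z) w(z)`. -/
theorem ThetaOn.comp {f f₁ w q : ℂ → ℂ} {s t : Set ℂ} (h : ThetaOn f f₁ t)
    (hw : ThetaOn w (fun z => q z * w z) s) (hst : Set.MapsTo w s t) :
    ThetaOn (fun z => f (w z)) (fun z => q z * f₁ (w z)) s := fun z hz => by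
  obtain ⟨f', h1, h2⟩ := h (w z) (hst hz)
  obtain ⟨w', h3, h4⟩ := hw z hz
  exact ⟨_, h1.comp z h3, by beta_reduce at h4 ⊢; rw [← h2]; linear_combination f' * h4⟩

/-! ### The hypergeometric equation and uniqueness of its regular solution -/

/-- `f` solves the hypergeometric equation `θ(θ+γ-1) f = z (θ+α)(θ+β) f` on `s`. -/
def IsHypSol (α β γ : ℂ) (f : ℂ → ℂ) (s : Set ℂ) : Prop :=
  ∃ f₁ f₂ : ℂ → ℂ, ThetaOn f f₁ s ∧ ThetaOn f₁ f₂ s ∧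
    ∀ z ∈ s, f₂ z + (γ - 1) * f₁ z = z * (f₂ z + (α + β) * f₁ z + α * β * f z)

theorem IsHypSol.mono {α β γ : ℂ} {f : ℂ → ℂ} {s t : Set ℂ} (h : IsHypSol α β γ f s)
    (hts : t ⊆ s) : IsHypSol α β γ f t := by
  obtain ⟨f₁, f₂, h1, h2, h3⟩ := h
  exact ⟨f₁, f₂, h1.mono hts, h2.mono hts, fun z hz => h3 z (hts hz)⟩

theorem IsHypSol.sub {α β γ : ℂ} {f g : ℂ → ℂ} {s : Set ℂ} (hf : IsHypSol α β γ f s)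
    (hg : IsHypSol α β γ g s) : IsHypSol α β γ (fun z => f z + -1 * g z) s := by
  obtain ⟨f₁, f₂, h1, h2, h3⟩ := hf
  obtain ⟨g₁, g₂, k1, k2, k3⟩ := hg
  refine ⟨_, _, h1.add (k1.const_mul (-1)), h2.add (k2.const_mul (-1)), fun z hz => ?_⟩
  linear_combination h3 z hz - k3 z hz

theorem IsHypSol.symm {α β γ : ℂ} {f : ℂ → ℂ} {s : Set ℂ} (h : IsHypSol α β γ f s) :
    IsHypSol β α γ f s := by
  obtain ⟨f₁, f₂, h1, h2, h3⟩ := h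
  exact ⟨f₁, f₂, h1, h2, fun z hz => by rw [h3 z hz]; ring⟩

theorem IsHypSol.differentiableOn {α β γ : ℂ} {f : ℂ → ℂ} {s : Set ℂ} (h : IsHypSol α β γ f s) :
    DifferentiableOn ℂ f s := by
  obtain ⟨f₁, f₂, h1, -⟩ := h
  exact h1.differentiableOn

/-- The exponents at the origin are `0` and `1 - γ`. A nonzero solution vanishing at `0` to order `n
≥ 1` would force `n = 1 - γ`, which the hypothesis on `γ` excludes. -/
theorem IsHypSol.eventually_zero {α β γ : ℂ} (hγ : ∀ k : ℕ, γ ≠ -k) {d : ℂ → ℂ} {s : Set ℂ}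
    (hs : IsOpen s) (h0 : (0 : ℂ) ∈ s) (hd : IsHypSol α β γ d s) (hd0 : d 0 = 0) :
    ∀ᶠ z in 𝓝 0, d z = 0 := by
  obtain ⟨f₁, f₂, h1, h2, h3⟩ := hd
  have hdan : AnalyticAt ℂ d 0 := (h1.differentiableOn.analyticOnNhd hs) 0 h0
  by_contra hne
  obtain ⟨n, e, he, he0, hde⟩ := hdan.exists_eventuallyEq_pow_smul_nonzero_iff.2 hne
  have hn : n ≠ 0 := by
    rintro rfl
    have := hde.self_of_nhds
    simp only [pow_zero, one_smul] at this
    exact he0 (this ▸ hd0)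
  simp only [sub_zero, smul_eq_mul] at hde
  -- First Euler derivative.
  set e₁ : ℂ → ℂ := fun z => n * e z + z * deriv e z with he₁
  have he₁an : AnalyticAt ℂ e₁ 0 :=
    (analyticAt_const.mul he).add (analyticAt_id.mul he.deriv)
  have key : ∀ (g u : ℂ → ℂ), AnalyticAt ℂ u 0 → (∀ᶠ z in 𝓝 0, g z = z ^ n * u z) →
      ∀ g₁, ThetaOn g g₁ s → ∀ᶠ z in 𝓝 0, g₁ z = z ^ n * (n * u z + z * deriv u z) := by
    intro g u hu hg g₁ hg₁
    filter_upwards [hg.eventually_nhds, hu.eventually_analyticAt, hs.mem_nhds h0]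
      with z hz hzu hzs
    rw [hg₁.eq_mul_deriv hzs, EventuallyEq.deriv_eq hz]
    have := ((hasDerivAt_pow n z).mul hzu.differentiableAt.hasDerivAt).deriv
    rw [show (fun z => z ^ n * u z) = ((fun x => x ^ n) * u) from rfl, this]
    obtain ⟨k, rfl⟩ := Nat.exists_eq_succ_of_ne_zero hn
    simp only [Nat.succ_eq_add_one, Nat.add_sub_cancel, pow_succ]
    ring
  have H1 := key d e he hde f₁ h1
  have H2 := key f₁ e₁ he₁an H1 f₂ h2
  set e₂ : ℂ → ℂ := fun z => n * e₁ z + z * deriv e₁ z with he₂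
  have he₂an : AnalyticAt ℂ e₂ 0 :=
    (analyticAt_const.mul he₁an).add (analyticAt_id.mul he₁an.deriv)
  -- The equation divided by `zⁿ`; its value at `0` is the indicial equation `n (n + γ - 1) e(0) =
  -- 0`.
  set L : ℂ → ℂ := fun z => e₂ z + (γ - 1) * e₁ z - z * (e₂ z + (α + β) * e₁ z + α * β * e z)
    with hL
  have hLan : AnalyticAt ℂ L 0 :=
    (he₂an.add (analyticAt_const.mul he₁an)).sub
      (analyticAt_id.mul ((he₂an.add (analyticAt_const.mul he₁an)).add (analyticAt_const.mul he)))
  have hL0 : ∀ᶠ z in 𝓝[≠] 0, L z = 0 := by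
    rw [eventually_nhdsWithin_iff]
    filter_upwards [H1, H2, hde, hs.mem_nhds h0] with z h1 h2 h4 h5 hz
    have := h3 z h5
    rw [h1, h2, h4] at this
    have hzn : z ^ n ≠ 0 := pow_ne_zero _ hz
    apply mul_left_cancel₀ hzn
    simp only [hL]
    linear_combination this
  have hL00 : L 0 = 0 := by
    have := (hLan.frequently_zero_iff_eventually_zero.1 hL0.frequently).self_of_nhds
    exact this
  simp only [hL, he₁, he₂, zero_mul, add_zero, sub_zero] at hL00
  have : (n : ℂ) * e 0 * (γ - -((n - 1 : ℕ) : ℂ)) = 0 := by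
    rw [Nat.cast_sub (Nat.one_le_iff_ne_zero.2 hn)]
    push_cast
    linear_combination hL00
  rcases mul_eq_zero.1 this with h | h
  · rcases mul_eq_zero.1 h with h | h
    · exact hn (by exact_mod_cast h)
    · exact he0 h
  · exact hγ _ (sub_eq_zero.1 h)

/-- Two solutions that are regular at the origin and agree there are equal. -/
theorem IsHypSol.eqOn {α β γ : ℂ} (hγ : ∀ k : ℕ, γ ≠ -k) {f g : ℂ → ℂ} {s : Set ℂ}
    (hs : IsOpen s) (hsc : IsPreconnected s) (h0 : (0 : ℂ) ∈ s) (hf : IsHypSol α β γ f s)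
    (hg : IsHypSol α β γ g s) (hfg : f 0 = g 0) : Set.EqOn f g s := by
  refine (hf.differentiableOn.analyticOnNhd hs).eqOn_of_preconnected_of_eventuallyEq
    (hg.differentiableOn.analyticOnNhd hs) hsc h0 ?_
  filter_upwards [(hf.sub hg).eventually_zero hγ hs h0 (by rw [hfg]; ring)] with z hz
  linear_combination hz

/-! ### The hypergeometric series -/

/-- The coefficients of the hypergeometric series `₂F₁(α, β; γ; z)`. -/
def hypCoef (α β γ : ℂ) (n : ℕ) : ℂ :=
  (ascPochhammer ℂ n).eval α * (ascPochhammer ℂ n).eval β /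
    ((ascPochhammer ℂ n).eval γ * n.factorial)

theorem asc_ne_zero {γ : ℂ} (hγ : ∀ k : ℕ, γ ≠ -k) (n : ℕ) : (ascPochhammer ℂ n).eval γ ≠ 0 := by
  induction n with
  | zero => simp
  | succ n ih =>
    rw [ascPochhammer_succ_eval]
    exact mul_ne_zero ih fun e => hγ n (eq_neg_of_add_eq_zero_left e)

theorem hypCoef_zero (α β γ : ℂ) : hypCoef α β γ 0 = 1 := by simp [hypCoef]

theorem hypCoef_succ {α β γ : ℂ} (hγ : ∀ k : ℕ, γ ≠ -k) (n : ℕ) :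
    ((n : ℂ) + 1) * (γ + n) * hypCoef α β γ (n + 1) = (α + n) * (β + n) * hypCoef α β γ n := by
  have h1 := asc_ne_zero hγ n
  have h2 : γ + n ≠ 0 := fun e => hγ n (eq_neg_of_add_eq_zero_left e)
  have h3 : (n.factorial : ℂ) ≠ 0 := by exact_mod_cast n.factorial_ne_zero
  have h4 : (n : ℂ) + 1 ≠ 0 := by exact_mod_cast n.succ_ne_zero
  simp only [hypCoef, ascPochhammer_succ_eval, Nat.factorial_succ, Nat.cast_mul, Nat.cast_succ]
  field_simp

end HornH5
end

noncomputable section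
namespace HornH5
open Filter Metric

/-! ### Bounds for Pochhammer symbols -/

theorem exists_bound_of_eventually_le {v : ℕ → ℝ} (n₀ : ℕ) (h : ∀ n, n₀ ≤ n → v (n + 1) ≤ v n) :
    ∃ C : ℝ, 0 < C ∧ ∀ n, v n ≤ C := by
  have hfin : ∀ n, n ≤ n₀ → v n ≤ ∑ i ∈ Finset.range (n₀ + 1), |v i| := fun n hn =>
    (le_abs_self _).trans (Finset.single_le_sum (f := fun i => |v i|) (fun i _ => abs_nonneg _)
      (Finset.mem_range.2 (by omega)))
  refine ⟨∑ i ∈ Finset.range (n₀ + 1), |v i| + 1, by positivity, fun n => ?_⟩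
  suffices v n ≤ ∑ i ∈ Finset.range (n₀ + 1), |v i| by linarith
  rcases le_total n n₀ with hn | hn
  · exact hfin n hn
  · induction n, hn using Nat.le_induction with
    | base => exact hfin _ le_rfl
    | succ k hk ih => exact (h k hk).trans ih

/-- Each new factor has modulus at most `p + n`, and by Bernoulli this is at most `(n + 1) ((n + 2)
/ (n + 1))^p`, so the product telescopes. -/
theorem norm_asc_le {z : ℂ} {p : ℕ} (hp : ‖z‖ ≤ p) (n : ℕ) :
    ‖(ascPochhammer ℂ n).eval z‖ ≤ ((n : ℝ) + 1) ^ p * n.factorial := by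
  induction n with
  | zero => simp
  | succ n ih =>
    rw [ascPochhammer_succ_eval, norm_mul, Nat.factorial_succ]
    have h1 : ‖z + n‖ ≤ p + n := (norm_add_le _ _).trans (by
      rw [Complex.norm_natCast]; gcongr)
    have hn : (0 : ℝ) < (n : ℝ) + 1 := by positivity
    have h2 : (p : ℝ) + n ≤ ((n : ℝ) + 1) * (((n : ℝ) + 2) / (n + 1)) ^ p := by
      have := one_add_mul_le_pow (a := 1 / ((n : ℝ) + 1)) (by
        have : (0 : ℝ) ≤ 1 / (n + 1) := by positivity
        linarith) p
      have e : ((n : ℝ) + 2) / (n + 1) = 1 + 1 / ((n : ℝ) + 1) := by field_simp; ring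
      rw [e]
      calc (p : ℝ) + n ≤ ((n : ℝ) + 1) * (1 + p * (1 / ((n : ℝ) + 1))) := by
            field_simp
            linarith
        _ ≤ _ := by gcongr
    calc ‖(ascPochhammer ℂ n).eval z‖ * ‖z + n‖
        ≤ (((n : ℝ) + 1) ^ p * n.factorial) *
            (((n : ℝ) + 1) * (((n : ℝ) + 2) / (n + 1)) ^ p) := by
          gcongr
          exact h1.trans h2
      _ = (((n + 1 : ℕ) : ℝ) + 1) ^ p * (((n + 1) * n.factorial : ℕ) : ℝ) := by
          rw [div_pow]
          push_cast
          field_simp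
          ring

theorem exists_norm_asc_le (z : ℂ) : ∃ p : ℕ, ∀ n : ℕ,
    ‖(ascPochhammer ℂ n).eval z‖ ≤ ((n : ℝ) + 1) ^ p * n.factorial := by
  obtain ⟨p, hp⟩ := exists_nat_ge ‖z‖
  exact ⟨p, norm_asc_le hp⟩

theorem exists_le_norm_asc {z : ℂ} (hz : ∀ k : ℕ, z ≠ -k) : ∃ (C : ℝ) (p : ℕ), 0 < C ∧
    ∀ n : ℕ, (n.factorial : ℝ) ≤ C * ((n : ℝ) + 1) ^ p * ‖(ascPochhammer ℂ n).eval z‖ := by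
  obtain ⟨G, hG⟩ := exists_nat_ge ‖z‖
  -- With this exponent the Bernoulli gain `1 + p / (n + 1)` outweighs the loss `(n - G) / (n + 1)`
  -- as soon as `n ≥ 2G + 2`, and the quotient is nonincreasing from there on.
  set p := 2 * G + 2 with hp
  have hpos : ∀ n : ℕ, 0 < ((n : ℝ) + 1) ^ p * ‖(ascPochhammer ℂ n).eval z‖ := fun n =>
    mul_pos (by positivity) (norm_pos_iff.2 (asc_ne_zero hz n))
  obtain ⟨C, hC0, hC⟩ := exists_bound_of_eventually_le
    (v := fun n => n.factorial / (((n : ℝ) + 1) ^ p * ‖(ascPochhammer ℂ n).eval z‖))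
    (2 * G + 2) (by
      intro n hn
      have hn' : (2 * G + 2 : ℝ) ≤ n := by exact_mod_cast hn
      have hG0 : (0 : ℝ) ≤ G := Nat.cast_nonneg G
      rw [div_le_div_iff₀ (hpos _) (hpos _), ascPochhammer_succ_eval, norm_mul, Nat.factorial_succ]
      have h1 : (n : ℝ) - G ≤ ‖z + n‖ := by
        have := norm_sub_le (z + n) z
        rw [add_sub_cancel_left, Complex.norm_natCast] at this
        linarith
      have h2 := one_add_mul_le_pow (a := 1 / ((n : ℝ) + 1)) (by
        have : (0 : ℝ) ≤ 1 / (n + 1) := by positivity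
        linarith) p
      have e : ((n : ℝ) + 2) = (n + 1) * (1 + 1 / ((n : ℝ) + 1)) := by field_simp; ring
      have h3 : ((n : ℝ) + 1) ≤ (1 + 1 / ((n : ℝ) + 1)) ^ p * ‖z + n‖ := by
        calc ((n : ℝ) + 1) ≤ (1 + p * (1 / ((n : ℝ) + 1))) * (n - G) := by
              rw [hp]
              push_cast
              have : (1 + (2 * (G : ℝ) + 2) * (1 / ((n : ℝ) + 1))) * (n - G) - (n + 1) =
                ((G + 1) * n - (2 * G ^ 2 + 3 * G + 1)) / (n + 1) := by field_simp; ring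
              have h4 : 0 ≤ ((G + 1) * n - (2 * G ^ 2 + 3 * G + 1)) / ((n : ℝ) + 1) := by
                apply div_nonneg _ (by positivity)
                nlinarith
              linarith
          _ ≤ _ := by
              apply mul_le_mul h2 h1 (by linarith) (by positivity)
      have h5 : (((n + 1 : ℕ) : ℝ) + 1) ^ p =
          ((n : ℝ) + 1) ^ p * (1 + 1 / ((n : ℝ) + 1)) ^ p := by
        rw [← mul_pow, ← e]; push_cast; ring
      rw [h5]
      push_cast
      have h6 : 0 ≤ (n.factorial : ℝ) * ((n : ℝ) + 1) ^ p * ‖(ascPochhammer ℂ n).eval z‖ := by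
        positivity
      have := mul_le_mul_of_nonneg_left h3 h6
      linarith)
  refine ⟨C, p, hC0, fun n => ?_⟩
  have := hC n
  rw [div_le_iff₀ (hpos n)] at this
  linarith

theorem tame_one : Tame fun _ => 1 := fun r h0 h1 =>
  ⟨1, fun n => by simpa using pow_le_one₀ h0.le h1.le⟩

theorem tame_hypCoef (α β : ℂ) {γ : ℂ} (hγ : ∀ k : ℕ, γ ≠ -k) : Tame (hypCoef α β γ) := by
  obtain ⟨p, hp⟩ := exists_norm_asc_le α
  obtain ⟨q, hq⟩ := exists_norm_asc_le β
  obtain ⟨C, r, hC0, hr⟩ := exists_le_norm_asc hγ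
  refine tame_one.of_le C (p + q + r) fun n => ?_
  have hγn : 0 < ‖(ascPochhammer ℂ n).eval γ‖ := norm_pos_iff.2 (asc_ne_zero hγ n)
  rw [hypCoef, norm_div, norm_mul, norm_mul, Complex.norm_natCast, norm_one, mul_one,
    div_le_iff₀ (by positivity)]
  calc ‖(ascPochhammer ℂ n).eval α‖ * ‖(ascPochhammer ℂ n).eval β‖
      ≤ (((n : ℝ) + 1) ^ p * n.factorial) * (((n : ℝ) + 1) ^ q * n.factorial) := by
        gcongr
        · exact hp n
        · exact hq n
    _ ≤ (((n : ℝ) + 1) ^ p * (C * ((n : ℝ) + 1) ^ r * ‖(ascPochhammer ℂ n).eval γ‖)) *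
          (((n : ℝ) + 1) ^ q * n.factorial) := by
        gcongr
        exact hr n
    _ = _ := by ring

/-- Multiplication by `z` is `shiftCoef`, and coefficientwise the equation is `hypCoef_succ`. -/
theorem isHypSol_psum (α β : ℂ) {γ : ℂ} (hγ : ∀ k : ℕ, γ ≠ -k) :
    IsHypSol α β γ (psum (hypCoef α β γ)) (ball 0 1) := by
  have hc := tame_hypCoef α β hγ
  refine ⟨_, _, hc.thetaOn, hc.nat_mul.thetaOn, fun z hz => ?_⟩
  have hz' : ‖z‖ < 1 := by simpa using hz
  have e1 : ∀ k l : ℂ, Tame fun n => (n : ℂ) * (n * hypCoef α β γ n) +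
      (k * (n * hypCoef α β γ n) + l * hypCoef α β γ n) := fun k l =>
    hc.nat_mul.nat_mul.add ((hc.nat_mul.const_mul k).add (hc.const_mul l))
  have e2 : ∀ k l : ℂ, psum (fun n => (n : ℂ) * (n * hypCoef α β γ n) +
      (k * (n * hypCoef α β γ n) + l * hypCoef α β γ n)) z =
      psum (fun n => (n : ℂ) * (n * hypCoef α β γ n)) z +
        (k * psum (fun n => n * hypCoef α β γ n) z + l * psum (hypCoef α β γ) z) := fun k l => by
    rw [psum_add hc.nat_mul.nat_mul ((hc.nat_mul.const_mul k).add (hc.const_mul l)) hz',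
      psum_add (hc.nat_mul.const_mul k) (hc.const_mul l) hz', psum_const_mul, psum_const_mul]
  have h3 := e2 (γ - 1) 0
  have h4 := e2 (α + β) (α * β)
  have h5 := psum_shiftCoef (e1 (α + β) (α * β)) hz'
  have h6 : psum (shiftCoef fun n => (n : ℂ) * (n * hypCoef α β γ n) +
      ((α + β) * (n * hypCoef α β γ n) + α * β * hypCoef α β γ n)) z =
      psum (fun n => (n : ℂ) * (n * hypCoef α β γ n) +
      ((γ - 1) * (n * hypCoef α β γ n) + 0 * hypCoef α β γ n)) z := by
    refine tsum_congr fun n => ?_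
    congr 1
    cases n with
    | zero => simp [shiftCoef]
    | succ n =>
      simp only [shiftCoef]
      push_cast
      linear_combination - hypCoef_succ (α := α) (β := β) hγ n
  rw [h6, h4, h3] at h5
  linear_combination h5

/-! ### The expansion on the slit plane -/

/-- Coefficients of the expansion of `(1 + w) ^ (-2α) ₂F₁(α, β; γ; 4w / (1 + w)²)` in powers of
`w`. -/
def quadCoef (α β γ : ℂ) : ℕ → ℂ
  | 0 => 1
  | 1 => 2 * (2 * β - γ) * α / γ
  | n + 2 => (2 * (2 * β - γ) * (n + 1 + α) * quadCoef α β γ (n + 1) +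
      (n + 2 * α) * (n + 1 + 2 * α - γ) * quadCoef α β γ n) / ((n + 2) * (γ + (n + 1)))

theorem exists_le_norm_add_nat {γ : ℂ} (hγ : ∀ k : ℕ, γ ≠ -k) :
    ∃ C : ℝ, 1 ≤ C ∧ ∀ n : ℕ, (n : ℝ) + 1 ≤ C * ‖γ + n‖ := by
  obtain ⟨C, p, hC0, hC⟩ := exists_le_norm_asc hγ
  obtain ⟨G, hG⟩ := exists_nat_ge ‖γ‖
  have hpos : ∀ n : ℕ, 0 < ‖γ + n‖ := fun n =>
    norm_pos_iff.2 fun e => hγ n (eq_neg_of_add_eq_zero_left e)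
  have hs : ∀ n : ℕ, 0 ≤ ((n : ℝ) + 1) / ‖γ + n‖ := fun n => by positivity
  set S := ∑ n ∈ Finset.range (2 * G + 1), ((n : ℝ) + 1) / ‖γ + n‖
  have hS : 0 ≤ S := Finset.sum_nonneg fun i _ => hs i
  refine ⟨2 + S, by linarith, fun n => ?_⟩
  rw [← div_le_iff₀ (hpos n)]
  rcases lt_or_ge n (2 * G + 1) with hn | hn
  · have := Finset.single_le_sum (f := fun n : ℕ => ((n : ℝ) + 1) / ‖γ + n‖) (fun i _ => hs i)
      (Finset.mem_range.2 hn)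
    linarith
  · have hn' : (2 * G + 1 : ℝ) ≤ n := by exact_mod_cast hn
    have h1 : (n : ℝ) - G ≤ ‖γ + n‖ := by
      have := norm_sub_le (γ + n) γ
      rw [add_sub_cancel_left, Complex.norm_natCast] at this
      linarith
    rw [div_le_iff₀ (hpos n)]
    nlinarith [hpos n]

/-- The product is the binomial coefficient `C(M + N, N)`. This keeps a product of about `M`
factors, some as large as `M`, exponential in `M`. -/
theorem prod_one_add_div (M N : ℕ) :
    ∏ j ∈ Finset.range N, (1 + (M : ℝ) / (j + 1)) ≤ 2 ^ (M + N) := by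
  have h : ∏ j ∈ Finset.range N, (1 + (M : ℝ) / (j + 1)) = ((M + N).choose N : ℝ) := by
    induction N with
    | zero => simp
    | succ N ih =>
      rw [Finset.prod_range_succ, ih]
      have := Nat.add_one_mul_choose_eq (M + N) N
      have h2 : ((M + N + 1 : ℕ) : ℝ) * ((M + N).choose N : ℝ) =
        ((M + N + 1).choose (N + 1) : ℝ) * (N + 1 : ℕ) := by exact_mod_cast this
      rw [show M + (N + 1) = M + N + 1 by ring]
      push_cast at h2 ⊢
      field_simp
      linarith
  rw [h]
  exact_mod_cast Nat.choose_le_two_pow (M + N) N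

/-- Exponential bound for two-term recurrences. -/
theorem recurrence_bound {v b : ℕ → ℝ} {V₀ C₁ : ℝ} {M N : ℕ} (hC₁ : 1 ≤ C₁)
    (h0 : v 0 ≤ V₀) (h1 : v 1 ≤ V₀) (hV₀ : 0 ≤ V₀) (hb0 : ∀ n, 0 ≤ b n)
    (hrec : ∀ n, v (n + 2) ≤ b n * max (v (n + 1)) (v n))
    (hb : ∀ n, b n ≤ C₁ * (1 + (M : ℝ) / (n + 1)) ^ 2) (hb1 : ∀ n, N ≤ n → b n ≤ 1) (n : ℕ) :
    v n ≤ V₀ * (C₁ ^ N * (2 ^ (M + N)) ^ 2) := by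
  set q : ℕ → ℝ := fun n => C₁ * (1 + (M : ℝ) / (n + 1)) ^ 2
  have hq : ∀ n, 1 ≤ q n := fun n => by
    have : (1 : ℝ) ≤ (1 + (M : ℝ) / (n + 1)) ^ 2 := by
      apply one_le_pow₀
      have : (0 : ℝ) ≤ M / (n + 1) := by positivity
      linarith
    calc (1 : ℝ) = 1 * 1 := by ring
      _ ≤ q n := mul_le_mul hC₁ this zero_le_one (by linarith)
  have hP1 : ∀ n, 1 ≤ ∏ j ∈ Finset.range n, q j := fun n => by
    induction n with
    | zero => simp
    | succ n ih =>
      rw [Finset.prod_range_succ]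
      nlinarith [hq n]
  -- The running maximum of two consecutive terms grows by at most `q n` while `n < N` and not at
  -- all afterwards, so only `N` factors accumulate.
  have key : ∀ n, max (v (n + 1)) (v n) ≤ V₀ * ∏ j ∈ Finset.range (min n N), q j := by
    intro n
    induction n with
    | zero => simpa using ⟨h1, h0⟩
    | succ n ih =>
      have hmono : V₀ * ∏ j ∈ Finset.range (min n N), q j ≤
          V₀ * ∏ j ∈ Finset.range (min (n + 1) N), q j := by
        refine mul_le_mul_of_nonneg_left ?_ hV₀
        rcases lt_or_ge n N with h | h
        · rw [min_eq_left h.le, min_eq_left (show n + 1 ≤ N by omega), Finset.prod_range_succ]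
          nlinarith [hP1 n, hq n]
        · rw [min_eq_right h, min_eq_right (by omega)]
      refine max_le ?_ ((le_max_left _ _).trans (ih.trans hmono))
      rcases lt_or_ge n N with h | h
      · rw [min_eq_left h.le] at ih
        rw [min_eq_left (show n + 1 ≤ N by omega), Finset.prod_range_succ]
        calc v (n + 2) ≤ b n * max (v (n + 1)) (v n) := hrec n
          _ ≤ b n * (V₀ * ∏ j ∈ Finset.range n, q j) := by gcongr; exact hb0 n
          _ ≤ q n * (V₀ * ∏ j ∈ Finset.range n, q j) := by
              refine mul_le_mul_of_nonneg_right (hb n) ?_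
              exact mul_nonneg hV₀ (zero_le_one.trans (hP1 n))
          _ = _ := by ring
      · refine le_trans ?_ hmono
        calc v (n + 2) ≤ b n * max (v (n + 1)) (v n) := hrec n
          _ ≤ b n * (V₀ * ∏ j ∈ Finset.range (min n N), q j) := by gcongr; exact hb0 n
          _ ≤ 1 * _ := by
              refine mul_le_mul_of_nonneg_right (hb1 n h) ?_
              exact mul_nonneg hV₀ (zero_le_one.trans (hP1 _))
          _ = _ := one_mul _
  refine ((le_max_right _ _).trans (key n)).trans ?_
  refine mul_le_mul_of_nonneg_left ?_ hV₀
  have h2 : ∏ j ∈ Finset.range (min n N), q j ≤ ∏ j ∈ Finset.range N, q j :=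
    monotone_nat_of_le_succ (f := fun n => ∏ j ∈ Finset.range n, q j) (fun n => by
      rw [Finset.prod_range_succ]
      nlinarith [hP1 n, hq n]) (min_le_right n N)
  refine h2.trans ?_
  simp only [q]
  rw [Finset.prod_mul_distrib, Finset.prod_const, Finset.card_range, Finset.prod_pow]
  gcongr
  exact prod_one_add_div M N

/-- The point is that `K` does not depend on `M`. Once `n ≥ L M` the `ρ`-weighted recurrence
contracts, and the first `L M` multipliers `C₁ (1 + M / (n + 1))²` have a product exponential in
`M`. -/
theorem exists_quadCoef_bound {γ : ℂ} (hγ : ∀ k : ℕ, γ ≠ -k) {ρ : ℝ} (hρ0 : 0 < ρ) (hρ : ρ < 1) :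
    ∃ K : ℝ, 1 ≤ K ∧ ∀ M : ℕ, 1 ≤ M → ∀ α β : ℂ, ‖α‖ ≤ M → ‖β‖ ≤ M →
      ∀ n, ‖quadCoef α β γ n‖ * ρ ^ n ≤ K ^ M := by
  obtain ⟨D, hD1, hD⟩ := exists_le_norm_add_nat hγ
  obtain ⟨G, hG⟩ := exists_nat_ge ‖γ‖
  have hpos : ∀ n : ℕ, 0 < ‖γ + n‖ := fun n =>
    norm_pos_iff.2 fun e => hγ n (eq_neg_of_add_eq_zero_left e)
  have hG0 : (0 : ℝ) ≤ G := Nat.cast_nonneg G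
  -- Chosen so that the final estimate `12 ε + ρ + 11 ε` equals `1 - ε`.
  set ε : ℝ := (1 - ρ) / 24 with hε
  have hε0 : 0 < ε := by simp only [hε]; linarith
  -- For `n ≥ L M` this makes both `M` and `G` at most `ε (n + 1)`.
  obtain ⟨L, hL⟩ := exists_nat_ge ((1 + G) / ε)
  rw [div_le_iff₀ hε0] at hL
  have hL0 : (0 : ℝ) ≤ L := Nat.cast_nonneg L
  set C₁ : ℝ := 4 * (2 + G) * D
  have hC₁ : 1 ≤ C₁ := by simp only [C₁]; nlinarith
  set V : ℝ := 4 * (2 + G) * D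
  refine ⟨V * 2 * 2 * (C₁ ^ L * (2 ^ (1 + L)) ^ 2), ?_, ?_⟩
  · have : (1 : ℝ) ≤ C₁ ^ L * (2 ^ (1 + L)) ^ 2 := by
      have h1 : (1 : ℝ) ≤ C₁ ^ L := one_le_pow₀ hC₁
      have h2 : (1 : ℝ) ≤ (2 ^ (1 + L)) ^ 2 := one_le_pow₀ (one_le_pow₀ (by norm_num))
      nlinarith
    have hV : 1 ≤ V := hC₁
    nlinarith
  intro M hM α β hα hβ n
  have hM1 : (1 : ℝ) ≤ M := by exact_mod_cast hM
  have h2β : ‖2 * β - γ‖ ≤ 2 * M + G := by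
    refine (norm_sub_le _ _).trans ?_
    rw [norm_mul]
    norm_num
    linarith
  -- The multiplier of the recurrence for `‖quadCoef n‖ ρⁿ`, with the norms of the parameters
  -- replaced by their bounds.
  set b : ℕ → ℝ := fun n => ρ * (2 * (2 * M + G) * (n + 1 + M) +
    ρ * ((n + 2 * M) * (n + 1 + 2 * M + G))) / ((n + 2) * ‖γ + (n + 1)‖) with hb
  have hpos' : ∀ n : ℕ, 0 < ‖γ + (n + 1)‖ := fun n => by
    have := hpos (n + 1); push_cast at this; exact this
  have hD' : ∀ n : ℕ, (n : ℝ) + 2 ≤ D * ‖γ + (n + 1)‖ := fun n => by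
    have := hD (n + 1); push_cast at this; linarith
  have hrb := recurrence_bound (v := fun n => ‖quadCoef α β γ n‖ * ρ ^ n) (b := b)
    (V₀ := V * M * M) (C₁ := C₁) (M := M) (N := L * M) hC₁ ?_ ?_ (by positivity) ?_ ?_ ?_ ?_ n
  · refine hrb.trans ?_
    have hM2 : (M : ℝ) ≤ 2 ^ M := by exact_mod_cast M.lt_two_pow_self.le
    have hVM : V ≤ V ^ M := le_self_pow₀ hC₁ (by omega)
    calc V * M * M * (C₁ ^ (L * M) * (2 ^ (M + L * M)) ^ 2)
        ≤ V ^ M * 2 ^ M * 2 ^ M * (C₁ ^ (L * M) * (2 ^ (M + L * M)) ^ 2) := by gcongr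
      _ = _ := by
        have h1 : ((2 : ℝ) ^ (M + L * M)) ^ 2 = ((2 ^ (1 + L)) ^ 2) ^ M := by
          rw [← pow_mul, ← pow_mul, ← pow_mul]
          congr 1
          ring
        have aux : ∀ v c t : ℝ, v ^ M * 2 ^ M * 2 ^ M * (c ^ (L * M) * t ^ M) =
            (v * 2 * 2 * (c ^ L * t)) ^ M := fun v c t => by
          rw [pow_mul]; simp only [mul_pow]
        rw [h1]
        exact aux _ _ _
  · simp only [quadCoef, norm_one, pow_zero, mul_one]
    have hV : 1 ≤ V := hC₁
    exact one_le_mul_of_one_le_of_one_le (one_le_mul_of_one_le_of_one_le hV hM1) hM1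
  · simp only [quadCoef, pow_one]
    rw [norm_div, norm_mul, norm_mul]
    have h0 := hD 0
    have h00 := hpos 0
    simp only [Nat.cast_zero, add_zero, zero_add] at h0 h00
    rw [div_mul_eq_mul_div, div_le_iff₀ h00]
    have h3 : (2 : ℝ) * M + G ≤ (2 + G) * M := by nlinarith
    calc ‖(2 : ℂ)‖ * ‖2 * β - γ‖ * ‖α‖ * ρ ≤ 2 * ((2 + G) * M) * M * 1 := by
          gcongr
          · norm_num
          · exact h2β.trans h3
      _ ≤ (4 * (2 + G) * M * M) * 1 := by
          have : 0 ≤ (2 + (G : ℝ)) * M * M := by positivity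
          linarith
      _ ≤ (4 * (2 + G) * M * M) * (D * ‖γ‖) := by gcongr
      _ = V * M * M * ‖γ‖ := by simp only [V]; ring
  · intro n
    simp only [hb]
    positivity
  · intro n
    simp only [quadCoef, hb]
    have hn : ‖((n : ℂ) + 2) * (γ + (n + 1))‖ = ((n : ℝ) + 2) * ‖γ + (n + 1)‖ := by
      rw [norm_mul]
      congr 1
      exact_mod_cast Complex.norm_natCast (n + 2)
    rw [norm_div, hn, div_mul_eq_mul_div, div_mul_eq_mul_div]
    refine div_le_div_of_nonneg_right ?_ (by positivity)
    have a1 : ‖(n : ℂ) + 1 + α‖ ≤ n + 1 + M := (norm_add_le _ _).trans (by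
      gcongr; exact_mod_cast (Complex.norm_natCast (n + 1)).le)
    have a2 : ‖(n : ℂ) + 2 * α‖ ≤ n + 2 * M := (norm_add_le _ _).trans (by
      rw [norm_mul, Complex.norm_natCast]; norm_num; linarith)
    have a3 : ‖(n : ℂ) + 1 + 2 * α - γ‖ ≤ n + 1 + 2 * M + G := (norm_sub_le _ _).trans (by
      gcongr
      refine (norm_add_le _ _).trans ?_
      have : ‖(n : ℂ) + 1‖ ≤ n + 1 := by exact_mod_cast (Complex.norm_natCast (n + 1)).le
      rw [norm_mul]; norm_num; linarith)
    set X := max (‖quadCoef α β γ (n + 1)‖ * ρ ^ (n + 1)) (‖quadCoef α β γ n‖ * ρ ^ n) with hX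
    have hX0 : 0 ≤ X := le_max_of_le_left (by positivity)
    calc _ ≤ (‖2 * (2 * β - γ) * (n + 1 + α) * quadCoef α β γ (n + 1)‖ +
          ‖(n + 2 * α) * (n + 1 + 2 * α - γ) * quadCoef α β γ n‖) * ρ ^ (n + 2) := by
          gcongr; exact norm_add_le _ _
      _ = ρ * (2 * ‖2 * β - γ‖ * ‖(n : ℂ) + 1 + α‖ *
            (‖quadCoef α β γ (n + 1)‖ * ρ ^ (n + 1)) +
          ρ * ((‖(n : ℂ) + 2 * α‖ * ‖(n : ℂ) + 1 + 2 * α - γ‖) *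
            (‖quadCoef α β γ n‖ * ρ ^ n))) := by
          simp only [norm_mul, Complex.norm_ofNat]; ring
      _ ≤ ρ * (2 * (2 * M + G) * (n + 1 + M) * X +
          ρ * (((n + 2 * M) * (n + 1 + 2 * M + G)) * X)) := by
          gcongr
          · exact le_max_left _ _
          · exact le_max_right _ _
      _ = _ := by ring
  · intro n
    simp only [hb]
    rw [div_le_iff₀ (by have := hpos' n; positivity)]
    have hn0 : (0 : ℝ) ≤ n := Nat.cast_nonneg n
    have s1 : ρ * (2 * (2 * M + G) * (n + 1 + M) + ρ * ((n + 2 * M) * (n + 1 + 2 * M + G))) ≤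
        4 * (2 + G) * (n + 1 + M) ^ 2 := by
      have t1 : (2 : ℝ) * M + G ≤ (2 + G) * (n + 1 + M) := by nlinarith
      have t2 : (n : ℝ) + 2 * M ≤ 2 * (n + 1 + M) := by linarith
      have t3 : (n : ℝ) + 1 + 2 * M + G ≤ (2 + G) * (n + 1 + M) := by nlinarith
      calc _ ≤ 1 * (2 * ((2 + (G : ℝ)) * ((n : ℝ) + 1 + M)) * ((n : ℝ) + 1 + M) +
            1 * ((2 * ((n : ℝ) + 1 + M)) * ((2 + (G : ℝ)) * ((n : ℝ) + 1 + M)))) := by gcongr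
        _ = _ := by ring
    refine s1.trans ?_
    have s2 : (n : ℝ) + 1 + M = (1 + M / (n + 1)) * (n + 1) := by field_simp
    calc 4 * (2 + G) * ((n : ℝ) + 1 + M) ^ 2
        = 4 * (2 + G) * (1 + M / ((n : ℝ) + 1)) ^ 2 * ((n + 1) * (n + 1)) := by
          rw [s2]; ring
      _ ≤ 4 * (2 + G) * (1 + M / ((n : ℝ) + 1)) ^ 2 * ((n + 2) * (D * ‖γ + (n + 1)‖)) := by
          gcongr
          · linarith
          · linarith [hD' n]
      _ = _ := by simp only [C₁]; ring
  · intro n hn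
    simp only [hb]
    have hn' : (L : ℝ) * M ≤ n := by exact_mod_cast hn
    rw [div_le_one (by have := hpos' n; positivity)]
    set x : ℝ := n + 1 with hx
    have hn0 : (0 : ℝ) ≤ n := Nat.cast_nonneg n
    have hMx : (1 + G) * (M : ℝ) ≤ ε * x := by
      calc (1 + G) * (M : ℝ) ≤ (L * ε) * M := by gcongr
        _ = ε * (L * M) := by ring
        _ ≤ ε * x := by gcongr; linarith
    have hM' : (M : ℝ) ≤ ε * x := by nlinarith
    have hG' : (G : ℝ) ≤ ε * x := by nlinarith
    have hx0 : 0 < x := by positivity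
    have h1 : x - G ≤ ‖γ + (n + 1)‖ := by
      have := norm_sub_le (γ + (n + 1)) γ
      have e : ‖γ + ((n : ℂ) + 1) - γ‖ = x := by
        rw [add_sub_cancel_left, hx]; exact_mod_cast Complex.norm_natCast (n + 1)
      rw [e] at this
      linarith
    have hε1 : ε ≤ 1 / 24 := by simp only [hε]; linarith
    calc ρ * (2 * (2 * M + G) * (x + M) + ρ * ((n + 2 * M) * (x + 2 * M + G)))
        ≤ ρ * (2 * (2 * (ε * x) + ε * x) * (x + ε * x) +
            ρ * ((x + 2 * (ε * x)) * (x + 2 * (ε * x) + ε * x))) := by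
          gcongr
          linarith
      _ = (ρ * (6 * ε * (1 + ε) + ρ * ((1 + 2 * ε) * (1 + 3 * ε)))) * (x * x) := by ring
      _ ≤ (1 - ε) * (x * x) := by
          gcongr
          have t1 : 6 * ε * (1 + ε) ≤ 12 * ε := by nlinarith
          have t2 : (1 + 2 * ε) * (1 + 3 * ε) ≤ 1 + 11 * ε := by nlinarith
          calc ρ * (6 * ε * (1 + ε) + ρ * ((1 + 2 * ε) * (1 + 3 * ε)))
              ≤ ρ * (12 * ε + ρ * (1 + 11 * ε)) := by gcongr
            _ = 12 * ε * ρ + ρ * ρ + 11 * ε * (ρ * ρ) := by ring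
            _ ≤ 12 * ε * 1 + ρ * 1 + 11 * ε * (1 * 1) := by gcongr
            _ = 1 - ε := by rw [hε]; ring
      _ = x * (x - ε * x) := by ring
      _ ≤ (n + 2) * ‖γ + (n + 1)‖ := by
          apply mul_le_mul _ _ _ (by positivity)
          · linarith
          · linarith
          · nlinarith

end HornH5
end

noncomputable section
namespace HornH5
open Filter Metric

/-! ### The differential equation in the disc variable -/

theorem Tame.quadratic {c : ℕ → ℂ} (hc : Tame c) (k₂ k₁ k₀ : ℂ) :
    Tame fun n => k₂ * (n * (n * c n)) + (k₁ * (n * c n) + k₀ * c n) :=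
  (hc.nat_mul.nat_mul.const_mul k₂).add ((hc.nat_mul.const_mul k₁).add (hc.const_mul k₀))

theorem psum_quadratic {c : ℕ → ℂ} (hc : Tame c) (k₂ k₁ k₀ : ℂ) {z : ℂ} (hz : ‖z‖ < 1) :
    psum (fun n => k₂ * (n * (n * c n)) + (k₁ * (n * c n) + k₀ * c n)) z =
      k₂ * psum (fun n => (n : ℂ) * (n * c n)) z +
        (k₁ * psum (fun n => (n : ℂ) * c n) z + k₀ * psum c z) := by
  rw [psum_add (hc.nat_mul.nat_mul.const_mul k₂)
      ((hc.nat_mul.const_mul k₁).add (hc.const_mul k₀)) hz,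
    psum_add (hc.nat_mul.const_mul k₁) (hc.const_mul k₀) hz, psum_const_mul, psum_const_mul,
    psum_const_mul]

theorem tame_quadCoef (α β : ℂ) {γ : ℂ} (hγ : ∀ k : ℕ, γ ≠ -k) : Tame (quadCoef α β γ) := by
  intro r h0 h1
  obtain ⟨K, -, hK⟩ := exists_quadCoef_bound hγ h0 h1
  obtain ⟨M, hM⟩ := exists_nat_ge (max ‖α‖ (max ‖β‖ 1))
  simp only [max_le_iff] at hM
  exact ⟨K ^ M, hK M (by exact_mod_cast hM.2.2) α β hM.1 hM.2.1⟩

/-- This is the hypergeometric equation pulled back by `y = 4w / (1 + w)²` with the factor `(1 +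
w)^(2α)` removed. Sorted by powers of `w`, the coefficient of `w^(n + 2)` is the recurrence defining
`quadCoef`. -/
theorem psum_quadCoef_eq (α β : ℂ) {γ : ℂ} (hγ : ∀ k : ℕ, γ ≠ -k) {w : ℂ} (hw : ‖w‖ < 1) :
    (1 - w ^ 2) * psum (fun n => (n : ℂ) * (n * quadCoef α β γ n)) w +
      ((γ - 1) + w * (2 * γ - 4 * β) + w ^ 2 * (γ - 1 - 4 * α)) *
        psum (fun n => (n : ℂ) * quadCoef α β γ n) w +
      (2 * α * w * (γ - 2 * β) + 2 * α * w ^ 2 * (γ - 1 - 2 * α)) *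
        psum (quadCoef α β γ) w = 0 := by
  have hc := tame_quadCoef α β hγ
  have t1 := hc.quadratic 0 (2 * γ - 4 * β) (2 * α * (γ - 2 * β))
  have t2 := hc.quadratic (-1) (γ - 1 - 4 * α) (2 * α * (γ - 1 - 2 * α))
  have e0 := psum_quadratic hc 1 (γ - 1) 0 hw
  have e1 := psum_quadratic hc 0 (2 * γ - 4 * β) (2 * α * (γ - 2 * β)) hw
  have e2 := psum_quadratic hc (-1) (γ - 1 - 4 * α) (2 * α * (γ - 1 - 2 * α)) hw
  have s1 := psum_shiftCoef t1 hw
  have s2 := psum_shiftCoef t2.shiftCoef hw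
  rw [psum_shiftCoef t2 hw] at s2
  have h1 := psum_add (hc.quadratic 1 (γ - 1) 0) (t1.shiftCoef.add t2.shiftCoef.shiftCoef) hw
  rw [psum_add t1.shiftCoef t2.shiftCoef.shiftCoef hw, s1, s2, e0, e1, e2] at h1
  rw [psum, tsum_congr (fun n => ?_), tsum_zero] at h1
  · linear_combination -h1
  refine mul_eq_zero_of_left ?_ _
  match n with
  | 0 => simp [shiftCoef]
  | 1 =>
    have h0 : γ ≠ 0 := by simpa using hγ 0
    simp only [shiftCoef, quadCoef]
    push_cast
    field_simp
    ring
  | n + 2 =>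
    have h0 : γ + (n + 1) ≠ 0 := fun e => hγ (n + 1) (by
      push_cast; exact eq_neg_of_add_eq_zero_left e)
    have h2 : (n : ℂ) + 2 ≠ 0 := by exact_mod_cast (n + 1).succ_ne_zero
    simp only [shiftCoef]
    rw [quadCoef]
    push_cast
    field_simp
    ring

/-! ### The slit plane, its map to the disc and the continued Gauss function -/

/-- The plane cut along `[1, ∞)`. -/
def slit : Set ℂ := {y | 1 - y ∈ Complex.slitPlane}

theorem isOpen_slit : IsOpen slit :=
  Complex.isOpen_slitPlane.preimage (continuous_const.sub continuous_id)

theorem zero_mem_slit : (0 : ℂ) ∈ slit := by simp [slit]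

theorem ball_subset_slit : ball (0 : ℂ) 1 ⊆ slit := fun y hy => by
  refine Or.inl ?_
  have h : ‖y‖ < 1 := by simpa using hy
  have := (Complex.abs_re_le_norm y)
  rw [Complex.sub_re, Complex.one_re]
  linarith [le_abs_self y.re]

theorem smul_mem_slit {y : ℂ} (hy : y ∈ slit) {t : ℝ} (h0 : 0 ≤ t) (h1 : t ≤ 1) :
    (t : ℂ) * y ∈ slit := by
  rcases h0.eq_or_lt with rfl | h0
  · simpa using zero_mem_slit
  rcases hy with h | h
  · refine Or.inl ?_
    simp only [Complex.sub_re, Complex.one_re, Complex.re_ofReal_mul] at h ⊢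
    nlinarith
  · refine Or.inr ?_
    simp only [Complex.sub_im, Complex.one_im, Complex.im_ofReal_mul] at h ⊢
    rw [zero_sub, neg_ne_zero] at h ⊢
    exact mul_ne_zero h0.ne' h

theorem isPreconnected_slit : IsPreconnected slit := by
  have : StarConvex ℝ 0 slit := by
    rw [starConvex_zero_iff]
    intro y hy t h0 h1
    simpa using smul_mem_slit hy h0 h1
  exact (this.isPathConnected zero_mem_slit).isConnected.isPreconnected

/-- The square root of `1 - y` with positive real part. -/
def rt (y : ℂ) : ℂ := Complex.exp (Complex.log (1 - y) / 2)

theorem rt_ne_zero (y : ℂ) : rt y ≠ 0 := Complex.exp_ne_zero _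

theorem rt_sq {y : ℂ} (hy : y ∈ slit) : rt y ^ 2 = 1 - y := by
  rw [rt, ← Complex.exp_nat_mul]
  push_cast
  rw [mul_div_cancel₀ _ two_ne_zero, Complex.exp_log (Complex.slitPlane_ne_zero hy)]

theorem rt_re_pos {y : ℂ} (hy : y ∈ slit) : 0 < (rt y).re := by
  rw [rt, Complex.exp_re]
  refine mul_pos (Real.exp_pos _) (Real.cos_pos_of_mem_Ioo ?_)
  have h1 := Complex.neg_pi_lt_arg (1 - y)
  have h2 := (Complex.arg_le_pi (1 - y)).lt_of_ne (Complex.slitPlane_arg_ne_pi hy)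
  have e : (Complex.log (1 - y) / 2).im = Complex.arg (1 - y) / 2 := by
    rw [show (2 : ℂ) = ((2 : ℝ) : ℂ) by norm_num, Complex.div_ofReal_im, Complex.log_im]
  rw [e]
  constructor <;> linarith

theorem one_add_rt_ne_zero {y : ℂ} (hy : y ∈ slit) : 1 + rt y ≠ 0 := fun h => by
  have := congrArg Complex.re h
  simp only [Complex.add_re, Complex.one_re, Complex.zero_re] at this
  linarith [rt_re_pos hy]

theorem hasDerivAt_rt {y : ℂ} (hy : y ∈ slit) : HasDerivAt rt (-1 / (2 * rt y)) y := by
  have h1 : HasDerivAt (fun y : ℂ => 1 - y) (-1) y := by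
    simpa using (hasDerivAt_id y).const_sub 1
  have := ((h1.clog hy).div_const 2).cexp
  refine this.congr_deriv ?_
  change rt y * _ = _
  rw [← rt_sq hy]
  have := rt_ne_zero y
  field_simp

/-- The conformal map of the slit plane to the disc. -/
def discMap (y : ℂ) : ℂ := (1 - rt y) / (1 + rt y)

/-- The Cayley transform takes the right half-plane, where `rt y` lies, into the unit disc. -/
theorem norm_discMap_lt {y : ℂ} (hy : y ∈ slit) : ‖discMap y‖ < 1 := by
  have h := rt_re_pos hy
  rw [discMap, norm_div, div_lt_one (norm_pos_iff.2 (one_add_rt_ne_zero hy))]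
  rw [← sq_lt_sq₀ (norm_nonneg _) (norm_nonneg _), Complex.sq_norm, Complex.sq_norm,
    Complex.normSq_apply, Complex.normSq_apply]
  simp only [Complex.add_re, Complex.sub_re, Complex.add_im, Complex.sub_im, Complex.one_re,
    Complex.one_im]
  nlinarith

theorem mem_slit_eq {y : ℂ} (hy : y ∈ slit) : y = 1 - rt y ^ 2 := by rw [rt_sq hy]; ring

/-- The Euler operator in `y` is `1 / rt y` times the Euler operator in the disc variable; this is
the form that `ThetaOn.comp` consumes. -/
theorem thetaOn_discMap : ThetaOn discMap (fun y => (1 / rt y) * discMap y) slit := by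
  intro y hy
  have h := hasDerivAt_rt hy
  have h1 := rt_ne_zero y
  have h2 := one_add_rt_ne_zero hy
  refine ⟨_, (h.const_sub 1).div (h.const_add 1) h2, ?_⟩
  conv_lhs => enter [1]; rw [mem_slit_eq hy]
  simp only [discMap]
  field_simp
  ring

theorem thetaOn_inv_rt :
    ThetaOn (fun y => 1 / rt y) (fun y => (1 - rt y ^ 2) / (2 * rt y ^ 3)) slit := by
  intro y hy
  have h1 := rt_ne_zero y
  refine ⟨_, (hasDerivAt_const y (1 : ℂ)).div (hasDerivAt_rt hy) h1, ?_⟩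
  conv_lhs => enter [1]; rw [mem_slit_eq hy]
  field_simp
  ring

/-- The prefactor `(1 + w) ^ (2α)` as a function of `y`. -/
def quadFactor (α y : ℂ) : ℂ := Complex.exp (-2 * α * Complex.log ((1 + rt y) / 2))

theorem thetaOn_quadFactor (α : ℂ) :
    ThetaOn (quadFactor α) (fun y => quadFactor α y * (α * (1 / rt y - 1))) slit := by
  intro y hy
  have h := hasDerivAt_rt hy
  have h1 := rt_ne_zero y
  have h2 := one_add_rt_ne_zero hy
  have h3 : (1 + rt y) / 2 ∈ Complex.slitPlane := by
    refine Or.inl ?_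
    rw [show (2 : ℂ) = ((2 : ℝ) : ℂ) by norm_num, Complex.div_ofReal_re, Complex.add_re,
      Complex.one_re]
    linarith [rt_re_pos hy]
  refine ⟨_, ((((h.const_add 1).div_const 2).clog h3).const_mul (-2 * α)).cexp, ?_⟩
  change y * (quadFactor α y * _) = _
  conv_lhs => enter [1]; rw [mem_slit_eq hy]
  field_simp
  ring

/-- The hypergeometric function on the plane cut along `[1, ∞)`. -/
def hyp (α β γ y : ℂ) : ℂ := quadFactor α y * psum (quadCoef α β γ) (discMap y)

theorem isHypSol_hyp (α β : ℂ) {γ : ℂ} (hγ : ∀ k : ℕ, γ ≠ -k) :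
    IsHypSol α β γ (hyp α β γ) slit := by
  have hc := tame_quadCoef α β hγ
  have hm : Set.MapsTo discMap slit (ball 0 1) := fun y hy => by
    simpa using norm_discMap_lt hy
  have g0 := hc.thetaOn.comp thetaOn_discMap hm
  have g1 := hc.nat_mul.thetaOn.comp thetaOn_discMap hm
  have hE := thetaOn_quadFactor α
  have hq : ThetaOn (fun y => α * (1 / rt y - 1)) (fun y => α * ((1 - rt y ^ 2) / (2 * rt y ^ 3)))
      slit := by
    intro y hy
    obtain ⟨f', k1, k2⟩ := thetaOn_inv_rt y hy
    exact ⟨_, (k1.sub_const 1).const_mul α, by beta_reduce at k2 ⊢; rw [← k2]; ring⟩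
  refine ⟨_, _, hE.mul g0, ((hE.mul hq).mul g0).add (hE.mul (thetaOn_inv_rt.mul g1)),
    fun y hy => ?_⟩
  have key := psum_quadCoef_eq α β hγ (norm_discMap_lt hy)
  have h1 := rt_ne_zero y
  have h2 := one_add_rt_ne_zero hy
  have hy' := mem_slit_eq hy
  simp only [hyp]
  set P₀ := psum (quadCoef α β γ) (discMap y)
  set P₁ := psum (fun n => (n : ℂ) * quadCoef α β γ n) (discMap y)
  set P₂ := psum (fun n => (n : ℂ) * (n * quadCoef α β γ n)) (discMap y)
  simp only [discMap] at key
  generalize quadFactor α y = E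
  generalize rt y = s at *
  subst hy'
  -- With `y = 1 - s²` the coefficient of `P₂` in the equation is `E`, while in `key` it is `1 - w²
  -- = 4s / (1 + s)²`; this fixes the multiplier.
  linear_combination (norm := (field_simp; ring)) (E * (1 + s) ^ 2 / (4 * s)) * key

theorem hyp_zero (α β γ : ℂ) : hyp α β γ 0 = 1 := by
  have h : rt 0 = 1 := by simp [rt]
  have h2 : ((1 : ℂ) + 1) / 2 = 1 := by norm_num
  simp [hyp, quadFactor, discMap, h, h2, psum_zero_right, quadCoef]

/-- On the unit disc `hyp` is the sum of the hypergeometric series. -/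
theorem hyp_eq_psum (α β : ℂ) {γ : ℂ} (hγ : ∀ k : ℕ, γ ≠ -k) {y : ℂ} (hy : ‖y‖ < 1) :
    hyp α β γ y = psum (hypCoef α β γ) y :=
  ((isHypSol_hyp α β hγ).mono ball_subset_slit).eqOn hγ isOpen_ball
    (convex_ball _ _).isPreconnected (by simp) (isHypSol_psum α β hγ)
    (by rw [hyp_zero, psum_zero_right, hypCoef_zero]) (by simpa using hy)

/-- The definition of `hyp` treats `α` and `β` differently, so the symmetry rests on uniqueness of
the regular solution. -/
theorem hyp_comm (α β : ℂ) {γ : ℂ} (hγ : ∀ k : ℕ, γ ≠ -k) {y : ℂ} (hy : y ∈ slit) :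
    hyp α β γ y = hyp β α γ y :=
  (isHypSol_hyp α β hγ).eqOn hγ isOpen_slit isPreconnected_slit zero_mem_slit
    (isHypSol_hyp β α hγ).symm (by rw [hyp_zero, hyp_zero]) hy

theorem differentiableOn_hyp (α β : ℂ) {γ : ℂ} (hγ : ∀ k : ℕ, γ ≠ -k) :
    DifferentiableOn ℂ (hyp α β γ) slit := (isHypSol_hyp α β hγ).differentiableOn

/-- Pfaff's transformation. -/
theorem hyp_eq_pfaff (α β : ℂ) {γ : ℂ} (hγ : ∀ k : ℕ, γ ≠ -k) {y : ℂ} (hy : y.re < 1 / 2) :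
    hyp α β γ y = Complex.exp (-α * Complex.log (1 - y)) *
      psum (hypCoef α (γ - β) γ) (y / (y - 1)) := by
  set s : Set ℂ := {y | y.re < 1 / 2} with hs
  have hss : s ⊆ slit := fun y hy => Or.inl (by
    have : y.re < 1 / 2 := hy
    rw [Complex.sub_re, Complex.one_re]; linarith)
  have hso : IsOpen s := isOpen_lt Complex.continuous_re continuous_const
  have hsc : IsPreconnected s := (convex_halfSpace_re_lt (1 / 2)).isPreconnected
  have h1 : ∀ y ∈ s, 1 - y ≠ 0 := fun y hy => Complex.slitPlane_ne_zero (hss hy)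
  have h2 : ∀ y ∈ s, y - 1 ≠ 0 := fun y hy h => h1 y hy (by linear_combination -h)
  -- The half-plane `re y < 1/2` consists of the points closer to `0` than to `1`, which is `|y / (y
  -- - 1)| < 1`.
  have hm : Set.MapsTo (fun y : ℂ => y / (y - 1)) s (ball 0 1) := fun y hy => by
    have hy' : y.re < 1 / 2 := hy
    rw [mem_ball_zero_iff, norm_div, div_lt_one (norm_pos_iff.2 (h2 y hy)),
      ← sq_lt_sq₀ (norm_nonneg _) (norm_nonneg _), Complex.sq_norm, Complex.sq_norm,
      Complex.normSq_apply, Complex.normSq_apply]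
    simp only [Complex.sub_re, Complex.sub_im, Complex.one_re, Complex.one_im]
    nlinarith
  have hq : ThetaOn (fun y => y / (y - 1)) (fun y => (1 / (1 - y)) * (y / (y - 1))) s := by
    intro y hy
    have k1 := h1 y hy
    have k2 := h2 y hy
    refine ⟨_, (hasDerivAt_id y).div ((hasDerivAt_id y).sub_const 1) k2, ?_⟩
    simp only [id]
    field_simp
    ring
  have hq' : ThetaOn (fun y => 1 / (1 - y)) (fun y => y / (1 - y) ^ 2) s := by
    intro y hy
    have k1 := h1 y hy
    refine ⟨_, (hasDerivAt_const y (1 : ℂ)).div ((hasDerivAt_id y).const_sub 1) k1, ?_⟩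
    beta_reduce
    field_simp
    ring
  have hq'' : ThetaOn (fun y => α * (1 / (1 - y) - 1)) (fun y => α * (y / (1 - y) ^ 2)) s := by
    intro y hy
    obtain ⟨f', k1, k2⟩ := hq' y hy
    exact ⟨_, (k1.sub_const 1).const_mul α, by beta_reduce at k2 ⊢; rw [← k2]; ring⟩
  have hE : ThetaOn (fun y => Complex.exp (-α * Complex.log (1 - y)))
      (fun y => Complex.exp (-α * Complex.log (1 - y)) * (α * (1 / (1 - y) - 1))) s := by
    intro y hy
    have k1 := h1 y hy
    refine ⟨_, ((((hasDerivAt_id y).const_sub 1).clog (hss hy)).const_mul (-α)).cexp, ?_⟩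
    simp only [id]
    field_simp
    ring
  obtain ⟨P₁, P₂, hP1, hP2, hP⟩ := isHypSol_psum α (γ - β) hγ
  have g0 := hP1.comp hq hm
  have g1 := hP2.comp hq hm
  have sol : IsHypSol α β γ (fun y => Complex.exp (-α * Complex.log (1 - y)) *
      psum (hypCoef α (γ - β) γ) (y / (y - 1))) s := by
    refine ⟨_, _, hE.mul g0, ((hE.mul hq'').mul g0).add (hE.mul (hq'.mul g1)), fun y hy => ?_⟩
    have key := hP _ (hm hy)
    have k1 := h1 y hy
    have k2 := h2 y hy
    beta_reduce
    generalize Complex.exp (-α * Complex.log (1 - y)) = E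
    simp only at key
    generalize P₂ (y / (y - 1)) = p2 at *
    generalize P₁ (y / (y - 1)) = p1 at *
    generalize psum (hypCoef α (γ - β) γ) (y / (y - 1)) = p0 at *
    have k3 : y - 1 = -(1 - y) := by ring
    rw [k3] at key
    linear_combination (norm := (field_simp; ring)) E * key
  refine ((isHypSol_hyp α β hγ).mono hss).eqOn hγ hso hsc (by simp [hs]) sol ?_ hy
  simp [hyp_zero, psum_zero_right, hypCoef_zero]

end HornH5
end

noncomputable section
namespace HornH5
open Filter Metric

/-! ### Solutions at infinity -/

/-- The exterior of the unit disc, cut along the positive real axis. -/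
def exterior : Set ℂ := {y | 1 < ‖y‖ ∧ -y ∈ Complex.slitPlane}

theorem isOpen_exterior : IsOpen exterior :=
  (isOpen_lt continuous_const continuous_norm).inter
    (Complex.isOpen_slitPlane.preimage continuous_neg)

theorem exterior_subset_slit : exterior ⊆ slit := fun y hy => by
  rcases hy.2 with h | h
  · refine Or.inl ?_
    rw [Complex.neg_re] at h
    rw [Complex.sub_re, Complex.one_re]
    linarith
  · refine Or.inr ?_
    simpa using h

theorem ne_zero_of_mem_exterior {y : ℂ} (hy : y ∈ exterior) : y ≠ 0 := fun h => by
  have := hy.1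
  rw [h, norm_zero] at this
  linarith

/-- The set is the image of a convex half-strip under `-exp`. -/
theorem isPreconnected_exterior : IsPreconnected exterior := by
  set s : Set ℂ := {u | 0 < u.re} ∩ ({u | -Real.pi < u.im} ∩ {u | u.im < Real.pi}) with hs
  have hc : Convex ℝ s := (convex_halfSpace_re_gt 0).inter
    ((convex_halfSpace_im_gt _).inter (convex_halfSpace_im_lt _))
  have : exterior = (fun u => -Complex.exp u) '' s := by
    ext y
    constructor
    · intro hy
      have hy0 : -y ≠ 0 := neg_ne_zero.2 (ne_zero_of_mem_exterior hy)
      refine ⟨Complex.log (-y), ⟨?_, ?_, ?_⟩, ?_⟩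
      · simp only [Set.mem_ofPred_eq, Complex.log_re, norm_neg]
        exact Real.log_pos hy.1
      · exact Complex.neg_pi_lt_log_im _
      · exact (Complex.log_im_le_pi _).lt_of_ne
          (by rw [Complex.log_im]; exact Complex.slitPlane_arg_ne_pi hy.2)
      · simp only [Complex.exp_log hy0, neg_neg]
    · rintro ⟨u, ⟨h1, h2, h3⟩, rfl⟩
      simp only [Set.mem_ofPred_eq] at h1 h2 h3
      refine ⟨?_, ?_⟩
      · simp only [norm_neg, Complex.norm_exp]
        exact Real.one_lt_exp_iff.2 h1
      · simp only [neg_neg]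
        rw [Complex.mem_slitPlane_iff_arg, Complex.arg_exp, ← sub_add_cancel u.im 0]
        refine ⟨?_, Complex.exp_ne_zero _⟩
        rw [sub_zero, add_zero, (toIocMod_eq_self Real.two_pi_pos).2 ⟨h2, by linarith⟩]
        exact h3.ne
  rw [this]
  exact hc.isPreconnected.image _ (Complex.continuous_exp.neg.continuousOn)

/-- `(-y)^(-s)` times a power series in `1 / y`. -/
def laurent (s : ℂ) (c : ℕ → ℂ) (y : ℂ) : ℂ :=
  Complex.exp (-s * Complex.log (-y)) * psum c (1 / y)

theorem norm_one_div_lt {y : ℂ} (hy : y ∈ exterior) : ‖1 / y‖ < 1 := by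
  rw [norm_div, norm_one]
  exact (div_lt_one (zero_lt_one.trans hy.1)).2 hy.1

theorem Tame.euler {c : ℕ → ℂ} (hc : Tame c) (s : ℂ) : Tame fun n => (s - n) * c n :=
  hc.of_le (‖s‖ + 1) 1 fun n => by
    rw [norm_mul, pow_one]
    gcongr
    refine (norm_sub_le _ _).trans ?_
    rw [Complex.norm_natCast]
    have : 0 ≤ ‖s‖ * n := by positivity
    linarith

theorem psum_euler {c : ℕ → ℂ} (hc : Tame c) (s : ℂ) {z : ℂ} (hz : ‖z‖ < 1) :
    psum (fun n => (s - n) * c n) z = s * psum c z - psum (fun n => n * c n) z := by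
  rw [← psum_const_mul, sub_eq_add_neg, ← neg_one_mul, ← psum_const_mul,
    ← psum_add (hc.const_mul s) (hc.nat_mul.const_mul (-1)) hz]
  exact tsum_congr fun n => by ring

/-- On the term `(-y)^(-s) y^(-n)` the Euler operator acts as multiplication by `-s - n`. -/
theorem thetaOn_laurent {c : ℕ → ℂ} (hc : Tame c) (s : ℂ) :
    ThetaOn (laurent s c) (laurent s fun n => (-s - n) * c n) exterior := by
  have hm : Set.MapsTo (fun y : ℂ => 1 / y) exterior (ball 0 1) := fun y hy => by
    simpa using norm_one_div_lt hy
  have hq : ThetaOn (fun y => 1 / y) (fun y => (-1) * (1 / y)) exterior := by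
    intro y hy
    have h0 := ne_zero_of_mem_exterior hy
    refine ⟨_, (hasDerivAt_const y (1 : ℂ)).div (hasDerivAt_id y) h0, ?_⟩
    beta_reduce
    field_simp
    ring
  have hE : ThetaOn (fun y => Complex.exp (-s * Complex.log (-y)))
      (fun y => Complex.exp (-s * Complex.log (-y)) * -s) exterior := by
    intro y hy
    have h0 := ne_zero_of_mem_exterior hy
    refine ⟨_, (((hasDerivAt_id y).neg.clog hy.2).const_mul (-s)).cexp, ?_⟩
    simp only [Pi.neg_apply, id]
    field_simp
  refine (hE.mul (hc.thetaOn.comp hq hm)).congr isOpen_exterior (fun y _ => rfl) fun y hy => ?_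
  rw [laurent, psum_euler hc _ (norm_one_div_lt hy)]
  ring

theorem laurent_add {c d : ℕ → ℂ} (hc : Tame c) (hd : Tame d) (s : ℂ) {y : ℂ}
    (hy : y ∈ exterior) : laurent s (fun n => c n + d n) y = laurent s c y + laurent s d y := by
  rw [laurent, psum_add hc hd (norm_one_div_lt hy), mul_add]
  rfl

theorem laurent_const_mul (k s : ℂ) (c : ℕ → ℂ) (y : ℂ) :
    laurent s (fun n => k * c n) y = k * laurent s c y := by
  rw [laurent, psum_const_mul, laurent]
  ring

theorem laurent_shiftCoef {c : ℕ → ℂ} (hc : Tame c) (s : ℂ) {y : ℂ} (hy : y ∈ exterior) :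
    y * laurent s (shiftCoef c) y = laurent s c y := by
  have h0 := ne_zero_of_mem_exterior hy
  rw [laurent, psum_shiftCoef hc (norm_one_div_lt hy), laurent]
  field_simp

theorem laurent_add_one {c : ℕ → ℂ} (s : ℂ) {y : ℂ} (hy : y ∈ exterior) :
    y * laurent (s + 1) c y = - laurent s c y := by
  have h0 := ne_zero_of_mem_exterior hy
  rw [laurent, laurent, show -(s + 1) * Complex.log (-y) =
    -s * Complex.log (-y) - Complex.log (-y) by ring, Complex.exp_sub,
    Complex.exp_log (neg_ne_zero.2 h0)]
  field_simp

/-- The solution of the hypergeometric equation with exponent `α` at infinity. -/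
def solInf (α β γ : ℂ) : ℂ → ℂ := laurent α (hypCoef α (α - γ + 1) (α - β + 1))

/-- In powers of `1 / y` the operator `θ + α` has eigenvalue `-n`, so the series on the right has no
leading term and can absorb the factor `y`. What remains is `hypCoef_succ` for the parameters at
infinity. -/
theorem isHypSol_solInf {α β : ℂ} (γ : ℂ) (h : ∀ k : ℕ, α - β + 1 ≠ -k) :
    IsHypSol α β γ (solInf α β γ) exterior := by
  have hc := tame_hypCoef α (α - γ + 1) h
  refine ⟨_, _, thetaOn_laurent hc α, thetaOn_laurent (hc.euler _) α, fun y hy => ?_⟩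
  have t := (hc.euler (-α)).euler (-α)
  rw [solInf, ← laurent_const_mul, ← laurent_const_mul, ← laurent_const_mul,
    ← laurent_add t ((hc.euler (-α)).const_mul _) _ hy,
    ← laurent_add t ((hc.euler (-α)).const_mul _) _ hy,
    ← laurent_add (t.add ((hc.euler (-α)).const_mul _)) (hc.const_mul _) _ hy,
    ← laurent_shiftCoef (t.add ((hc.euler (-α)).const_mul _)) _ hy]
  congr 2
  funext n
  cases n with
  | zero => simp only [shiftCoef]; push_cast; ring
  | succ n =>
    simp only [shiftCoef]
    have := hypCoef_succ (α := α) (β := α - γ + 1) h n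
    push_cast
    linear_combination -this

theorem tendsto_laurent {c : ℕ → ℂ} (hc : Tame c) (s : ℂ) :
    Tendsto (fun t : ℝ => Complex.exp (s * (Real.log t : ℂ)) * laurent s c (-(t : ℂ))) atTop
      (𝓝 (c 0)) := by
  have h1 : Tendsto (fun t : ℝ => psum c (1 / (-(t : ℂ)))) atTop (𝓝 (c 0)) := by
    rw [← psum_zero_right c]
    have hcont : ContinuousAt (psum c) 0 := (hc.hasDerivAt (by simp)).continuousAt
    refine hcont.tendsto.comp ?_
    have : Tendsto (fun t : ℝ => ((-t⁻¹ : ℝ) : ℂ)) atTop (𝓝 ((-0 : ℝ) : ℂ)) :=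
      (Complex.continuous_ofReal.tendsto _).comp tendsto_inv_atTop_zero.neg
    simp only [neg_zero, Complex.ofReal_zero] at this
    refine this.congr fun t => ?_
    push_cast
    rw [one_div, inv_neg]
  refine h1.congr' ?_
  filter_upwards [eventually_gt_atTop 0] with t ht
  rw [laurent, neg_neg, ← mul_assoc, ← Complex.exp_add, Complex.ofReal_log ht.le]
  ring_nf
  simp

/-! ### Wronskians and the space of solutions at infinity -/

/-- The inverse of the Wronskian of two solutions, up to a constant. -/
def wronskFactor (α β γ y : ℂ) : ℂ :=
  Complex.exp ((γ - 1) * Complex.log (-y) + (α + β - γ + 1) * Complex.log (1 - y))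

/-- The equation gives `(1 - z) θW = ((α + β) z - (γ - 1)) W` for `W = f θg - g θf`. The factor has
the opposite logarithmic derivative, so the product is constant on the connected exterior. -/
theorem exists_wronskian_const {α β γ : ℂ} {f g f₁ f₂ g₁ g₂ : ℂ → ℂ}
    (hf : ThetaOn f f₁ exterior) (hf₁ : ThetaOn f₁ f₂ exterior)
    (hf₂ : ∀ z ∈ exterior, f₂ z + (γ - 1) * f₁ z = z * (f₂ z + (α + β) * f₁ z + α * β * f z))
    (hg : ThetaOn g g₁ exterior) (hg₁ : ThetaOn g₁ g₂ exterior)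
    (hg₂ : ∀ z ∈ exterior, g₂ z + (γ - 1) * g₁ z = z * (g₂ z + (α + β) * g₁ z + α * β * g z)) :
    ∃ κ, ∀ y ∈ exterior, (f y * g₁ y - g y * f₁ y) * wronskFactor α β γ y = κ := by
  have hM : ThetaOn (wronskFactor α β γ)
      (fun y => wronskFactor α β γ y * ((γ - 1) - (α + β - γ + 1) * (y / (1 - y)))) exterior := by
    intro y hy
    have h0 := ne_zero_of_mem_exterior hy
    have h1 := Complex.slitPlane_ne_zero (exterior_subset_slit hy)
    refine ⟨_, ((((hasDerivAt_id y).neg.clog hy.2).const_mul (γ - 1)).add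
      ((((hasDerivAt_id y).const_sub 1).clog (exterior_subset_slit hy)).const_mul
        (α + β - γ + 1))).cexp, ?_⟩
    change y * (wronskFactor α β γ y * _) = _
    simp only [Pi.neg_apply, id]
    field_simp
    ring
  have hW := ((hf.mul hg₁).add ((hg.mul hf₁).const_mul (-1))).mul hM
  have hd : ∀ y ∈ exterior,
      HasDerivAt (fun y => (f y * g₁ y - g y * f₁ y) * wronskFactor α β γ y) 0 y := by
    intro y hy
    have h0 := ne_zero_of_mem_exterior hy
    have h1 := Complex.slitPlane_ne_zero (exterior_subset_slit hy)
    obtain ⟨D, d1, d2⟩ := hW y hy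
    have hD : D = 0 := by
      refine (mul_eq_zero.1 (d2.trans ?_)).resolve_left h0
      linear_combination (norm := (field_simp; ring)) wronskFactor α β γ y / (1 - y) *
        (f y * hg₂ y hy - g y * hf₂ y hy)
    rw [hD] at d1
    refine d1.congr_of_eventuallyEq (Eventually.of_forall fun z => ?_)
    beta_reduce
    ring
  obtain ⟨κ, hκ⟩ := isOpen_exterior.exists_is_const_of_deriv_eq_zero isPreconnected_exterior
    (fun y hy => (hd y hy).differentiableAt.differentiableWithinAt) (fun y hy => (hd y hy).deriv)
  exact ⟨κ, hκ⟩

theorem neg_mem_exterior {t : ℝ} (ht : 1 < t) : -(t : ℂ) ∈ exterior := by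
  refine ⟨?_, ?_⟩
  · rw [norm_neg, Complex.norm_real, Real.norm_eq_abs]
    exact ht.trans_le (le_abs_self t)
  · rw [neg_neg]
    exact Complex.ofReal_mem_slitPlane.2 (by linarith)

theorem tendsto_log_one_add_sub_log :
    Tendsto (fun t : ℝ => ((Real.log (1 + t) - Real.log t : ℝ) : ℂ)) atTop (𝓝 0) := by
  have h1 : Tendsto (fun t : ℝ => Real.log (1 + t⁻¹)) atTop (𝓝 0) := by
    have : Tendsto (fun t : ℝ => 1 + t⁻¹) atTop (𝓝 1) := by
      simpa using tendsto_inv_atTop_zero.const_add (1 : ℝ)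
    simpa [Function.comp_def] using (Real.continuousAt_log one_ne_zero).tendsto.comp this
  rw [← Complex.ofReal_zero]
  refine (Complex.continuous_ofReal.tendsto _).comp (h1.congr' ?_)
  filter_upwards [eventually_gt_atTop 0] with t ht
  rw [← Real.log_div (by positivity) ht.ne']
  congr 1
  field_simp
  ring

/-- The Wronskian of the two solutions at infinity does not vanish. -/
theorem wronskian_solInf {α β : ℂ} (γ : ℂ) (h : ∀ k : ℤ, α - β ≠ k) {y : ℂ}
    (hy : y ∈ exterior) :
    (solInf α β γ y * laurent β (fun n => (-β - n) * hypCoef β (β - γ + 1) (β - α + 1) n) y -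
      solInf β α γ y * laurent α (fun n => (-α - n) * hypCoef α (α - γ + 1) (α - β + 1) n) y) *
        wronskFactor α β γ y = α - β := by
  have hab : ∀ k : ℕ, α - β + 1 ≠ -k := fun k e => h (-k - 1) (by
    push_cast; linear_combination e)
  have hba : ∀ k : ℕ, β - α + 1 ≠ -k := fun k e => h (k + 1) (by
    push_cast; linear_combination -e)
  have hc := tame_hypCoef α (α - γ + 1) hab
  have hd := tame_hypCoef β (β - γ + 1) hba
  obtain ⟨κ, hκ⟩ : ∃ κ, ∀ y ∈ exterior, (solInf α β γ y *
      laurent β (fun n => (-β - n) * hypCoef β (β - γ + 1) (β - α + 1) n) y -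
      solInf β α γ y * laurent α (fun n => (-α - n) * hypCoef α (α - γ + 1) (α - β + 1) n) y) *
        wronskFactor α β γ y = κ := by
    obtain ⟨f₁, f₂, k1, k2, k3⟩ := isHypSol_solInf γ hab
    obtain ⟨g₁, g₂, l1, l2, l3⟩ := (isHypSol_solInf γ hba).symm
    obtain ⟨κ, hκ⟩ := exists_wronskian_const k1 k2 k3 l1 l2 l3
    refine ⟨κ, fun y hy => ?_⟩
    rw [← hκ y hy, k1.eq_mul_deriv hy, l1.eq_mul_deriv hy,
      (thetaOn_laurent hc α).eq_mul_deriv hy, (thetaOn_laurent hd β).eq_mul_deriv hy]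
    rfl
  rw [hκ y hy]
  have t1 := tendsto_laurent hc α
  have t2 := tendsto_laurent hd β
  have t3 := tendsto_laurent (hc.euler (-α)) α
  have t4 := tendsto_laurent (hd.euler (-β)) β
  -- At `y = -t` the factor grows like `t^(α + β)`, which compensates the decay of the two
  -- solutions. The constant is thus read off from the leading coefficients as `-β - (-α)`.
  have t5 : Tendsto (fun t : ℝ => Complex.exp (-(α + β) * (Real.log t : ℂ)) *
      wronskFactor α β γ (-(t : ℂ))) atTop (𝓝 1) := by
    have : Tendsto (fun t : ℝ => Complex.exp ((α + β - γ + 1) *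
        ((Real.log (1 + t) - Real.log t : ℝ) : ℂ))) atTop (𝓝 1) := by
      have := (Complex.continuous_exp.tendsto _).comp
        (tendsto_log_one_add_sub_log.const_mul (α + β - γ + 1))
      simpa [Function.comp_def] using this
    refine this.congr' ?_
    filter_upwards [eventually_gt_atTop 0] with t ht
    rw [wronskFactor, ← Complex.exp_add, neg_neg, sub_neg_eq_add, ← Complex.ofReal_log ht.le,
      ← Complex.ofReal_one, ← Complex.ofReal_add, ← Complex.ofReal_log (by positivity)]
    congr 1
    push_cast
    ring
  have t6 := ((t1.mul t4).sub (t2.mul t3)).mul t5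
  simp only [hypCoef_zero, Nat.cast_zero, sub_zero, one_mul, mul_one] at t6
  have t7 := tendsto_nhds_unique (tendsto_const_nhds (x := κ)) (t6.congr' ?_)
  · rw [t7]; ring
  · filter_upwards [eventually_gt_atTop 1] with t ht
    rw [← hκ _ (neg_mem_exterior ht)]
    have e : ∀ z : ℂ, Complex.exp (-(α + β) * z) =
        (Complex.exp (α * z))⁻¹ * (Complex.exp (β * z))⁻¹ := fun z => by
      rw [← Complex.exp_neg, ← Complex.exp_neg, ← Complex.exp_add]
      congr 1
      ring
    rw [e]
    simp only [solInf]
    have e1 := Complex.exp_ne_zero (α * (Real.log t : ℂ))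
    have e2 := Complex.exp_ne_zero (β * (Real.log t : ℂ))
    field_simp

/-- The two solutions at infinity span the solutions. -/
theorem exists_eq_solInf {α β γ : ℂ} (h : ∀ k : ℤ, α - β ≠ k) {f : ℂ → ℂ}
    (hf : IsHypSol α β γ f exterior) :
    ∃ A B : ℂ, ∀ y ∈ exterior, f y = A * solInf α β γ y + B * solInf β α γ y := by
  have hab : ∀ k : ℕ, α - β + 1 ≠ -k := fun k e => h (-k - 1) (by
    push_cast; linear_combination e)
  have hba : ∀ k : ℕ, β - α + 1 ≠ -k := fun k e => h (k + 1) (by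
    push_cast; linear_combination -e)
  have hc := tame_hypCoef α (α - γ + 1) hab
  have hd := tame_hypCoef β (β - γ + 1) hba
  obtain ⟨f₁, f₂, m1, m2, m3⟩ := hf
  obtain ⟨p₁, p₂, k1, k2, k3⟩ := isHypSol_solInf γ hab
  obtain ⟨q₁, q₂, l1, l2, l3⟩ := (isHypSol_solInf γ hba).symm
  obtain ⟨κ₁, hκ₁⟩ := exists_wronskian_const m1 m2 m3 l1 l2 l3
  obtain ⟨κ₂, hκ₂⟩ := exists_wronskian_const k1 k2 k3 m1 m2 m3
  have hne : α - β ≠ 0 := by simpa using h 0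
  -- Cramer's rule: the coefficients are the Wronskians of `f` with each basis solution, divided by
  -- the Wronskian of the basis.
  refine ⟨κ₁ / (α - β), κ₂ / (α - β), fun y hy => ?_⟩
  have e1 := hκ₁ y hy
  have e2 := hκ₂ y hy
  have e3 := wronskian_solInf γ h hy
  rw [← (thetaOn_laurent hc α).eq_mul_deriv hy |>.trans (k1.eq_mul_deriv hy).symm |>.symm] at e3
  rw [← (thetaOn_laurent hd β).eq_mul_deriv hy |>.trans (l1.eq_mul_deriv hy).symm |>.symm] at e3
  field_simp
  rw [← e1, ← e2, ← e3]
  ring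

/-- Pairing the relation with the second solution in the Wronskian leaves `P` times the nonzero
constant `α - β`. -/
theorem solInf_independent {α β : ℂ} (γ : ℂ) (h : ∀ k : ℤ, α - β ≠ k) {P Q : ℂ}
    (h0 : ∀ y ∈ exterior, P * solInf α β γ y + Q * solInf β α γ y = 0) : P = 0 := by
  have hab : ∀ k : ℕ, α - β + 1 ≠ -k := fun k e => h (-k - 1) (by
    push_cast; linear_combination e)
  have hba : ∀ k : ℕ, β - α + 1 ≠ -k := fun k e => h (k + 1) (by
    push_cast; linear_combination -e)
  have hc := tame_hypCoef α (α - γ + 1) hab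
  have hd := tame_hypCoef β (β - γ + 1) hba
  have ht := ((thetaOn_laurent hc α).const_mul P).add ((thetaOn_laurent hd β).const_mul Q)
  have hy := neg_mem_exterior (t := 2) (by norm_num)
  have e1 := ht.eq_mul_deriv hy
  have e2 : deriv (fun z => P * laurent α (hypCoef α (α - γ + 1) (α - β + 1)) z +
      Q * laurent β (hypCoef β (β - γ + 1) (β - α + 1)) z) (-((2 : ℝ) : ℂ)) = 0 := by
    rw [EventuallyEq.deriv_eq (f := fun _ => 0), deriv_const]
    filter_upwards [isOpen_exterior.mem_nhds hy] with z hz using h0 z hz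
  rw [e2, mul_zero] at e1
  have e3 := wronskian_solInf γ h hy
  have e4 := h0 _ hy
  have hne : α - β ≠ 0 := by simpa using h 0
  refine (mul_eq_zero.1 (?_ : P * (α - β) = 0)).resolve_right hne
  rw [← e3]
  linear_combination wronskFactor α β γ (-((2 : ℝ) : ℂ)) *
    (laurent β (fun n => (-β - n) * hypCoef β (β - γ + 1) (β - α + 1) n) (-((2 : ℝ) : ℂ)) * e4 -
      solInf β α γ (-((2 : ℝ) : ℂ)) * e1)

end HornH5
end

noncomputable section
namespace HornH5
open Filter Metric

/-! ### Connection coefficients -/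

theorem asc_mul_add (z : ℂ) (n : ℕ) : (ascPochhammer ℂ n).eval z * (z + n) =
    z * (ascPochhammer ℂ n).eval (z + 1) := by
  rw [← ascPochhammer_succ_eval, ascPochhammer_succ_left]
  simp [Polynomial.eval_comp]

theorem ne_neg_natCast_add_one {γ : ℂ} (hγ : ∀ k : ℕ, γ ≠ -k) (k : ℕ) : γ + 1 ≠ -k := fun e =>
  hγ (k + 1) (by push_cast; linear_combination e)

theorem hypCoef_contiguous {α β γ : ℂ} (hγ : ∀ k : ℕ, γ ≠ -k) (n : ℕ) :
    γ * (n * hypCoef α β γ n + β * hypCoef α β γ n) =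
      β * (n * hypCoef α (β + 1) (γ + 1) n + γ * hypCoef α (β + 1) (γ + 1) n) := by
  have h1 := asc_ne_zero hγ n
  have h2 := asc_ne_zero (ne_neg_natCast_add_one hγ) n
  have h3 : (n.factorial : ℂ) ≠ 0 := by exact_mod_cast n.factorial_ne_zero
  have e1 := asc_mul_add γ n
  have e2 := asc_mul_add β n
  simp only [hypCoef]
  rw [show ∀ A : ℂ, γ * (n * A + β * A) = γ * (A * (β + n)) by intros; ring,
    show ∀ A : ℂ, β * (n * A + γ * A) = β * (A * (γ + n)) by intros; ring]
  field_simp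
  linear_combination (ascPochhammer ℂ n).eval α * (γ * (ascPochhammer ℂ n).eval (γ + 1) * e2 -
    β * (ascPochhammer ℂ n).eval (β + 1) * e1)

/-- `(γ + 1)`-contiguity in the denominators. -/
theorem hypCoef_sub_nat_mul_denom {a b d : ℂ} (hd : ∀ k : ℕ, d ≠ -k) (n : ℕ) :
    (-d - n) * hypCoef a b (d + 1) n = -d * hypCoef a b d n := by
  have h1 := asc_ne_zero hd n
  have h2 := asc_ne_zero (ne_neg_natCast_add_one hd) n
  have h3 : (n.factorial : ℂ) ≠ 0 := by exact_mod_cast n.factorial_ne_zero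
  have e1 := asc_mul_add d n
  simp only [hypCoef]
  field_simp
  linear_combination -(ascPochhammer ℂ n).eval a * (ascPochhammer ℂ n).eval b * e1

theorem hypCoef_sub_nat_mul_num (a b d : ℂ) (n : ℕ) :
    (-b - n) * hypCoef a b d n = -b * hypCoef a (b + 1) d n := by
  have e1 := asc_mul_add b n
  simp only [hypCoef]
  linear_combination - (ascPochhammer ℂ n).eval a /
    ((ascPochhammer ℂ n).eval d * n.factorial) * e1

theorem hypCoef_succ_shift {a b d : ℂ} (hd : ∀ k : ℕ, d ≠ -k) (n : ℕ) :
    ((n : ℂ) + 1) * hypCoef a b d (n + 1) = a * b / d * hypCoef (a + 1) (b + 1) (d + 1) n := by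
  have h1 := asc_ne_zero hd n
  have h2 := asc_ne_zero (ne_neg_natCast_add_one hd) n
  have h3 : (n.factorial : ℂ) ≠ 0 := by exact_mod_cast n.factorial_ne_zero
  have h4 : (n : ℂ) + 1 ≠ 0 := by exact_mod_cast n.succ_ne_zero
  have h0 : d ≠ 0 := by simpa using hd 0
  simp only [hypCoef, ascPochhammer_succ_eval, asc_mul_add, Nat.factorial_succ]
  push_cast
  field_simp

/-- The function `hyp` in terms of the solutions at infinity. -/
def Connects (α β γ A B : ℂ) : Prop :=
  ∀ y ∈ exterior, hyp α β γ y = A * solInf α β γ y + B * solInf β α γ y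

theorem exists_connects {α β γ : ℂ} (hγ : ∀ k : ℕ, γ ≠ -k) (h : ∀ k : ℤ, α - β ≠ k) :
    ∃ A B, Connects α β γ A B :=
  exists_eq_solInf h ((isHypSol_hyp α β hγ).mono exterior_subset_slit)

/-- On the unit disc this is `hypCoef_contiguous` term by term; the identity theorem carries it to
the slit plane. -/
theorem deriv_hyp_contiguous (α β : ℂ) {γ : ℂ} (hγ : ∀ k : ℕ, γ ≠ -k) {y : ℂ} (hy : y ∈ slit) :
    γ * (y * deriv (hyp α β γ) y + β * hyp α β γ y) =
      β * (y * deriv (hyp α (β + 1) (γ + 1)) y + γ * hyp α (β + 1) (γ + 1) y) := by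
  have hγ' := ne_neg_natCast_add_one hγ
  have hf := differentiableOn_hyp α β hγ
  have hg := differentiableOn_hyp α (β + 1) hγ'
  have han : ∀ {f : ℂ → ℂ}, DifferentiableOn ℂ f slit → ∀ k l : ℂ,
      AnalyticOnNhd ℂ (fun y => k * (y * deriv f y + l * f y)) slit := fun hf k l =>
    (analyticOnNhd_const).mul ((analyticOnNhd_id.mul (hf.analyticOnNhd isOpen_slit).deriv).add
      (analyticOnNhd_const.mul (hf.analyticOnNhd isOpen_slit)))
  refine (han hf γ β).eqOn_of_preconnected_of_eventuallyEq (han hg β γ) isPreconnected_slit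
    zero_mem_slit ?_ hy
  have key : ∀ {a b d : ℂ}, (∀ k : ℕ, d ≠ -k) → ∀ z ∈ ball (0 : ℂ) 1,
      z * deriv (hyp a b d) z = psum (fun n => n * hypCoef a b d n) z := fun {a b d} hd z hz => by
    rw [(tame_hypCoef a b hd).thetaOn.eq_mul_deriv hz]
    congr 1
    refine EventuallyEq.deriv_eq ?_
    filter_upwards [isOpen_ball.mem_nhds hz] with w hw
    exact hyp_eq_psum a b hd (by simpa using hw)
  filter_upwards [isOpen_ball.mem_nhds (mem_ball_self (x := (0 : ℂ)) zero_lt_one)] with z hz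
  have hz' : ‖z‖ < 1 := by simpa using hz
  have c1 := tame_hypCoef α β hγ
  have c2 := tame_hypCoef α (β + 1) hγ'
  rw [key hγ z hz, key hγ' z hz, hyp_eq_psum α β hγ hz', hyp_eq_psum α (β + 1) hγ' hz',
    ← psum_const_mul β, ← psum_const_mul γ (hypCoef _ _ _), ← psum_add c1.nat_mul (c1.const_mul _) hz',
    ← psum_add c2.nat_mul (c2.const_mul _) hz', ← psum_const_mul, ← psum_const_mul]
  congr 1
  funext n
  exact hypCoef_contiguous hγ n

theorem Connects.deriv {α β γ A B : ℂ} (hc : Connects α β γ A B) (h : ∀ k : ℤ, α - β ≠ k) {y : ℂ}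
    (hy : y ∈ exterior) (s : ℂ) :
    y * deriv (hyp α β γ) y + s * hyp α β γ y =
      A * laurent α (fun n => (s - α - n) * hypCoef α (α - γ + 1) (α - β + 1) n) y +
      B * laurent β (fun n => (s - β - n) * hypCoef β (β - γ + 1) (β - α + 1) n) y := by
  have hab : ∀ k : ℕ, α - β + 1 ≠ -k := fun k e => h (-k - 1) (by
    push_cast; linear_combination e)
  have hba : ∀ k : ℕ, β - α + 1 ≠ -k := fun k e => h (k + 1) (by
    push_cast; linear_combination -e)
  have t1 := tame_hypCoef α (α - γ + 1) hab
  have t2 := tame_hypCoef β (β - γ + 1) hba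
  have ht := ((thetaOn_laurent t1 α).const_mul A).add ((thetaOn_laurent t2 β).const_mul B)
  have e1 := (ht.congr (f₁ := hyp α β γ) isOpen_exterior (fun z hz => hc z hz)
    fun z hz => rfl).eq_mul_deriv hy
  have e2 : ∀ (u : ℂ) (c : ℕ → ℂ), Tame c → laurent u (fun n => (s - u - n) * c n) y =
      laurent u (fun n => (-u - n) * c n) y + s * laurent u c y := fun u c hc => by
    rw [← laurent_const_mul, ← laurent_add (hc.euler _) (hc.const_mul _) _ hy]
    congr 1
    funext n
    ring
  rw [← e1, hc y hy, e2 _ _ t1, e2 _ _ t2]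
  simp only [solInf]
  ring

/-- Both sides of `deriv_hyp_contiguous` expand in the solutions at infinity for the single
parameter set `(α, β + 1, γ)`. Comparing the coefficients of the solution with exponent `α` gives
the relation. -/
theorem Connects.step {α β γ A B A' B' : ℂ} (hγ : ∀ k : ℕ, γ ≠ -k) (h : ∀ k : ℤ, α - β ≠ k)
    (hc : Connects α β γ A B) (hc' : Connects α (β + 1) (γ + 1) A' B') :
    γ * (β - α) * A = β * (γ - α) * A' := by
  have h' : ∀ k : ℤ, α - (β + 1) ≠ k := fun k e => h (k + 1) (by
    push_cast; linear_combination e)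
  have hab : ∀ k : ℕ, α - β ≠ -k := fun k e => h (-k) (by push_cast; exact e)
  have hba : ∀ k : ℕ, β - α + 1 ≠ -k := fun k e => h (k + 1) (by
    push_cast; linear_combination -e)
  set r := β * (β - γ + 1) / (β - α + 1)
  suffices γ * (β - α) * A - β * (γ - α) * A' = 0 from sub_eq_zero.1 this
  -- `Q` is the corresponding difference for the solution with exponent `β + 1`; only its existence
  -- matters.
  refine solInf_independent γ h' (Q := γ * (r * B) - β * ((γ - β - 1) * B')) fun y hy => ?_
  have key := deriv_hyp_contiguous α β hγ (exterior_subset_slit hy)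
  rw [hc.deriv h hy β, hc'.deriv h' hy γ] at key
  have e1 : laurent α (fun n => (β - α - n) * hypCoef α (α - γ + 1) (α - β + 1) n) y =
      (β - α) * solInf α (β + 1) γ y := by
    rw [solInf, ← laurent_const_mul, show α - (β + 1) + 1 = α - β by ring]
    congr 1
    funext n
    have := hypCoef_sub_nat_mul_denom (a := α) (b := α - γ + 1) hab n
    rw [neg_sub] at this
    exact this
  have e2 : laurent α (fun n => (γ - α - n) * hypCoef α (α - (γ + 1) + 1) (α - (β + 1) + 1) n) y =
      (γ - α) * solInf α (β + 1) γ y := by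
    rw [solInf, ← laurent_const_mul]
    congr 1
    funext n
    have := hypCoef_sub_nat_mul_num α (α - γ) (α - (β + 1) + 1) n
    rw [neg_sub] at this
    rw [show α - (γ + 1) + 1 = α - γ by ring]
    exact this
  -- `θ + β` kills the leading term of the solution with exponent `β`, so the result starts one
  -- power lower, at exponent `β + 1`. This is where the index shift and the sign in `r` come from.
  have e3 : laurent β (fun n => (β - β - n) * hypCoef β (β - γ + 1) (β - α + 1) n) y =
      r * solInf (β + 1) α γ y := by
    have t := tame_hypCoef (β + 1) (β + 1 - γ + 1) (ne_neg_natCast_add_one hba)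
    have : (fun n : ℕ => (β - β - n) * hypCoef β (β - γ + 1) (β - α + 1) n) =
        shiftCoef (fun n => -r * hypCoef (β + 1) (β - γ + 1 + 1) (β - α + 1 + 1) n) := by
      funext n
      cases n with
      | zero => simp [shiftCoef]
      | succ n =>
        have := hypCoef_succ_shift (a := β) (b := β - γ + 1) hba n
        simp only [shiftCoef, r]
        push_cast
        linear_combination -this
    rw [this]
    rw [show β + 1 - γ + 1 = β - γ + 1 + 1 by ring] at t
    have h0 := ne_zero_of_mem_exterior hy
    apply mul_left_cancel₀ h0
    rw [laurent_shiftCoef (t.const_mul (-r)) _ hy, laurent_const_mul, solInf,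
      show β + 1 - γ + 1 = β - γ + 1 + 1 by ring, show β + 1 - α + 1 = β - α + 1 + 1 by ring]
    linear_combination -r * laurent_add_one (c := hypCoef (β + 1) (β - γ + 1 + 1) (β - α + 1 + 1)) β hy
  have e4 : laurent (β + 1) (fun n => (γ - (β + 1) - n) *
      hypCoef (β + 1) (β + 1 - (γ + 1) + 1) (β + 1 - α + 1) n) y =
      (γ - β - 1) * solInf (β + 1) α γ y := by
    rw [solInf, ← laurent_const_mul]
    congr 1
    funext n
    have := hypCoef_sub_nat_mul_num (β + 1) (β + 1 - γ) (β + 1 - α + 1) n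
    rw [neg_sub] at this
    rw [show β + 1 - (γ + 1) + 1 = β + 1 - γ by ring]
    rw [this]
    ring
  rw [e1, e2, e3, e4] at key
  linear_combination key


/-! ### Evaluation of the connection coefficients -/

/-- Factor by factor the product dominates `(r + 1)_n = (r + n)! / r!`, which is at least `(n + 1)^r
n! / r!`. -/
theorem norm_asc_ge {z : ℂ} {r : ℕ} (hz : (r : ℝ) + 1 ≤ z.re) (n : ℕ) :
    ((n : ℝ) + 1) ^ r * n.factorial ≤ r.factorial * ‖(ascPochhammer ℂ n).eval z‖ := by
  have h1 : ((r + 1).ascFactorial n : ℝ) ≤ ‖(ascPochhammer ℂ n).eval z‖ := by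
    induction n with
    | zero => simp
    | succ n ih =>
      rw [ascPochhammer_succ_eval, norm_mul, Nat.ascFactorial_succ, mul_comm]
      push_cast
      have : (r : ℝ) + 1 + n ≤ ‖z + n‖ := by
        refine le_trans ?_ ((le_abs_self _).trans (Complex.abs_re_le_norm _))
        rw [Complex.add_re, Complex.natCast_re]
        linarith
      gcongr
  have h2 : (n + 1) ^ r * n.factorial ≤ r.factorial * (r + 1).ascFactorial n := by
    rw [Nat.factorial_mul_ascFactorial, add_comm r n, ← Nat.factorial_mul_ascFactorial, mul_comm]
    exact Nat.mul_le_mul_left _ (Nat.pow_succ_le_ascFactorial _ _)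
  calc ((n : ℝ) + 1) ^ r * n.factorial ≤ r.factorial * (r + 1).ascFactorial n := by
        exact_mod_cast h2
    _ ≤ _ := by gcongr

/-- A large real part of `γ` gives the denominator enough extra powers of `n + 1` to beat the
polynomial growth from `α` and `β`. The bound is uniform in `γ`, as dominated convergence requires.
-/
theorem exists_hypCoef_bound (α β : ℂ) : ∃ (X C : ℝ), 0 < X ∧ ∀ γ : ℂ, X ≤ γ.re → ∀ n : ℕ,
    ‖hypCoef α β γ n‖ ≤ C * (1 / ((n : ℝ) + 1) ^ 2) := by
  obtain ⟨p, hp⟩ := exists_norm_asc_le α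
  obtain ⟨q, hq⟩ := exists_norm_asc_le β
  set r := p + q + 2
  refine ⟨(r : ℝ) + 1, r.factorial, by positivity, fun γ hγ n => ?_⟩
  have h := norm_asc_ge hγ n
  have hpos : 0 < ‖(ascPochhammer ℂ n).eval γ‖ := by
    have h1 : 0 < ((n : ℝ) + 1) ^ r * n.factorial := by positivity
    have h2 : 0 < (r.factorial : ℝ) := by positivity
    exact pos_of_mul_pos_right (h1.trans_le h) h2.le
  rw [hypCoef, norm_div, norm_mul, norm_mul, Complex.norm_natCast, mul_one_div,
    div_le_div_iff₀ (by positivity) (by positivity)]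
  calc ‖(ascPochhammer ℂ n).eval α‖ * ‖(ascPochhammer ℂ n).eval β‖ * ((n : ℝ) + 1) ^ 2
      ≤ (((n : ℝ) + 1) ^ p * n.factorial) * (((n : ℝ) + 1) ^ q * n.factorial) *
          ((n : ℝ) + 1) ^ 2 := by
        gcongr
        · exact hp n
        · exact hq n
    _ = (((n : ℝ) + 1) ^ r * n.factorial) * n.factorial := by simp only [r]; ring
    _ ≤ (r.factorial * ‖(ascPochhammer ℂ n).eval γ‖) * n.factorial := by gcongr
    _ = _ := by ring

theorem summable_one_div_succ_sq : Summable fun n : ℕ => 1 / ((n : ℝ) + 1) ^ 2 := by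
  have := (summable_nat_add_iff 1).2 (Real.summable_one_div_nat_pow.2 (one_lt_two))
  refine this.congr fun n => ?_
  push_cast
  rfl

/-- Every term with `n ≥ 1` has a denominator of modulus at least `re (γ + N)`; only the term `n =
0` survives. -/
theorem tendsto_tsum_hypCoef (α β γ : ℂ) :
    Tendsto (fun N : ℕ => ∑' n, hypCoef α β (γ + N) n) atTop (𝓝 1) := by
  obtain ⟨X, C, hX, hC⟩ := exists_hypCoef_bound α β
  have hre : Tendsto (fun N : ℕ => (γ + N).re) atTop atTop := by
    simp only [Complex.add_re, Complex.natCast_re]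
    exact tendsto_atTop_add_const_left _ _ tendsto_natCast_atTop_atTop
  have hlim : ∑' n : ℕ, (if n = 0 then (1 : ℂ) else 0) = 1 := by simp
  rw [← hlim]
  refine tendsto_tsum_of_dominated_convergence (summable_one_div_succ_sq.mul_left C) ?_ ?_
  · intro n
    cases n with
    | zero => simp [hypCoef_zero]
    | succ n =>
      simp only [Nat.add_eq_zero_iff, one_ne_zero, and_false, if_false]
      rw [tendsto_zero_iff_norm_tendsto_zero]
      set K : ℝ := ‖(ascPochhammer ℂ (n + 1)).eval α * (ascPochhammer ℂ (n + 1)).eval β‖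
      have hlim : Tendsto (fun N : ℕ => K * ((γ + N).re)⁻¹) atTop (𝓝 0) := by
        simpa using (tendsto_inv_atTop_zero.comp hre).const_mul K
      refine squeeze_zero' (Eventually.of_forall fun N => norm_nonneg _) ?_ hlim
      filter_upwards [hre.eventually_ge_atTop 1] with N hN
      rw [hypCoef, norm_div, div_eq_mul_inv]
      gcongr
      rw [ascPochhammer_succ_left]
      simp only [Polynomial.eval_mul, Polynomial.eval_X, Polynomial.eval_comp, Polynomial.eval_add,
        Polynomial.eval_one, norm_mul, Complex.norm_natCast]
      have h1 : (γ + N).re ≤ ‖γ + N‖ := (le_abs_self _).trans (Complex.abs_re_le_norm _)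
      have h2 := norm_asc_ge (z := γ + N + 1) (r := 0) (by
        simp only [Complex.add_re, Complex.one_re, Complex.natCast_re] at hN ⊢
        norm_num
        linarith) n
      simp only [pow_zero, one_mul, Nat.factorial_zero, Nat.cast_one] at h2
      have h3 : (1 : ℝ) ≤ n.factorial := by exact_mod_cast n.factorial_pos
      have h4 : (1 : ℝ) ≤ (n + 1).factorial := by exact_mod_cast (n + 1).factorial_pos
      calc (γ + N).re = (γ + N).re * 1 * 1 := by ring
        _ ≤ _ := by gcongr; linarith
  · filter_upwards [hre.eventually_ge_atTop X] with N hN n using hC _ hN n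

theorem tendsto_psum_one {c : ℕ → ℂ} (hc : Summable fun n => ‖c n‖) {z : ℝ → ℂ}
    (hz : ∀ᶠ t in atTop, ‖z t‖ ≤ 1) (hz1 : Tendsto z atTop (𝓝 1)) :
    Tendsto (fun t => psum c (z t)) atTop (𝓝 (∑' n, c n)) := by
  refine tendsto_tsum_of_dominated_convergence hc (fun n => ?_) ?_
  · simpa using (hz1.pow n).const_mul (c n)
  · filter_upwards [hz] with t ht n
    rw [norm_mul, norm_pow]
    exact mul_le_of_le_one_right (norm_nonneg _) (pow_le_one₀ (norm_nonneg _) ht)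

/-- The dominant connection coefficient is the sum of the transformed series at `1`. -/
theorem Connects.eq_tsum {α β γ A B : ℂ} (hγ : ∀ k : ℕ, γ ≠ -k) (h : ∀ k : ℤ, α - β ≠ k)
    (hc : Connects α β γ A B) (hre : α.re < β.re)
    (hs : Summable fun n => ‖hypCoef α (γ - β) γ n‖) : A = ∑' n, hypCoef α (γ - β) γ n := by
  have hab : ∀ k : ℕ, α - β + 1 ≠ -k := fun k e => h (-k - 1) (by
    push_cast; linear_combination e)
  have hba : ∀ k : ℕ, β - α + 1 ≠ -k := fun k e => h (k + 1) (by
    push_cast; linear_combination -e)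
  have t1 := tendsto_laurent (tame_hypCoef α (α - γ + 1) hab) α
  have t2 := tendsto_laurent (tame_hypCoef β (β - γ + 1) hba) β
  rw [hypCoef_zero] at t1 t2
  have t3 : Tendsto (fun t : ℝ => Complex.exp ((α - β) * (Real.log t : ℂ))) atTop (𝓝 0) := by
    rw [tendsto_zero_iff_norm_tendsto_zero]
    simp only [Complex.norm_exp, Complex.re_mul_ofReal]
    refine Real.tendsto_exp_atBot.comp ?_
    refine Real.tendsto_log_atTop.const_mul_atTop_of_neg ?_
    rw [Complex.sub_re]
    linarith
  -- Along `y = -t`, multiplication by `t^α` isolates `A`, because `re α < re β` makes the other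
  -- solution negligible.
  have t4 : Tendsto (fun t : ℝ => Complex.exp (α * (Real.log t : ℂ)) * hyp α β γ (-(t : ℂ))) atTop
      (𝓝 A) := by
    have := (t1.const_mul A).add ((t3.mul t2).const_mul B)
    simp only [mul_one, mul_zero, add_zero] at this
    refine this.congr' ?_
    filter_upwards [eventually_gt_atTop 1] with t ht
    rw [hc _ (neg_mem_exterior ht), sub_mul, Complex.exp_sub]
    have := Complex.exp_ne_zero (β * (Real.log t : ℂ))
    simp only [solInf]
    field_simp
  -- The same limit by Pfaff's transformation: its argument `t / (t + 1)` tends to `1` and `t^α (1 +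
  -- t)^(-α)` tends to `1`.
  have t5 : Tendsto (fun t : ℝ => Complex.exp (α * (Real.log t : ℂ)) * hyp α β γ (-(t : ℂ))) atTop
      (𝓝 (∑' n, hypCoef α (γ - β) γ n)) := by
    have s1 : Tendsto (fun t : ℝ => Complex.exp (-α *
        ((Real.log (1 + t) - Real.log t : ℝ) : ℂ))) atTop (𝓝 1) := by
      have := (Complex.continuous_exp.tendsto _).comp
        (tendsto_log_one_add_sub_log.const_mul (-α))
      simpa [Function.comp_def] using this
    have s2 : Tendsto (fun t : ℝ => ((t / (t + 1) : ℝ) : ℂ)) atTop (𝓝 1) := by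
      rw [← Complex.ofReal_one]
      refine (Complex.continuous_ofReal.tendsto _).comp ?_
      have : Tendsto (fun t : ℝ => 1 - (t + 1)⁻¹) atTop (𝓝 (1 - 0)) :=
        (tendsto_inv_atTop_zero.comp (tendsto_atTop_add_const_right _ 1 tendsto_id)).const_sub 1
      rw [sub_zero] at this
      refine this.congr' ?_
      filter_upwards [eventually_gt_atTop 0] with t ht
      field_simp
      ring
    have s3 := tendsto_psum_one hs (z := fun t : ℝ => ((t / (t + 1) : ℝ) : ℂ)) (by
      filter_upwards [eventually_gt_atTop 0] with t ht
      rw [Complex.norm_real, Real.norm_eq_abs, abs_of_pos (by positivity), div_le_one (by positivity)]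
      linarith) s2
    have := s1.mul s3
    rw [one_mul] at this
    refine this.congr' ?_
    filter_upwards [eventually_gt_atTop 0] with t ht
    rw [hyp_eq_pfaff α β hγ (by rw [Complex.neg_re, Complex.ofReal_re]; linarith), ← mul_assoc,
      ← Complex.exp_add, sub_neg_eq_add, ← Complex.ofReal_one, ← Complex.ofReal_add,
      ← Complex.ofReal_log (by positivity)]
    congr 2
    · push_cast
      ring
    · push_cast
      rw [← neg_add', neg_div_neg_eq]
  exact tendsto_nhds_unique t4 t5

theorem inv_GammaSeq (z : ℂ) (n : ℕ) : (Complex.GammaSeq z n)⁻¹ =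
    (ascPochhammer ℂ (n + 1)).eval z / ((n : ℂ) ^ z * n.factorial) := by
  rw [Complex.GammaSeq, inv_div]
  congr 1
  induction n with
  | zero => simp
  | succ n ih => rw [Finset.prod_range_succ, ih, ascPochhammer_succ_eval (n + 1)]

/-- Working with `1 / Γ` avoids any condition at the poles: there the Pochhammer symbol is
eventually zero, matching Mathlib's value `Γ = 0`. -/
theorem tendsto_inv_GammaSeq (z : ℂ) :
    Tendsto (fun n => (Complex.GammaSeq z n)⁻¹) atTop (𝓝 (Complex.Gamma z)⁻¹) := by
  by_cases h : ∀ k : ℕ, z ≠ -k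
  · exact (Complex.GammaSeq_tendsto_Gamma z).inv₀ (Complex.Gamma_ne_zero h)
  · push Not at h
    obtain ⟨k, rfl⟩ := h
    rw [Complex.Gamma_neg_nat_eq_zero, inv_zero]
    refine tendsto_const_nhds.congr' ?_
    filter_upwards [eventually_ge_atTop k] with n hn
    rw [inv_GammaSeq, ascPochhammer_eval_neg_coe_nat_of_lt (by omega), zero_div]

/-- The powers of `n` and the factorials in Euler's limit cancel, because `β + (γ - α) = γ + (β -
α)` and there are two symbols above and two below. -/
theorem tendsto_asc_ratio {α β γ : ℂ} (hγ : ∀ k : ℕ, γ ≠ -k) (h : ∀ k : ℕ, β - α ≠ -k) :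
    Tendsto (fun n => (ascPochhammer ℂ (n + 1)).eval β * (ascPochhammer ℂ (n + 1)).eval (γ - α) /
      ((ascPochhammer ℂ (n + 1)).eval γ * (ascPochhammer ℂ (n + 1)).eval (β - α))) atTop
      (𝓝 (Complex.Gamma γ * Complex.Gamma (β - α) /
        (Complex.Gamma β * Complex.Gamma (γ - α)))) := by
  have t := ((tendsto_inv_GammaSeq β).mul (tendsto_inv_GammaSeq (γ - α))).div
    ((tendsto_inv_GammaSeq γ).mul (tendsto_inv_GammaSeq (β - α)))
    (mul_ne_zero (inv_ne_zero (Complex.Gamma_ne_zero hγ)) (inv_ne_zero (Complex.Gamma_ne_zero h)))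
  have e : (Complex.Gamma β)⁻¹ * (Complex.Gamma (γ - α))⁻¹ /
      ((Complex.Gamma γ)⁻¹ * (Complex.Gamma (β - α))⁻¹) =
      Complex.Gamma γ * Complex.Gamma (β - α) / (Complex.Gamma β * Complex.Gamma (γ - α)) := by
    rw [← mul_inv, ← mul_inv, inv_div_inv]
  rw [← e]
  refine t.congr' ?_
  filter_upwards [eventually_gt_atTop 0] with n hn
  have hn0 : (n : ℂ) ≠ 0 := by exact_mod_cast hn.ne'
  have hf : (n.factorial : ℂ) ≠ 0 := by exact_mod_cast n.factorial_ne_zero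
  have h1 := asc_ne_zero hγ (n + 1)
  have h2 := asc_ne_zero h (n + 1)
  simp only [Pi.div_apply, inv_GammaSeq]
  rw [Complex.cpow_sub _ _ hn0, Complex.cpow_sub _ _ hn0]
  have a1 : (n : ℂ) ^ α ≠ 0 := by simp [Complex.cpow_eq_zero_iff, hn0]
  have a2 : (n : ℂ) ^ β ≠ 0 := by simp [Complex.cpow_eq_zero_iff, hn0]
  have a3 : (n : ℂ) ^ γ ≠ 0 := by simp [Complex.cpow_eq_zero_iff, hn0]
  field_simp

/-- Iterating the contiguity step `N` times expresses `A` as a ratio of Pochhammer symbols times the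
coefficient `a N` at `(α, β + N, γ + N)`. For large `N` that coefficient is the Pfaff-transformed
series at `1`, whose second parameter `γ - β` is unaffected by the shift, so it tends to `1`. -/
theorem Connects.eq_Gamma {α β γ A B : ℂ} (hγ : ∀ k : ℕ, γ ≠ -k) (h : ∀ k : ℤ, α - β ≠ k)
    (hc : Connects α β γ A B) :
    A = Complex.Gamma γ * Complex.Gamma (β - α) / (Complex.Gamma β * Complex.Gamma (γ - α)) := by
  have hγN : ∀ N : ℕ, ∀ k : ℕ, γ + N ≠ -k := fun N k e => hγ (N + k) (by
    push_cast; linear_combination e)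
  have hN : ∀ N : ℕ, ∀ k : ℤ, α - (β + N) ≠ k := fun N k e => h (N + k) (by
    push_cast; linear_combination e)
  have hba : ∀ k : ℕ, β - α ≠ -k := fun k e => h k (by push_cast; linear_combination -e)
  choose a b hab using fun N : ℕ => exists_connects (hγN N) (hN N)
  have h0 : A = a 0 := by
    have h1 := hab 0
    simp only [Nat.cast_zero, add_zero] at h1
    refine sub_eq_zero.1 (solInf_independent γ h (P := A - a 0) (Q := B - b 0) fun y hy => ?_)
    linear_combination h1 y hy - hc y hy
  have hstep : ∀ N : ℕ, (γ + N) * (β - α + N) * a N = (β + N) * (γ - α + N) * a (N + 1) := by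
    intro N
    have h1 := hab (N + 1)
    have e1 : β + ((N + 1 : ℕ) : ℂ) = β + N + 1 := by push_cast; ring
    have e2 : γ + ((N + 1 : ℕ) : ℂ) = γ + N + 1 := by push_cast; ring
    rw [e1, e2] at h1
    have := (hab N).step (hγN N) (hN N) h1
    linear_combination this
  have hprod : ∀ N : ℕ, (ascPochhammer ℂ N).eval γ * (ascPochhammer ℂ N).eval (β - α) * a 0 =
      (ascPochhammer ℂ N).eval β * (ascPochhammer ℂ N).eval (γ - α) * a N := by
    intro N
    induction N with
    | zero => simp
    | succ N ih =>
      simp only [ascPochhammer_succ_eval]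
      linear_combination (γ + N) * (β - α + N) * ih +
        (ascPochhammer ℂ N).eval β * (ascPochhammer ℂ N).eval (γ - α) * hstep N
  have hlim : Tendsto a atTop (𝓝 1) := by
    obtain ⟨X, C, hX, hC⟩ := exists_hypCoef_bound α (γ - β)
    refine (tendsto_tsum_hypCoef α (γ - β) γ).congr' ?_
    have hre : ∀ z : ℂ, Tendsto (fun N : ℕ => (z + N).re) atTop atTop := fun z => by
      simp only [Complex.add_re, Complex.natCast_re]
      exact tendsto_atTop_add_const_left _ _ tendsto_natCast_atTop_atTop
    filter_upwards [(hre γ).eventually_ge_atTop X, (hre β).eventually_gt_atTop α.re] with N h1 h2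
    have e : γ + (N : ℂ) - (β + N) = γ - β := by ring
    have := (hab N).eq_tsum (hγN N) (hN N) h2 (by
      rw [e]
      exact Summable.of_nonneg_of_le (fun n => norm_nonneg _) (hC _ h1)
        (summable_one_div_succ_sq.mul_left C))
    rw [this, e]
  have t := (tendsto_asc_ratio hγ hba).mul (hlim.comp (tendsto_add_atTop_nat 1))
  rw [mul_one] at t
  rw [h0]
  refine tendsto_nhds_unique (tendsto_const_nhds.congr fun n => ?_) t
  have h1 := asc_ne_zero hγ (n + 1)
  have h2 := asc_ne_zero hba (n + 1)
  have := hprod (n + 1)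
  simp only [Function.comp]
  field_simp
  linear_combination this

/-- The connection formula between the origin and infinity. -/
theorem hyp_eq_solInf {α β γ : ℂ} (hγ : ∀ k : ℕ, γ ≠ -k) (h : ∀ k : ℤ, α - β ≠ k) {y : ℂ}
    (hy : y ∈ exterior) : hyp α β γ y =
      Complex.Gamma γ * Complex.Gamma (β - α) / (Complex.Gamma β * Complex.Gamma (γ - α)) *
        solInf α β γ y +
      Complex.Gamma γ * Complex.Gamma (α - β) / (Complex.Gamma α * Complex.Gamma (γ - β)) *
        solInf β α γ y := by
  obtain ⟨A, B, hc⟩ := exists_connects hγ h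
  have h' : ∀ k : ℤ, β - α ≠ k := fun k e => h (-k) (by push_cast; linear_combination -e)
  -- Symmetry in `α` and `β` exchanges the two coefficients, so one evaluation gives both.
  have hc' : Connects β α γ B A := fun y hy => by
    rw [hyp_comm β α hγ (exterior_subset_slit hy), hc y hy, add_comm]
  rw [hc y hy, hc.eq_Gamma hγ h, hc'.eq_Gamma hγ h']

end HornH5
end

noncomputable section
namespace HornH5
open Filter Metric

/-! ### Analyticity of double power series -/

/-- The monomial `x ^ i * y ^ (k - i)` as a `k`-linear map in `(x, y)`. -/
def monomialMap (k i : ℕ) : ContinuousMultilinearMap ℂ (fun _ : Fin k => ℂ × ℂ) ℂ :=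
  (ContinuousMultilinearMap.mkPiAlgebra ℂ (Fin k) ℂ).compContinuousLinearMap fun l =>
    if (l : ℕ) < i then ContinuousLinearMap.fst ℂ ℂ ℂ else ContinuousLinearMap.snd ℂ ℂ ℂ

theorem monomialMap_apply (k i : ℕ) (v : Fin k → ℂ × ℂ) :
    monomialMap k i v = ∏ l : Fin k, if (l : ℕ) < i then (v l).1 else (v l).2 := by
  simp only [monomialMap, ContinuousMultilinearMap.compContinuousLinearMap_apply,
    ContinuousMultilinearMap.mkPiAlgebra_apply]
  refine Finset.prod_congr rfl fun l _ => ?_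
  split_ifs <;> rfl

theorem monomialMap_diag (i j : ℕ) (q : ℂ × ℂ) :
    monomialMap (i + j) i (fun _ => q) = q.1 ^ i * q.2 ^ j := by
  rw [monomialMap_apply, Fin.prod_univ_add]
  simp

theorem norm_monomialMap_le (k i : ℕ) : ‖monomialMap k i‖ ≤ 1 := by
  refine ContinuousMultilinearMap.opNorm_le_bound zero_le_one fun v => ?_
  rw [monomialMap_apply, one_mul, norm_prod]
  refine Finset.prod_le_prod (fun _ _ => norm_nonneg _) fun l _ => ?_
  split_ifs
  · exact norm_fst_le _
  · exact norm_snd_le _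

theorem summable_double {c : ℕ → ℕ → ℂ} {C : ℝ} (hc : ∀ i j, ‖c i j‖ ≤ C) {x y : ℂ}
    (hx : ‖x‖ < 1) (hy : ‖y‖ < 1) :
    Summable fun p : ℕ × ℕ => c p.1 p.2 * (x ^ p.1 * y ^ p.2) := by
  have h := ((summable_geometric_of_lt_one (norm_nonneg x) hx).mul_of_nonneg
    (summable_geometric_of_lt_one (norm_nonneg y) hy) (fun _ => by positivity)
    (fun _ => by positivity)).mul_left C
  refine Summable.of_norm_bounded h fun p => ?_
  rw [norm_mul, norm_mul, norm_pow, norm_pow]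
  gcongr
  exact hc _ _

/-- Grouping by total degree `k` gives multilinear maps of norm at most `(k + 1) C`, so the radius
of convergence is at least `1`. -/
theorem analyticOnNhd_double {c : ℕ → ℕ → ℂ} {C : ℝ} (hc : ∀ i j, ‖c i j‖ ≤ C) :
    AnalyticOnNhd ℂ (fun q : ℂ × ℂ => ∑' p : ℕ × ℕ, c p.1 p.2 * (q.1 ^ p.1 * q.2 ^ p.2))
      (ball 0 1) := by
  intro q₀ hq₀
  obtain ⟨r, h1, h2⟩ := exists_between (mem_ball_zero_iff.1 hq₀)
  have hr0 : 0 < r := (norm_nonneg _).trans_lt h1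
  lift r to NNReal using hr0.le
  set p : FormalMultilinearSeries ℂ (ℂ × ℂ) ℂ := fun k =>
    ∑ ij ∈ Finset.HasAntidiagonal.antidiagonal k, c ij.1 ij.2 • monomialMap k ij.1 with hp
  have hC0 : 0 ≤ C := (norm_nonneg _).trans (hc 0 0)
  have hpn : ∀ k, ‖p k‖ ≤ ((k : ℝ) + 1) * C := fun k => by
    refine (norm_sum_le _ _).trans ?_
    calc ∑ ij ∈ Finset.HasAntidiagonal.antidiagonal k, ‖c ij.1 ij.2 • monomialMap k ij.1‖
        ≤ ∑ ij ∈ Finset.HasAntidiagonal.antidiagonal k, C := by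
          refine Finset.sum_le_sum fun ij _ => ?_
          rw [norm_smul]
          exact (mul_le_mul (hc _ _) (norm_monomialMap_le _ _) (norm_nonneg _) hC0).trans
            (mul_one C).le
      _ = ((k : ℝ) + 1) * C := by
          rw [Finset.sum_const, Finset.Nat.card_antidiagonal, nsmul_eq_mul]
          push_cast
          ring
  have hball : HasFPowerSeriesOnBall
      (fun q : ℂ × ℂ => ∑' p : ℕ × ℕ, c p.1 p.2 * (q.1 ^ p.1 * q.2 ^ p.2)) p 0
      (r : ENNReal) := by
    refine ⟨?_, by simpa using hr0, ?_⟩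
    · obtain ⟨D, -, hD⟩ := exists_bound_pow_mul_geometric 1 hr0.le h2
      refine p.le_radius_of_bound (D * C) fun n => ?_
      calc ‖p n‖ * r ^ n ≤ (((n : ℝ) + 1) * C) * r ^ n := by gcongr; exact hpn n
        _ = (((n : ℝ) + 1) ^ 1 * r ^ n) * C := by ring
        _ ≤ D * C := by gcongr; exact hD n
    · intro q hq
      rw [Metric.eball_coe, mem_ball_zero_iff] at hq
      have hq' : ‖q‖ < r := hq
      have hs := (summable_double hc ((norm_fst_le q).trans_lt (hq'.trans h2))
        ((norm_snd_le q).trans_lt (hq'.trans h2))).hasSum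
      rw [zero_add]
      have := (Finset.HasAntidiagonal.sigmaAntidiagonalEquivProd.hasSum_iff.2 hs).sigma
        (fun k => hasSum_fintype _)
      refine (congrArg (fun f => HasSum f _) (funext fun k => ?_)).mp this
      symm
      simp only [hp, sum_apply, smul_apply, smul_eq_mul, Function.comp]
      rw [← Finset.sum_coe_sort]
      refine Finset.sum_congr rfl fun ij _ => ?_
      obtain ⟨⟨i, j⟩, hij⟩ := ij
      obtain rfl := Finset.HasAntidiagonal.mem_antidiagonal.1 hij
      simp only [monomialMap_diag]
      rfl
  exact hball.analyticOnNhd _ (by rw [Metric.eball_coe]; exact mem_ball_zero_iff.2 h1)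

/-- A series of holomorphic functions times powers of a second variable, locally uniformly bounded,
is analytic in both variables. -/
theorem analyticAt_tsum_pow_mul {g : ℕ → ℂ → ℂ} {y₀ : ℂ} {ε r C : ℝ} (hε : 0 < ε) (hr : 0 < r)
    (hg : ∀ m, DifferentiableOn ℂ (g m) (ball y₀ ε))
    (hC : ∀ m, ∀ y ∈ ball y₀ ε, ‖g m y‖ * r ^ m ≤ C) {x₀ : ℂ} (hx₀ : ‖x₀‖ < r) :
    AnalyticAt ℂ (fun q : ℂ × ℂ => ∑' m, q.1 ^ m * g m q.2) (x₀, y₀) := by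
  set ρ := ε / 2 with hρ
  have hρ0 : 0 < ρ := half_pos hε
  have hρε : ρ < ε := half_lt_self hε
  -- Taylor coefficients rescaled to the unit polydisc; the Cauchy estimate on the circle of radius
  -- `ρ` bounds all of them by `C`.
  set c : ℕ → ℕ → ℂ := fun m n =>
    ((n.factorial : ℂ)⁻¹ * iteratedDeriv n (g m) y₀) * ((r : ℂ) ^ m * (ρ : ℂ) ^ n) with hc
  have hcb : ∀ m n, ‖c m n‖ ≤ C := fun m n => by
    have hrm : (0 : ℝ) < r ^ m := by positivity
    have hdc : DiffContOnCl ℂ (g m) (ball y₀ ρ) :=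
      ((hg m).mono (closedBall_subset_ball hρε)).diffContOnCl_ball subset_rfl
    have := Complex.norm_iteratedDeriv_le_of_forall_mem_sphere_norm_le n hρ0 hdc
      (C := C / r ^ m) fun z hz => by
        rw [le_div_iff₀ hrm]
        exact hC m z (closedBall_subset_ball hρε (sphere_subset_closedBall hz))
    have hn : (0 : ℝ) < n.factorial := by exact_mod_cast n.factorial_pos
    simp only [hc, norm_mul, norm_inv, Complex.norm_natCast, norm_pow, Complex.norm_real,
      Real.norm_eq_abs, abs_of_pos hr, abs_of_pos hρ0]
    calc (n.factorial : ℝ)⁻¹ * ‖iteratedDeriv n (g m) y₀‖ * (r ^ m * ρ ^ n)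
        ≤ (n.factorial : ℝ)⁻¹ * (n.factorial * (C / r ^ m) / ρ ^ n) * (r ^ m * ρ ^ n) := by gcongr
      _ = C := by field_simp
  have han := analyticOnNhd_double hcb
  have hr0 : (r : ℂ) ≠ 0 := by exact_mod_cast hr.ne'
  have hρ0' : (ρ : ℂ) ≠ 0 := by exact_mod_cast hρ0.ne'
  have hin : AnalyticAt ℂ (fun q : ℂ × ℂ => (q.1 / (r : ℂ), (q.2 - y₀) / (ρ : ℂ))) (x₀, y₀) :=
    (analyticAt_fst.div analyticAt_const hr0).prod
      ((analyticAt_snd.sub analyticAt_const).div analyticAt_const hρ0')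
  have h0 : ‖x₀ / (r : ℂ)‖ < 1 := by
    rw [norm_div, Complex.norm_real, Real.norm_eq_abs, abs_of_pos hr, div_lt_one hr]
    exact hx₀
  have hcomp := (han (x₀ / (r : ℂ), (y₀ - y₀) / (ρ : ℂ)) (by
    rw [mem_ball_zero_iff, Prod.norm_def, sub_self, zero_div, norm_zero]
    exact max_lt h0 zero_lt_one)).comp_of_eq hin rfl
  refine hcomp.congr ?_
  have hU : {q : ℂ × ℂ | ‖q.1‖ < r ∧ ‖q.2 - y₀‖ < ρ} ∈ 𝓝 (x₀, y₀) := by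
    refine IsOpen.mem_nhds ?_ ⟨hx₀, by simpa using hρ0⟩
    have h1 : IsOpen {q : ℂ × ℂ | ‖q.1‖ < r} := isOpen_lt (by fun_prop) (by fun_prop)
    have h2 : IsOpen {q : ℂ × ℂ | ‖q.2 - y₀‖ < ρ} := isOpen_lt (by fun_prop) (by fun_prop)
    exact h1.inter h2
  filter_upwards [hU] with q hq
  have hx : ‖q.1 / (r : ℂ)‖ < 1 := by
    rw [norm_div, Complex.norm_real, Real.norm_eq_abs, abs_of_pos hr, div_lt_one hr]
    exact hq.1
  have hy : ‖(q.2 - y₀) / (ρ : ℂ)‖ < 1 := by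
    rw [norm_div, Complex.norm_real, Real.norm_eq_abs, abs_of_pos hρ0, div_lt_one hρ0]
    exact hq.2
  simp only [Function.comp]
  rw [(summable_double hcb hx hy).tsum_prod]
  refine tsum_congr fun m => ?_
  have ht := Complex.taylorSeries_eq_on_ball' (c := y₀) (r := ε) (z := q.2)
    (by rw [mem_ball_iff_norm]; exact hq.2.trans hρε) (hg m)
  rw [← ht, ← tsum_mul_left]
  refine tsum_congr fun n => ?_
  simp only [hc, div_pow]
  field_simp

end HornH5
end

noncomputable section
namespace HornH5
open Filter Metric

/-! ### Factorial estimates -/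

/-- A single term of the binomial expansion of `(p + q)^(a + b)`. -/
theorem factorial_add_mul_pow_le (a b : ℕ) {p q : ℝ} (hp : 0 ≤ p) (hq : 0 ≤ q) :
    ((a + b).factorial : ℝ) * (p ^ a * q ^ b) ≤ a.factorial * b.factorial * (p + q) ^ (a + b) := by
  have h1 : ((a + b).choose a : ℝ) * (p ^ a * q ^ b) ≤ (p + q) ^ (a + b) := by
    rw [add_pow]
    have := Finset.single_le_sum (f := fun m => p ^ m * q ^ (a + b - m) * ((a + b).choose m : ℝ))
      (s := Finset.range (a + b + 1)) (a := a) (fun i _ => by positivity)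
      (Finset.mem_range.2 (by omega))
    simp only [Nat.add_sub_cancel_left] at this
    linarith
  have h2 : ((a + b).factorial : ℝ) = (a + b).choose a * a.factorial * b.factorial := by
    have := Nat.add_choose_mul_factorial_mul_factorial a b
    rw [← Nat.choose_symm_add] at this
    exact_mod_cast this.symm
  rw [h2]
  calc ((a + b).choose a * a.factorial * b.factorial : ℝ) * (p ^ a * q ^ b)
      = a.factorial * b.factorial * (((a + b).choose a : ℝ) * (p ^ a * q ^ b)) := by ring
    _ ≤ _ := by gcongr

/-- The induction step is `e N^(N + 1) ≤ (N + 1)^(N + 1)`. -/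
theorem factorial_le_stirling (N : ℕ) :
    ((N.factorial : ℝ)) * Real.exp N ≤ Real.exp 1 * (N + 1) * (N : ℝ) ^ N := by
  rcases Nat.eq_zero_or_pos N with rfl | hN
  · simp
  suffices ((N.factorial : ℝ)) * Real.exp N ≤ Real.exp 1 * N * (N : ℝ) ^ N by
    refine this.trans ?_
    gcongr
    linarith
  induction N, hN using Nat.le_induction with
  | base => simp
  | succ N hN ih =>
    have hN' : (0 : ℝ) < N := by exact_mod_cast hN
    have h1 : Real.exp 1 * (N : ℝ) ^ (N + 1) ≤ ((N : ℝ) + 1) ^ (N + 1) := by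
      have h2 : (N : ℝ) / (N + 1) ≤ Real.exp (-(1 / ((N : ℝ) + 1))) := by
        have := Real.add_one_le_exp (-(1 / ((N : ℝ) + 1)))
        refine le_trans (le_of_eq ?_) this
        field_simp
        ring
      have h3 : ((N : ℝ) / (N + 1)) ^ (N + 1) ≤ Real.exp (-1) := by
        calc ((N : ℝ) / (N + 1)) ^ (N + 1) ≤ Real.exp (-(1 / ((N : ℝ) + 1))) ^ (N + 1) := by gcongr
          _ = Real.exp (-1) := by
            rw [← Real.exp_nat_mul]
            congr 1
            push_cast
            field_simp
      rw [div_pow, div_le_iff₀ (by positivity), Real.exp_neg] at h3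
      calc Real.exp 1 * (N : ℝ) ^ (N + 1)
          ≤ Real.exp 1 * ((Real.exp 1)⁻¹ * ((N : ℝ) + 1) ^ (N + 1)) := by gcongr
        _ = _ := by rw [← mul_assoc, mul_inv_cancel₀ (Real.exp_ne_zero 1), one_mul]
    rw [Nat.factorial_succ]
    push_cast
    rw [Real.exp_add]
    calc ((N : ℝ) + 1) * N.factorial * (Real.exp N * Real.exp 1)
        = ((N : ℝ) + 1) * Real.exp 1 * (N.factorial * Real.exp N) := by ring
      _ ≤ ((N : ℝ) + 1) * Real.exp 1 * (Real.exp 1 * N * (N : ℝ) ^ N) := by gcongr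
      _ = Real.exp 1 * (N + 1) * (Real.exp 1 * (N : ℝ) ^ (N + 1)) := by ring
      _ ≤ Real.exp 1 * (N + 1) * ((N : ℝ) + 1) ^ (N + 1) := by gcongr

theorem pow_mul_le_factorial_mul_exp (k : ℕ) {x : ℝ} (hx : 0 ≤ x) :
    x ^ k ≤ k.factorial * Real.exp x := by
  have := Real.pow_div_factorial_le_exp x hx k
  rwa [div_le_iff₀' (by positivity)] at this

/-- An entropy bound for products of factorials. -/
theorem factorial_sq_mul_pow_le {m n l N : ℕ} (h : m + n + l = 2 * N) {p q r : ℝ} (hp : 0 ≤ p)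
    (hq : 0 ≤ q) (hr : 0 ≤ r) (hs : p + q + r = 2) :
    (N.factorial : ℝ) ^ 2 * (p ^ m * q ^ n * r ^ l) ≤
      Real.exp 1 ^ 2 * ((N : ℝ) + 1) ^ 2 * (m.factorial * n.factorial * l.factorial) := by
  rcases Nat.eq_zero_or_pos N with rfl | hN
  · obtain ⟨rfl, rfl, rfl⟩ : m = 0 ∧ n = 0 ∧ l = 0 := by omega
    simp
  have hN' : (0 : ℝ) < N := by exact_mod_cast hN
  have h1 := factorial_le_stirling N
  -- Each factor is `x^k ≤ k! eˣ` at `x = pN, qN, rN`. As `p + q + r = 2`, the exponentials multiply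
  -- to `e^(2N)`, which cancels against Stirling's bound for `N!²`.
  have h2 : (p * N) ^ m * (q * N) ^ n * (r * N) ^ l ≤
      (m.factorial * Real.exp (p * N)) * (n.factorial * Real.exp (q * N)) *
        (l.factorial * Real.exp (r * N)) := by
    gcongr <;> exact pow_mul_le_factorial_mul_exp _ (by positivity)
  have e1 : (p * N) ^ m * (q * N) ^ n * (r * N) ^ l =
      (p ^ m * q ^ n * r ^ l) * ((N : ℝ) ^ N) ^ 2 := by
    rw [← pow_mul, mul_comm N 2, ← h, pow_add, pow_add]
    ring
  have e2 : Real.exp (p * N) * Real.exp (q * N) * Real.exp (r * N) = Real.exp N ^ 2 := by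
    rw [← Real.exp_add, ← Real.exp_add, ← Real.exp_nat_mul]
    congr 1
    push_cast
    rw [← hs]
    ring
  rw [e1] at h2
  have hE : 0 < Real.exp N ^ 2 := by positivity
  have hNN : 0 < ((N : ℝ) ^ N) ^ 2 := by positivity
  refine le_of_mul_le_mul_right ?_ (mul_pos hE hNN)
  calc (N.factorial : ℝ) ^ 2 * (p ^ m * q ^ n * r ^ l) * (Real.exp N ^ 2 * ((N : ℝ) ^ N) ^ 2)
      = (N.factorial * Real.exp N) ^ 2 * ((p ^ m * q ^ n * r ^ l) * ((N : ℝ) ^ N) ^ 2) := by ring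
    _ ≤ (Real.exp 1 * (N + 1) * (N : ℝ) ^ N) ^ 2 * ((m.factorial * Real.exp (p * N)) *
        (n.factorial * Real.exp (q * N)) * (l.factorial * Real.exp (r * N))) := by gcongr
    _ = (Real.exp 1 * (N + 1) * (N : ℝ) ^ N) ^ 2 * (m.factorial * n.factorial * l.factorial) *
        (Real.exp (p * N) * Real.exp (q * N) * Real.exp (r * N)) := by ring
    _ = _ := by rw [e2]; ring

/-- A log-convex positive sequence has no strict interior maximum: once it increases, it keeps
increasing. -/
theorem le_max_of_logConvex {s : ℕ → ℝ} (K : ℕ) (hpos : ∀ k, k ≤ K → 0 < s k)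
    (h : ∀ k, k + 2 ≤ K → s (k + 1) ^ 2 ≤ s k * s (k + 2)) :
    ∀ k, k ≤ K → s k ≤ max (s 0) (s K) := by
  induction K with
  | zero =>
    intro k hk
    rw [Nat.le_zero.1 hk]
    exact le_max_left _ _
  | succ K ih =>
    have ih' := ih (fun k hk => hpos k (by omega)) fun k hk => h k (by omega)
    have hK : s K ≤ max (s 0) (s (K + 1)) := by
      rcases Nat.eq_zero_or_pos K with rfl | hK0
      · exact le_max_left _ _
      obtain ⟨J, rfl⟩ := Nat.exists_eq_succ_of_ne_zero hK0.ne'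
      by_contra hlt
      push Not at hlt
      obtain ⟨h1, h2⟩ := max_lt_iff.1 hlt
      have h3 := h J le_rfl
      have h4 := ih' J (Nat.le_succ J)
      have hJ := hpos J (by omega)
      have hJ1 := hpos (J + 1) (by omega)
      rw [Nat.succ_eq_add_one] at *
      have h5 : s (J + 1) < s J := by
        by_contra hle
        push Not at hle
        have : s J * s (J + 1 + 1) < s (J + 1) * s (J + 1) := by
          calc s J * s (J + 1 + 1) < s J * s (J + 1) := by gcongr
            _ ≤ _ := by gcongr
        nlinarith
      rcases le_max_iff.1 h4 with h6 | h6 <;> linarith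
    intro k hk
    rcases Nat.lt_or_ge k (K + 1) with hlt | hge
    · exact (ih' k (by omega)).trans (max_le (le_max_left _ _) hK)
    · rw [le_antisymm hk hge]
      exact le_max_right _ _

/-! ### The size of Pochhammer symbols with integer index -/

/-- `k!` for `k ≥ 0` and `1 / (-k)!` for `k ≤ 0`. -/
def intFac (k : ℤ) : ℝ := k.toNat.factorial / (-k).toNat.factorial

theorem intFac_pos (k : ℤ) : 0 < intFac k := by
  unfold intFac
  positivity

theorem intFac_natCast (n : ℕ) : intFac n = n.factorial := by simp [intFac]

theorem intFac_neg_natCast (n : ℕ) : intFac (-(n : ℤ)) = 1 / n.factorial := by simp [intFac]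

theorem intFac_of_eq {k : ℤ} {n : ℕ} (h : k = n) : intFac k = n.factorial := by
  rw [h, intFac_natCast]

theorem intFac_of_eq_neg {k : ℤ} {n : ℕ} (h : k = -n) : intFac k = 1 / n.factorial := by
  rw [h, intFac_neg_natCast]

theorem poch_natCast (z : ℂ) (n : ℕ) : poch z n = (ascPochhammer ℂ n).eval z := rfl

theorem asc_reflect (z : ℂ) (n : ℕ) : (ascPochhammer ℂ n).eval (z - n) =
    (-1) ^ n * (ascPochhammer ℂ n).eval (1 - z) := by
  induction n generalizing z with
  | zero => simp
  | succ n ih =>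
    rw [ascPochhammer_succ_eval n (1 - z), ascPochhammer_succ_left]
    simp only [Polynomial.eval_mul, Polynomial.eval_X, Polynomial.eval_comp, Polynomial.eval_add,
      Polynomial.eval_one]
    rw [show z - ((n + 1 : ℕ) : ℂ) + 1 = z - n by push_cast; ring, ih z]
    push_cast
    ring

theorem poch_neg_natCast (z : ℂ) (n : ℕ) :
    poch z (-(n : ℤ)) = (-1) ^ n * ((ascPochhammer ℂ n).eval (1 - z))⁻¹ := by
  cases n with
  | zero => simp [poch]
  | succ n =>
    have : poch z (-((n + 1 : ℕ) : ℤ)) = ((ascPochhammer ℂ (n + 1)).eval (z - (n + 1)))⁻¹ := by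
      rw [show (-((n + 1 : ℕ) : ℤ)) = Int.negSucc n from rfl]
      rfl
    rw [this, show z - ((n : ℂ) + 1) = z - ((n + 1 : ℕ) : ℂ) by push_cast; rfl, asc_reflect,
      mul_inv, ← inv_pow]
    norm_num

/-- `intFac` is the common size of all `(z)_k` up to powers of `|k| + 1`. A negative index puts `(1
- z)_n` in the denominator, hence the condition on `1 - z`. -/
theorem exists_norm_poch_le {z : ℂ} (hz : ∀ k : ℕ, 1 - z ≠ -k) : ∃ (C : ℝ) (p : ℕ), 0 < C ∧
    ∀ k : ℤ, ‖poch z k‖ ≤ C * ((k.natAbs : ℝ) + 1) ^ p * intFac k := by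
  obtain ⟨p, hp⟩ := exists_norm_asc_le z
  obtain ⟨C, q, hC, hq⟩ := exists_le_norm_asc hz
  refine ⟨C + 1, p + q, by positivity, fun k => ?_⟩
  obtain ⟨n, rfl | rfl⟩ := k.eq_nat_or_neg
  · rw [intFac_natCast, Int.natAbs_natCast, poch_natCast]
    refine (hp n).trans ?_
    have h1 : (1 : ℝ) ≤ (n : ℝ) + 1 := by linarith [n.cast_nonneg (α := ℝ)]
    have h2 : ((n : ℝ) + 1) ^ p ≤ ((n : ℝ) + 1) ^ (p + q) := pow_le_pow_right₀ h1 (by omega)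
    have h3 : ((n : ℝ) + 1) ^ (p + q) ≤ (C + 1) * ((n : ℝ) + 1) ^ (p + q) :=
      le_mul_of_one_le_left (by positivity) (by linarith)
    gcongr
    exact h2.trans h3
  · rw [intFac_neg_natCast, Int.natAbs_neg, Int.natAbs_natCast, poch_neg_natCast]
    have hpos : 0 < ‖(ascPochhammer ℂ n).eval (1 - z)‖ := norm_pos_iff.2 (asc_ne_zero hz n)
    rw [norm_mul, norm_pow, norm_neg, norm_one, one_pow, one_mul, norm_inv, mul_one_div,
      le_div_iff₀ (by positivity), inv_mul_le_iff₀ hpos]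
    have h1 : (1 : ℝ) ≤ (n : ℝ) + 1 := by linarith [n.cast_nonneg (α := ℝ)]
    have h2 : ((n : ℝ) + 1) ^ q ≤ ((n : ℝ) + 1) ^ (p + q) := pow_le_pow_right₀ h1 (by omega)
    calc (n.factorial : ℝ) ≤ C * ((n : ℝ) + 1) ^ q * ‖(ascPochhammer ℂ n).eval (1 - z)‖ := hq n
      _ ≤ (C + 1) * ((n : ℝ) + 1) ^ (p + q) * ‖(ascPochhammer ℂ n).eval (1 - z)‖ := by
          gcongr; linarith
      _ = _ := mul_comm _ _

theorem exists_le_norm_poch {z : ℂ} (hz : ∀ k : ℤ, z ≠ k) : ∃ (C : ℝ) (p : ℕ), 0 < C ∧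
    ∀ k : ℤ, intFac k ≤ C * ((k.natAbs : ℝ) + 1) ^ p * ‖poch z k‖ := by
  have hz1 : ∀ k : ℕ, z ≠ -k := fun k e => hz (-k) (by push_cast; exact e)
  have hz2 : ∀ k : ℕ, 1 - z ≠ -k := fun k e => hz (k + 1) (by push_cast; linear_combination -e)
  obtain ⟨p, hp⟩ := exists_norm_asc_le (1 - z)
  obtain ⟨C, q, hC, hq⟩ := exists_le_norm_asc hz1
  refine ⟨C + 1, p + q, by positivity, fun k => ?_⟩
  obtain ⟨n, rfl | rfl⟩ := k.eq_nat_or_neg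
  · rw [intFac_natCast, Int.natAbs_natCast, poch_natCast]
    refine (hq n).trans ?_
    have h1 : (1 : ℝ) ≤ (n : ℝ) + 1 := by linarith [n.cast_nonneg (α := ℝ)]
    have h2 : ((n : ℝ) + 1) ^ q ≤ ((n : ℝ) + 1) ^ (p + q) := pow_le_pow_right₀ h1 (by omega)
    gcongr
    linarith
  · rw [intFac_neg_natCast, Int.natAbs_neg, Int.natAbs_natCast, poch_neg_natCast]
    have hpos : 0 < ‖(ascPochhammer ℂ n).eval (1 - z)‖ := norm_pos_iff.2 (asc_ne_zero hz2 n)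
    rw [norm_mul, norm_pow, norm_neg, norm_one, one_pow, one_mul, norm_inv, ← div_eq_mul_inv,
      div_le_div_iff₀ (by positivity) hpos, one_mul]
    have h1 : (1 : ℝ) ≤ (n : ℝ) + 1 := by linarith [n.cast_nonneg (α := ℝ)]
    have h2 : ((n : ℝ) + 1) ^ p ≤ ((n : ℝ) + 1) ^ (p + q) := pow_le_pow_right₀ h1 (by omega)
    have h3 : ((n : ℝ) + 1) ^ (p + q) ≤ (C + 1) * ((n : ℝ) + 1) ^ (p + q) :=
      le_mul_of_one_le_left (by positivity) (by linarith)
    refine (hp n).trans ?_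
    gcongr
    exact h2.trans h3

end HornH5
end

noncomputable section
namespace HornH5
open Filter Metric

/-! ### Estimates up to polynomial factors -/

/-- `f ≤ g` up to a polynomial factor. -/
def PolyLe (f g : ℕ → ℕ → ℝ) : Prop :=
  ∃ (C : ℝ) (p : ℕ), 0 < C ∧ ∀ m n : ℕ, f m n ≤ C * ((m : ℝ) + n + 1) ^ p * g m n

theorem PolyLe.mul {f₁ g₁ f₂ g₂ : ℕ → ℕ → ℝ} (h₁ : PolyLe f₁ g₁) (h₂ : PolyLe f₂ g₂)
    (hf₂ : ∀ m n, 0 ≤ f₂ m n) (hg₁ : ∀ m n, 0 ≤ g₁ m n) :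
    PolyLe (fun m n => f₁ m n * f₂ m n) fun m n => g₁ m n * g₂ m n := by
  obtain ⟨C, p, hC, h⟩ := h₁
  obtain ⟨D, q, hD, k⟩ := h₂
  refine ⟨C * D, p + q, by positivity, fun m n => ?_⟩
  calc f₁ m n * f₂ m n ≤ (C * ((m : ℝ) + n + 1) ^ p * g₁ m n) *
        (D * ((m : ℝ) + n + 1) ^ q * g₂ m n) := by
        refine mul_le_mul (h m n) (k m n) (hf₂ m n) ?_
        have := hg₁ m n
        positivity
    _ = _ := by rw [pow_add]; ring

theorem PolyLe.inv {f g : ℕ → ℕ → ℝ} (h : PolyLe f g) (hf : ∀ m n, 0 < f m n) :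
    PolyLe (fun m n => (g m n)⁻¹) fun m n => (f m n)⁻¹ := by
  obtain ⟨C, p, hC, h⟩ := h
  refine ⟨C, p, hC, fun m n => ?_⟩
  have h1 := (hf m n).trans_le (h m n)
  have h2 : 0 < C * ((m : ℝ) + n + 1) ^ p := by positivity
  have hg : 0 < g m n := pos_of_mul_pos_right h1 h2.le
  rw [inv_le_iff_one_le_mul₀' hg]
  calc (1 : ℝ) = f m n * (f m n)⁻¹ := (mul_inv_cancel₀ (hf m n).ne').symm
    _ ≤ (C * ((m : ℝ) + n + 1) ^ p * g m n) * (f m n)⁻¹ := by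
        have := hf m n
        gcongr
        exact h m n
    _ = _ := by ring

theorem PolyLe.refl (f : ℕ → ℕ → ℝ) : PolyLe f f := ⟨1, 0, one_pos, fun m n => by simp⟩

theorem natAbs_poly_le {k : ℤ} {m n : ℕ} (h : k.natAbs ≤ 3 * (m + n)) (p : ℕ) :
    ((k.natAbs : ℝ) + 1) ^ p ≤ 3 ^ p * ((m : ℝ) + n + 1) ^ p := by
  rw [← mul_pow]
  have : (k.natAbs : ℝ) ≤ 3 * (m + n) := by exact_mod_cast h
  gcongr
  linarith

theorem polyLe_poch {z : ℂ} (hz : ∀ k : ℕ, 1 - z ≠ -k) {k : ℕ → ℕ → ℤ}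
    (hk : ∀ m n, (k m n).natAbs ≤ 3 * (m + n)) :
    PolyLe (fun m n => ‖poch z (k m n)‖) fun m n => intFac (k m n) := by
  obtain ⟨C, p, hC, h⟩ := exists_norm_poch_le hz
  refine ⟨C * 3 ^ p, p, by positivity, fun m n => (h _).trans ?_⟩
  have := natAbs_poly_le (hk m n) p
  have h2 := (intFac_pos (k m n)).le
  calc _ ≤ C * (3 ^ p * ((m : ℝ) + n + 1) ^ p) * intFac (k m n) := by gcongr
    _ = _ := by ring

theorem polyLe_poch_nat (z : ℂ) {k : ℕ → ℕ → ℤ} (h0 : ∀ m n, 0 ≤ k m n)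
    (hk : ∀ m n, (k m n).natAbs ≤ 3 * (m + n)) :
    PolyLe (fun m n => ‖poch z (k m n)‖) fun m n => intFac (k m n) := by
  obtain ⟨p, h⟩ := exists_norm_asc_le z
  refine ⟨3 ^ p, p, by positivity, fun m n => ?_⟩
  obtain ⟨l, hl⟩ := Int.eq_ofNat_of_zero_le (h0 m n)
  have := natAbs_poly_le (hk m n) p
  beta_reduce
  rw [hl] at this ⊢
  rw [intFac_natCast, poch_natCast]
  refine (h l).trans ?_
  rw [Int.natAbs_natCast] at this
  gcongr

theorem polyLe_intFac {z : ℂ} (hz : ∀ k : ℤ, z ≠ k) {k : ℕ → ℕ → ℤ}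
    (hk : ∀ m n, (k m n).natAbs ≤ 3 * (m + n)) :
    PolyLe (fun m n => intFac (k m n)) fun m n => ‖poch z (k m n)‖ := by
  obtain ⟨C, p, hC, h⟩ := exists_le_norm_poch hz
  refine ⟨C * 3 ^ p, p, by positivity, fun m n => (h _).trans ?_⟩
  have := natAbs_poly_le (hk m n) p
  calc _ ≤ C * (3 ^ p * ((m : ℝ) + n + 1) ^ p) * ‖poch z (k m n)‖ := by gcongr
    _ = _ := by ring

theorem polyLe_intFac_nat {z : ℂ} (hz : ∀ k : ℕ, z ≠ -k) {k : ℕ → ℕ → ℤ} (h0 : ∀ m n, 0 ≤ k m n)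
    (hk : ∀ m n, (k m n).natAbs ≤ 3 * (m + n)) :
    PolyLe (fun m n => intFac (k m n)) fun m n => ‖poch z (k m n)‖ := by
  obtain ⟨C, p, hC, h⟩ := exists_le_norm_asc hz
  refine ⟨C * 3 ^ p, p, by positivity, fun m n => ?_⟩
  obtain ⟨l, hl⟩ := Int.eq_ofNat_of_zero_le (h0 m n)
  have := natAbs_poly_le (hk m n) p
  beta_reduce
  rw [hl] at this ⊢
  rw [intFac_natCast, poch_natCast]
  refine (h l).trans ?_
  rw [Int.natAbs_natCast] at this
  calc _ ≤ C * (3 ^ p * ((m : ℝ) + n + 1) ^ p) * ‖(ascPochhammer ℂ l).eval z‖ := by gcongr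
    _ = _ := by ring

/-! ### Coefficients of the three double series -/

/-- Coefficients of Horn's series. -/
def hornCoef (a b c : ℂ) (m n : ℕ) : ℂ :=
  poch a (2 * m + n) * poch b ((n : ℤ) - m) / poch c n / ((m.factorial : ℂ) * (n.factorial : ℂ))

/-- Coefficients of the first series at infinity. -/
def firstCoef (a b c : ℂ) (m n : ℕ) : ℂ :=
  poch a (2 * m + n) * poch (a - c + 1) (2 * m + n) /
    ((m.factorial : ℂ) * (n.factorial : ℂ) * poch (a - b + 1) (3 * m + n))

/-- Coefficients of the second series at infinity. -/
def secondCoef (a b c : ℂ) (m n : ℕ) : ℂ :=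
  poch b ((n : ℤ) - m) * poch (b - c + 1) ((n : ℤ) - m) /
    ((m.factorial : ℂ) * (n.factorial : ℂ) * poch (-a + b + 1) ((n : ℤ) - 3 * m))

theorem hornH5Term_eq (a b c x y : ℂ) (p : ℕ × ℕ) :
    hornH5Term a b c x y p = hornCoef a b c p.1 p.2 * (x ^ p.1 * y ^ p.2) := by
  rw [hornH5Term, hornCoef]; ring

theorem firstTerm_eq (a b c x y : ℂ) (p : ℕ × ℕ) :
    firstTerm a b c x y p = firstCoef a b c p.1 p.2 * ((-(x / y ^ 2)) ^ p.1 * (1 / y) ^ p.2) := by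
  rw [firstTerm, firstCoef, mul_assoc]

theorem secondTerm_eq (a b c x y : ℂ) (p : ℕ × ℕ) :
    secondTerm a b c x y p = secondCoef a b c p.1 p.2 * ((-(x * y)) ^ p.1 * (1 / y) ^ p.2) := by
  rw [secondTerm, secondCoef, mul_assoc]

theorem polyLe_hornCoef {a b c : ℂ} (hb : ∀ k : ℤ, b ≠ (k : ℂ)) (hc : ∀ k : ℕ, c ≠ -(k : ℂ)) :
    PolyLe (fun m n => ‖hornCoef a b c m n‖) fun m n =>
      intFac (2 * m + n) * intFac ((n : ℤ) - m) * (intFac n)⁻¹ *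
        ((m.factorial : ℝ) * n.factorial)⁻¹ := by
  have h1 := polyLe_poch_nat a (k := fun m n => 2 * (m : ℤ) + n) (fun m n => by positivity)
    (fun m n => by omega)
  have h2 := polyLe_poch (z := b) (fun k e => hb (k + 1) (by push_cast; linear_combination -e))
    (k := fun m n => (n : ℤ) - m) (fun m n => by omega)
  have h3 := (polyLe_intFac_nat hc (k := fun _ n => (n : ℤ)) (fun m n => by positivity)
    (fun m n => by omega)).inv fun m n => intFac_pos _
  have := ((h1.mul h2 (fun m n => norm_nonneg _) fun m n => (intFac_pos _).le).mul h3
    (fun m n => by positivity)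
    fun m n => mul_nonneg (intFac_pos _).le (intFac_pos _).le).mul
    (PolyLe.refl fun m n => ((m.factorial : ℝ) * n.factorial)⁻¹) (fun m n => by positivity)
    fun m n => mul_nonneg (mul_nonneg (intFac_pos _).le (intFac_pos _).le)
      (inv_nonneg.2 (intFac_pos _).le)
  obtain ⟨C, p, hC, h⟩ := this
  refine ⟨C, p, hC, fun m n => le_trans (le_of_eq ?_) (h m n)⟩
  simp only [hornCoef, norm_mul, norm_div, Complex.norm_natCast]
  ring

theorem polyLe_firstCoef {a b : ℂ} (c : ℂ) (hab : ∀ k : ℤ, a - b ≠ (k : ℂ)) :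
    PolyLe (fun m n => ‖firstCoef a b c m n‖) fun m n =>
      intFac (2 * m + n) * intFac (2 * m + n) * (intFac (3 * m + n))⁻¹ *
        ((m.factorial : ℝ) * n.factorial)⁻¹ := by
  have h1 := fun z => polyLe_poch_nat z (k := fun m n => 2 * (m : ℤ) + n) (fun m n => by positivity)
    (fun m n => by omega)
  have h3 := (polyLe_intFac (z := a - b + 1) (fun k e => hab (k - 1) (by
    push_cast; linear_combination e)) (k := fun m n => 3 * (m : ℤ) + n)
    (fun m n => by omega)).inv fun m n => intFac_pos _
  obtain ⟨C, p, hC, h⟩ := (((h1 a).mul (h1 (a - c + 1)) (fun m n => norm_nonneg _)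
    fun m n => (intFac_pos _).le).mul h3 (fun m n => by positivity)
    fun m n => mul_nonneg (intFac_pos _).le (intFac_pos _).le).mul
    (PolyLe.refl fun m n => ((m.factorial : ℝ) * n.factorial)⁻¹) (fun m n => by positivity)
    fun m n => mul_nonneg (mul_nonneg (intFac_pos _).le (intFac_pos _).le)
      (inv_nonneg.2 (intFac_pos _).le)
  refine ⟨C, p, hC, fun m n => le_trans (le_of_eq ?_) (h m n)⟩
  simp only [firstCoef, norm_mul, norm_div, Complex.norm_natCast]
  ring

theorem polyLe_secondCoef {a b c : ℂ} (hb : ∀ k : ℤ, b ≠ (k : ℂ))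
    (hab : ∀ k : ℤ, a - b ≠ (k : ℂ)) (hcb : ∀ k : ℕ, c - b ≠ -(k : ℂ)) :
    PolyLe (fun m n => ‖secondCoef a b c m n‖) fun m n =>
      intFac ((n : ℤ) - m) * intFac ((n : ℤ) - m) * (intFac ((n : ℤ) - 3 * m))⁻¹ *
        ((m.factorial : ℝ) * n.factorial)⁻¹ := by
  have h1 := polyLe_poch (z := b) (fun k e => hb (k + 1) (by push_cast; linear_combination -e))
    (k := fun m n => (n : ℤ) - m) (fun m n => by omega)
  have h2 := polyLe_poch (z := b - c + 1) (fun k e => hcb k (by linear_combination e))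
    (k := fun m n => (n : ℤ) - m) (fun m n => by omega)
  have h3 := (polyLe_intFac (z := -a + b + 1) (fun k e => hab (1 - k) (by
    push_cast; linear_combination -e)) (k := fun m n => (n : ℤ) - 3 * m)
    (fun m n => by omega)).inv fun m n => intFac_pos _
  obtain ⟨C, p, hC, h⟩ := ((h1.mul h2 (fun m n => norm_nonneg _)
    fun m n => (intFac_pos _).le).mul h3 (fun m n => by positivity)
    fun m n => mul_nonneg (intFac_pos _).le (intFac_pos _).le).mul
    (PolyLe.refl fun m n => ((m.factorial : ℝ) * n.factorial)⁻¹) (fun m n => by positivity)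
    fun m n => mul_nonneg (mul_nonneg (intFac_pos _).le (intFac_pos _).le)
      (inv_nonneg.2 (intFac_pos _).le)
  refine ⟨C, p, hC, fun m n => le_trans (le_of_eq ?_) (h m n)⟩
  simp only [secondCoef, norm_mul, norm_div, Complex.norm_natCast]
  ring

/-! ### Factorial inequalities behind the regions of convergence -/

/-- These radii are deliberately crude: only convergence somewhere near the origin is needed from
them. -/
theorem hornFac_le (m n : ℕ) : intFac (2 * m + n) * intFac ((n : ℤ) - m) * (intFac n)⁻¹ *
    ((m.factorial : ℝ) * n.factorial)⁻¹ * ((1 / 32) ^ m * (1 / 2) ^ n) ≤ 1 := by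
  have h1 := factorial_add_mul_pow_le (2 * m) n (p := 1) (q := 1) zero_le_one zero_le_one
  have h2 := factorial_add_mul_pow_le m m (p := 1) (q := 1) zero_le_one zero_le_one
  simp only [one_pow, mul_one] at h1 h2
  rw [← two_mul] at h2
  have e1 : intFac (2 * (m : ℤ) + n) = (2 * m + n).factorial := intFac_of_eq (by push_cast; rfl)
  have h3 : (m.factorial : ℝ) * intFac ((n : ℤ) - m) ≤ 2 ^ m * n.factorial := by
    rcases le_total m n with h | h
    · obtain ⟨j, rfl⟩ := Nat.exists_eq_add_of_le h
      rw [intFac_of_eq (n := j) (by push_cast; ring)]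
      have h4 : (m.factorial : ℝ) * j.factorial ≤ (m + j).factorial := by
        exact_mod_cast Nat.le_of_dvd (m + j).factorial_pos
          (Nat.factorial_mul_factorial_dvd_factorial_add m j)
      refine h4.trans (le_mul_of_one_le_left (by positivity) (one_le_pow₀ (by norm_num)))
    · obtain ⟨j, rfl⟩ := Nat.exists_eq_add_of_le h
      rw [intFac_of_eq_neg (n := j) (by push_cast; ring), mul_one_div, div_le_iff₀ (by positivity)]
      have h4 := factorial_add_mul_pow_le n j (p := 1) (q := 1) zero_le_one zero_le_one
      simp only [one_pow, mul_one] at h4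
      norm_num at h4 ⊢
      linarith
  rw [e1, intFac_natCast]
  have hm : (0 : ℝ) < m.factorial := by positivity
  have hn : (0 : ℝ) < n.factorial := by positivity
  have hi := intFac_pos ((n : ℤ) - m)
  norm_num at h1 h2
  have h5 : ((2 * m + n).factorial : ℝ) * intFac ((n : ℤ) - m) ≤
      ((m.factorial : ℝ) * n.factorial * n.factorial) * ((32 : ℝ) ^ m * 2 ^ n) := by
    calc ((2 * m + n).factorial : ℝ) * intFac ((n : ℤ) - m)
        ≤ ((2 * m).factorial * n.factorial * 2 ^ (2 * m + n)) * intFac ((n : ℤ) - m) := by gcongr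
      _ ≤ ((m.factorial * m.factorial * 2 ^ (2 * m)) * n.factorial * 2 ^ (2 * m + n)) *
          intFac ((n : ℤ) - m) := by gcongr
      _ = (m.factorial * n.factorial * (2 ^ (2 * m) * 2 ^ (2 * m + n))) *
          (m.factorial * intFac ((n : ℤ) - m)) := by ring
      _ ≤ (m.factorial * n.factorial * (2 ^ (2 * m) * 2 ^ (2 * m + n))) *
          (2 ^ m * n.factorial) := by gcongr
      _ = _ := by
        rw [show (32 : ℝ) = 2 ^ 5 by norm_num, ← pow_mul]
        ring
  have e2 : ((1 : ℝ) / 32) ^ m * (1 / 2) ^ n = ((32 : ℝ) ^ m * 2 ^ n)⁻¹ := by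
    rw [div_pow, div_pow, one_pow, one_pow, mul_inv, one_div, one_div]
  rw [e2]
  calc _ = (((2 * m + n).factorial : ℝ) * intFac ((n : ℤ) - m)) *
        (((m.factorial : ℝ) * n.factorial * n.factorial) * ((32 : ℝ) ^ m * 2 ^ n))⁻¹ := by
        rw [mul_inv, mul_inv, mul_inv, mul_inv]; ring
    _ ≤ (((m.factorial : ℝ) * n.factorial * n.factorial) * ((32 : ℝ) ^ m * 2 ^ n)) *
        (((m.factorial : ℝ) * n.factorial * n.factorial) * ((32 : ℝ) ^ m * 2 ^ n))⁻¹ := by gcongr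
    _ = 1 := mul_inv_cancel₀ (by positivity)

/-- The entropy bound with `N = 2m + n` and indices `m, n, 3m + n`, which sum to `2N`. The
one-parameter weights `μ, 1 - 2μ, 1 + μ` sum to `2` and yield the radii `μ (1 + μ)³` and `(1 - 2μ)(1
+ μ)`. -/
theorem firstFac_le {μ : ℝ} (h0 : 0 ≤ μ) (h1 : μ ≤ 1 / 2) (m n : ℕ) :
    intFac (2 * m + n) * intFac (2 * m + n) * (intFac (3 * m + n))⁻¹ *
      ((m.factorial : ℝ) * n.factorial)⁻¹ *
        ((μ * (1 + μ) ^ 3) ^ m * ((1 - 2 * μ) * (1 + μ)) ^ n) ≤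
      Real.exp 1 ^ 2 * ((2 * m + n : ℕ) + 1 : ℝ) ^ 2 := by
  have h := factorial_sq_mul_pow_le (m := m) (n := n) (l := 3 * m + n) (N := 2 * m + n) (by ring)
    (p := μ) (q := 1 - 2 * μ) (r := 1 + μ) h0 (by linarith) (by linarith) (by ring)
  rw [intFac_of_eq (k := 2 * (m : ℤ) + n) (n := 2 * m + n) (by push_cast; rfl),
    intFac_of_eq (k := 3 * (m : ℤ) + n) (n := 3 * m + n) (by push_cast; rfl)]
  have e : (μ * (1 + μ) ^ 3) ^ m * ((1 - 2 * μ) * (1 + μ)) ^ n =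
      μ ^ m * (1 - 2 * μ) ^ n * (1 + μ) ^ (3 * m + n) := by
    rw [mul_pow, mul_pow, pow_add, pow_mul]
    ring
  rw [e]
  have hpos : (0 : ℝ) < m.factorial * n.factorial * (3 * m + n).factorial := by positivity
  refine le_of_mul_le_mul_right ?_ hpos
  refine le_trans (le_of_eq ?_) h
  field_simp

/-- In the cone `3m ≤ n` all shifted indices are non-negative. The entropy bound applies with `N = n
- m`, indices `m, n, n - 3m` and weights `μ, 1 + μ, 1 - 2μ`. -/
theorem secondFac_le_upper {μ : ℝ} (h0 : 0 ≤ μ) (h1 : μ ≤ 1 / 2) {X Y : ℝ} (hX : 0 ≤ X)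
    (hY : 0 ≤ Y) (hXμ : X * (1 - 2 * μ) ^ 3 ≤ μ) (hYμ : Y ≤ (1 + μ) * (1 - 2 * μ)) {m n : ℕ}
    (hmn : 3 * m ≤ n) :
    intFac ((n : ℤ) - m) * intFac ((n : ℤ) - m) * (intFac ((n : ℤ) - 3 * m))⁻¹ *
        ((m.factorial : ℝ) * n.factorial)⁻¹ * (X ^ m * Y ^ n) ≤
      Real.exp 1 ^ 2 * ((m + n : ℕ) + 1 : ℝ) ^ 2 := by
  obtain ⟨l, rfl⟩ := Nat.exists_eq_add_of_le hmn
  have h := factorial_sq_mul_pow_le (m := m) (n := 3 * m + l) (l := l) (N := 2 * m + l) (by ring)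
    (p := μ) (q := 1 + μ) (r := 1 - 2 * μ) h0 (by linarith) (by linarith) (by ring)
  rw [intFac_of_eq (n := 2 * m + l) (by push_cast; ring),
    intFac_of_eq (n := l) (by push_cast; ring)]
  have h12 : 0 ≤ 1 - 2 * μ := by linarith
  have e : X ^ m * Y ^ (3 * m + l) ≤ μ ^ m * (1 + μ) ^ (3 * m + l) * (1 - 2 * μ) ^ l := by
    calc X ^ m * Y ^ (3 * m + l) ≤ X ^ m * ((1 + μ) * (1 - 2 * μ)) ^ (3 * m + l) := by gcongr
      _ = (X * (1 - 2 * μ) ^ 3) ^ m * (1 + μ) ^ (3 * m + l) * (1 - 2 * μ) ^ l := by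
        rw [mul_pow, mul_pow, pow_add (1 - 2 * μ), pow_mul (1 - 2 * μ)]
        ring
      _ ≤ _ := by gcongr
  have hpos : (0 : ℝ) < m.factorial * (3 * m + l).factorial * l.factorial := by positivity
  refine le_of_mul_le_mul_right ?_ hpos
  calc _ = ((2 * m + l).factorial : ℝ) ^ 2 * (X ^ m * Y ^ (3 * m + l)) := by field_simp
    _ ≤ ((2 * m + l).factorial : ℝ) ^ 2 *
        (μ ^ m * (1 + μ) ^ (3 * m + l) * (1 - 2 * μ) ^ l) := by gcongr
    _ ≤ _ := h
    _ ≤ _ := by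
      have : ((2 * m + l : ℕ) : ℝ) ≤ (m + (3 * m + l) : ℕ) := by exact_mod_cast (by omega)
      gcongr

/-- In the cone `n ≤ m` the coefficient is the multinomial `(3m - n)! / (m! n! (m - n)!²)`. It is
bounded by the multinomial theorem with weights `1 + ν, ν, 1, 1` of sum `3 + 2ν`. -/
theorem secondFac_le_lower {ν : ℝ} (h0 : 0 < ν) {X Y : ℝ} (hX : 0 ≤ X)
    (hY : 0 ≤ Y) (hXν : X * (3 + 2 * ν) ^ 3 ≤ 1 + ν) (hYν : Y ≤ ν * (3 + 2 * ν)) {m n : ℕ}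
    (hmn : n ≤ m) :
    intFac ((n : ℤ) - m) * intFac ((n : ℤ) - m) * (intFac ((n : ℤ) - 3 * m))⁻¹ *
        ((m.factorial : ℝ) * n.factorial)⁻¹ * (X ^ m * Y ^ n) ≤ 1 := by
  obtain ⟨j, rfl⟩ := Nat.exists_eq_add_of_le hmn
  rw [intFac_of_eq_neg (n := j) (by push_cast; ring),
    intFac_of_eq_neg (n := (n + j) + n + (j + j)) (by push_cast; ring)]
  have hD : (0 : ℝ) < 3 + 2 * ν := by linarith
  have h1 := factorial_add_mul_pow_le (n + j + n) (j + j)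
    (p := 1 + 2 * ν) (q := 2) (by linarith) (by linarith)
  have h2 := factorial_add_mul_pow_le (n + j) n (p := 1 + ν) (q := ν) (by linarith) h0.le
  have h3 := factorial_add_mul_pow_le j j (p := 1) (q := 1) zero_le_one zero_le_one
  simp only [one_pow, mul_one] at h3
  rw [show (1 : ℝ) + 1 = 2 by norm_num] at h3
  rw [show 1 + ν + ν = 1 + 2 * ν by ring] at h2
  rw [show 1 + 2 * ν + 2 = 3 + 2 * ν by ring] at h1
  have e : X ^ (n + j) * Y ^ n * (3 + 2 * ν) ^ (n + j + n + (j + j)) ≤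
      (1 + ν) ^ (n + j) * ν ^ n := by
    calc X ^ (n + j) * Y ^ n * (3 + 2 * ν) ^ (n + j + n + (j + j))
        ≤ X ^ (n + j) * (ν * (3 + 2 * ν)) ^ n * (3 + 2 * ν) ^ (n + j + n + (j + j)) := by gcongr
      _ = (X * (3 + 2 * ν) ^ 3) ^ (n + j) * ν ^ n := by
        generalize 3 + 2 * ν = D
        simp only [mul_pow, ← pow_mul]
        ring
      _ ≤ _ := by gcongr
  have h4 : ((n + j + n + (j + j)).factorial : ℝ) * ((1 + ν) ^ (n + j) * ν ^ n) ≤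
      (n + j).factorial * n.factorial * (j.factorial * j.factorial) *
        (3 + 2 * ν) ^ (n + j + n + (j + j)) := by
    have p1 : (0 : ℝ) < (1 + 2 * ν) ^ (n + j + n) * 2 ^ (j + j) := by positivity
    refine le_of_mul_le_mul_right ?_ p1
    have p2 : (0 : ℝ) < (n + j + n).factorial := by positivity
    refine le_of_mul_le_mul_right ?_ p2
    calc _ = (((n + j + n + (j + j)).factorial : ℝ) *
          ((1 + 2 * ν) ^ (n + j + n) * 2 ^ (j + j))) *
            (((n + j + n).factorial : ℝ) * ((1 + ν) ^ (n + j) * ν ^ n)) := by ring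
      _ ≤ (((n + j + n).factorial : ℝ) * (j + j).factorial *
          (3 + 2 * ν) ^ (n + j + n + (j + j))) *
          ((n + j).factorial * n.factorial * (1 + 2 * ν) ^ (n + j + n)) := by gcongr
      _ ≤ (((n + j + n).factorial : ℝ) * (j.factorial * j.factorial * 2 ^ (j + j)) *
          (3 + 2 * ν) ^ (n + j + n + (j + j))) *
          ((n + j).factorial * n.factorial * (1 + 2 * ν) ^ (n + j + n)) := by gcongr
      _ = _ := by ring
  have hDp : (0 : ℝ) < (3 + 2 * ν) ^ (n + j + n + (j + j)) := by positivity
  have h5 : ((n + j + n + (j + j)).factorial : ℝ) * (X ^ (n + j) * Y ^ n) ≤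
      (n + j).factorial * n.factorial * (j.factorial * j.factorial) := by
    refine le_of_mul_le_mul_right ?_ hDp
    calc _ = ((n + j + n + (j + j)).factorial : ℝ) *
          (X ^ (n + j) * Y ^ n * (3 + 2 * ν) ^ (n + j + n + (j + j))) := by ring
      _ ≤ ((n + j + n + (j + j)).factorial : ℝ) * ((1 + ν) ^ (n + j) * ν ^ n) := by gcongr
      _ ≤ _ := h4
  have hpos : (0 : ℝ) < (n + j).factorial * n.factorial * (j.factorial * j.factorial) := by
    positivity
  refine le_of_mul_le_mul_right ?_ hpos
  rw [one_mul]
  refine le_trans (le_of_eq ?_) h5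
  field_simp

/-- For fixed `m` and `n = m + k` the terms `(k!)² (2m - k)! / (m! (m + k)!) Xᵐ Y^(m + k)` are
log-convex in `k`, so the two edges `n = m` and `n = 3m` of the cone control them. The two
hypotheses are the bounds on these edges. -/
theorem secondFac_le_middle {X Y : ℝ} (hX : 0 < X) (hY : 0 < Y) (h1 : 4 * (X * Y) ≤ 1)
    (h2 : 16 * (X * Y ^ 3) ≤ 27) {m n : ℕ} (hmn : m ≤ n) (hnm : n ≤ 3 * m) :
    intFac ((n : ℤ) - m) * intFac ((n : ℤ) - m) * (intFac ((n : ℤ) - 3 * m))⁻¹ *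
        ((m.factorial : ℝ) * n.factorial)⁻¹ * (X ^ m * Y ^ n) ≤
      Real.exp 1 ^ 2 * ((2 * m : ℕ) + 1 : ℝ) ^ 2 := by
  obtain ⟨k, rfl⟩ := Nat.exists_eq_add_of_le hmn
  rw [intFac_of_eq (n := k) (by push_cast; ring),
    intFac_of_eq_neg (n := 2 * m - k) (by omega)]
  set s : ℕ → ℝ := fun k => (k.factorial : ℝ) ^ 2 * (2 * m - k).factorial /
    (m.factorial * (m + k).factorial) * (X ^ m * Y ^ (m + k)) with hs
  have hk : k ≤ 2 * m := by omega
  have hmax := le_max_of_logConvex (s := s) (2 * m) (fun k _ => by simp only [hs]; positivity) (by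
    intro k hk
    obtain ⟨i, hi⟩ := Nat.exists_eq_add_of_le hk
    have a0 : 2 * m - k = i + 2 := by omega
    have a1 : 2 * m - (k + 1) = i + 1 := by omega
    have a2 : 2 * m - (k + 2) = i := by omega
    simp only [hs, a0, a1, a2, ← Nat.add_assoc, Nat.factorial_succ, pow_succ, pow_zero, one_mul]
    push_cast
    have hm : (0 : ℝ) < m.factorial := by positivity
    have hkf : (0 : ℝ) < k.factorial := by positivity
    have hif : (0 : ℝ) < i.factorial := by positivity
    have hmk : (0 : ℝ) < (m + k).factorial := by positivity
    have hX' : 0 < X ^ m := by positivity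
    have hY' : 0 < Y ^ (m + k) := by positivity
    generalize (m.factorial : ℝ) = A at *
    generalize (k.factorial : ℝ) = B at *
    generalize (i.factorial : ℝ) = D at *
    generalize ((m + k).factorial : ℝ) = E at *
    generalize X ^ m = P at *
    generalize Y ^ (m + k) = Q at *
    have hkk : (0 : ℝ) ≤ k := by positivity
    have hmm : (0 : ℝ) ≤ m := by positivity
    have hii : (0 : ℝ) ≤ i := by positivity
    have key : ((k : ℝ) + 1) ^ 2 * (i + 1) * (m + k + 2) ≤
        ((k : ℝ) + 2) ^ 2 * (i + 2) * (m + k + 1) := by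
      have : ((k : ℝ) + 1) ^ 2 * (m + k + 2) ≤ ((k : ℝ) + 2) ^ 2 * (m + k + 1) := by nlinarith
      calc ((k : ℝ) + 1) ^ 2 * (i + 1) * (m + k + 2)
          = (((k : ℝ) + 1) ^ 2 * (m + k + 2)) * (i + 1) := by ring
        _ ≤ (((k : ℝ) + 2) ^ 2 * (m + k + 1)) * (i + 2) := by gcongr; norm_num
        _ = _ := by ring
    rw [← sub_nonneg]
    have : 0 ≤ (((k : ℝ) + 2) ^ 2 * (i + 2) * (m + k + 1) - ((k : ℝ) + 1) ^ 2 * (i + 1) * (m + k + 2)) *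
        (B ^ 4 * ((k : ℝ) + 1) ^ 2 * D ^ 2 * (i + 1) * P ^ 2 * Q ^ 2 * Y ^ 2 /
          (A ^ 2 * E ^ 2 * ((m : ℝ) + k + 1) ^ 2 * (m + k + 2))) := by
      apply mul_nonneg (sub_nonneg.2 key)
      positivity
    refine this.trans (le_of_eq ?_)
    field_simp
    ring) k hk
  -- The edge `n = m`, where the factorials form a central binomial coefficient, at most `4ᵐ`.
  have e0 : s 0 ≤ 1 := by
    have h3 := factorial_add_mul_pow_le m m (p := 1) (q := 1) zero_le_one zero_le_one
    simp only [one_pow, mul_one] at h3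
    rw [← two_mul] at h3
    simp only [hs, Nat.factorial_zero, Nat.cast_one, one_pow, one_mul, Nat.sub_zero, add_zero]
    rw [div_mul_eq_mul_div, div_le_one (by positivity)]
    calc ((2 * m).factorial : ℝ) * (X ^ m * Y ^ m)
        ≤ (m.factorial * m.factorial * (1 + 1) ^ (2 * m)) * (X ^ m * Y ^ m) := by gcongr
      _ = (m.factorial * m.factorial) * (4 * (X * Y)) ^ m := by
        rw [pow_mul, mul_pow, mul_pow]; norm_num; ring
      _ ≤ (m.factorial * m.factorial) * 1 := by
        gcongr
        exact pow_le_one₀ (by positivity) h1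
      _ = _ := mul_one _
  -- The edge `n = 3m`: the weights `1/2, 0, 3/2` give `(1/2)(3/2)³ = 27/16`.
  have e1 : s (2 * m) ≤ Real.exp 1 ^ 2 * ((2 * m : ℕ) + 1 : ℝ) ^ 2 := by
    have h3 := factorial_sq_mul_pow_le (m := m) (n := 0) (l := 3 * m) (N := 2 * m) (by ring)
      (p := 1 / 2) (q := 0) (r := 3 / 2) (by norm_num) le_rfl (by norm_num) (by norm_num)
    simp only [pow_zero, mul_one, Nat.factorial_zero, Nat.cast_one] at h3
    simp only [hs, Nat.sub_self, Nat.factorial_zero, Nat.cast_one, mul_one]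
    rw [show m + 2 * m = 3 * m by ring, div_mul_eq_mul_div, div_le_iff₀ (by positivity)]
    refine le_trans ?_ h3
    have : X ^ m * Y ^ (3 * m) ≤ (1 / 2) ^ m * (3 / 2) ^ (3 * m) := by
      rw [pow_mul, pow_mul, ← mul_pow, ← mul_pow]
      exact pow_le_pow_left₀ (by positivity) (by linarith) m
    gcongr
  have e2 : (1 : ℝ) ≤ Real.exp 1 ^ 2 * ((2 * m : ℕ) + 1 : ℝ) ^ 2 := by
    have : (1 : ℝ) ≤ Real.exp 1 := Real.one_le_exp zero_le_one
    have h4 : (1 : ℝ) ≤ (2 * m : ℕ) + 1 := by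
      linarith [(2 * m).cast_nonneg (α := ℝ)]
    exact one_le_mul_of_one_le_of_one_le (one_le_pow₀ this) (one_le_pow₀ h4)
  refine le_trans (le_of_eq ?_) (hmax.trans (max_le (e0.trans e2) e1))
  simp only [hs]
  field_simp

end HornH5
end

noncomputable section
namespace HornH5
open Filter Metric

/-! ### Dominated double series -/

/-- The coefficients `t` define a double power series that converges on a polydisc strictly larger
than the one with radii `X` and `Y`. -/
def Dominated (t : ℕ → ℕ → ℂ) (X Y : ℝ) : Prop :=
  ∃ X' Y' C : ℝ, X < X' ∧ Y < Y' ∧ ∀ m n : ℕ, ‖t m n‖ * (X' ^ m * Y' ^ n) ≤ C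

theorem Dominated.exists_gt {t : ℕ → ℕ → ℂ} {X Y : ℝ} (h : Dominated t X Y) :
    ∃ X' Y' : ℝ, X < X' ∧ Y < Y' ∧ Dominated t X' Y' := by
  obtain ⟨X', Y', C, h1, h2, h⟩ := h
  obtain ⟨X'', h3, h4⟩ := exists_between h1
  obtain ⟨Y'', h5, h6⟩ := exists_between h2
  exact ⟨X'', Y'', h3, h5, X', Y', C, h4, h6, h⟩

theorem tsum_scale (t : ℕ → ℕ → ℂ) {X Y : ℝ} (hX : 0 < X) (hY : 0 < Y) (u v : ℂ) (p : ℕ × ℕ) :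
    t p.1 p.2 * (u ^ p.1 * v ^ p.2) =
      (t p.1 p.2 * ((X : ℂ) ^ p.1 * (Y : ℂ) ^ p.2)) * ((u / X) ^ p.1 * (v / Y) ^ p.2) := by
  have hX' : (X : ℂ) ≠ 0 := by exact_mod_cast hX.ne'
  have hY' : (Y : ℂ) ≠ 0 := by exact_mod_cast hY.ne'
  rw [div_pow, div_pow]
  field_simp

theorem norm_scale_le {t : ℕ → ℕ → ℂ} {X Y C : ℝ} (hX : 0 < X) (hY : 0 < Y)
    (h : ∀ m n : ℕ, ‖t m n‖ * (X ^ m * Y ^ n) ≤ C) (m n : ℕ) :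
    ‖t m n * ((X : ℂ) ^ m * (Y : ℂ) ^ n)‖ ≤ C := by
  rw [norm_mul, norm_mul, norm_pow, norm_pow, Complex.norm_of_nonneg hX.le,
    Complex.norm_of_nonneg hY.le]
  exact h m n

theorem norm_div_ofReal_lt_one {u : ℂ} {X : ℝ} (h : ‖u‖ < X) : ‖u / X‖ < 1 := by
  have hX : 0 < X := (norm_nonneg u).trans_lt h
  rw [norm_div, Complex.norm_of_nonneg hX.le, div_lt_one hX]
  exact h

theorem Dominated.summable {t : ℕ → ℕ → ℂ} {X Y : ℝ} (h : Dominated t X Y) {u v : ℂ}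
    (hu : ‖u‖ ≤ X) (hv : ‖v‖ ≤ Y) :
    Summable fun p : ℕ × ℕ => t p.1 p.2 * (u ^ p.1 * v ^ p.2) := by
  obtain ⟨X', Y', C, h1, h2, h⟩ := h
  have hX := (norm_nonneg u).trans_lt (hu.trans_lt h1)
  have hY := (norm_nonneg v).trans_lt (hv.trans_lt h2)
  exact (summable_double (norm_scale_le hX hY h) (norm_div_ofReal_lt_one (hu.trans_lt h1))
    (norm_div_ofReal_lt_one (hv.trans_lt h2))).congr fun p => (tsum_scale t hX hY u v p).symm

theorem Dominated.continuousAt {t : ℕ → ℕ → ℂ} {u v : ℂ} (h : Dominated t ‖u‖ ‖v‖) :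
    ContinuousAt (fun q : ℂ × ℂ => ∑' p : ℕ × ℕ, t p.1 p.2 * (q.1 ^ p.1 * q.2 ^ p.2)) (u, v) := by
  obtain ⟨X, Y, C, h1, h2, h⟩ := h
  have hX := (norm_nonneg u).trans_lt h1
  have hY := (norm_nonneg v).trans_lt h2
  rw [show (fun q : ℂ × ℂ => ∑' p : ℕ × ℕ, t p.1 p.2 * (q.1 ^ p.1 * q.2 ^ p.2)) = _ from
    funext fun q => tsum_congr fun p => tsum_scale t hX hY q.1 q.2 p]
  have hmem : (u / X, v / Y) ∈ ball (0 : ℂ × ℂ) 1 := by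
    rw [mem_ball_zero_iff, Prod.norm_def]
    exact max_lt (norm_div_ofReal_lt_one h1) (norm_div_ofReal_lt_one h2)
  have h3 := ((analyticOnNhd_double (norm_scale_le hX hY h)) _ hmem).continuousAt
  exact h3.comp_of_eq (f := fun q : ℂ × ℂ => (q.1 / (X : ℂ), q.2 / (Y : ℂ))) (x := (u, v))
    (by fun_prop) rfl

/-- The rows of a dominated series are bounded. -/
theorem Dominated.exists_row_bound {t : ℕ → ℕ → ℂ} {X Y : ℝ} (h : Dominated t X Y) (hX : 0 ≤ X)
    (hY : 0 ≤ Y) :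
    ∃ C : ℝ, 0 ≤ C ∧ ∀ v : ℂ, ‖v‖ ≤ Y → ∀ m, ‖psum (t m) v‖ * X ^ m ≤ C := by
  obtain ⟨X', Y', C, h1, h2, h⟩ := h
  have hX' := hX.trans_lt h1
  have hY' := hY.trans_lt h2
  have hC : 0 ≤ C := by
    have := h 0 0
    simp only [pow_zero, mul_one] at this
    exact (norm_nonneg _).trans this
  have h3 : 0 < 1 - Y / Y' := by rw [sub_pos, div_lt_one hY']; exact h2
  refine ⟨C * (1 - Y / Y')⁻¹, by positivity, fun v hv m => ?_⟩
  have hm : (0 : ℝ) < X' ^ m := by positivity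
  have h4 : ‖psum (t m) v‖ ≤ C / X' ^ m * (1 - ‖v‖ / Y')⁻¹ := by
    refine norm_psum_le (hv.trans_lt h2) fun n => ?_
    rw [le_div_iff₀ hm]
    exact (le_of_eq (by ring)).trans (h m n)
  have h5 : (1 - ‖v‖ / Y')⁻¹ ≤ (1 - Y / Y')⁻¹ := by gcongr
  calc ‖psum (t m) v‖ * X ^ m ≤ (C / X' ^ m * (1 - Y / Y')⁻¹) * X' ^ m := by
        gcongr
        exact h4.trans (by gcongr)
    _ = _ := by field_simp

/-- A dominated double series is the sum of its rows. -/
theorem Dominated.tsum_eq {t : ℕ → ℕ → ℂ} {X Y : ℝ} (h : Dominated t X Y) {u v : ℂ}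
    (hu : ‖u‖ ≤ X) (hv : ‖v‖ ≤ Y) :
    ∑' p : ℕ × ℕ, t p.1 p.2 * (u ^ p.1 * v ^ p.2) = ∑' m, u ^ m * psum (t m) v := by
  rw [(h.summable hu hv).tsum_prod]
  refine tsum_congr fun m => ?_
  rw [psum, ← tsum_mul_left]
  exact tsum_congr fun n => by ring

theorem Dominated.summable_rows {t : ℕ → ℕ → ℂ} {X Y : ℝ} (h : Dominated t X Y) {u v : ℂ}
    (hu : ‖u‖ ≤ X) (hv : ‖v‖ ≤ Y) : Summable fun m => u ^ m * psum (t m) v := by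
  refine (h.summable hu hv).prod.congr fun m => ?_
  rw [psum, ← tsum_mul_left]
  exact tsum_congr fun n => by ring

/-- The strict gaps to `X₀` and `Y₀` leave a factor `q^(m + n)` with `q < 1`, which absorbs both
polynomial factors. -/
theorem dominated_of_polyLe {t : ℕ → ℕ → ℂ} {g : ℕ → ℕ → ℝ}
    (h : PolyLe (fun m n => ‖t m n‖) g) {X₀ Y₀ : ℝ}
    (hg : PolyLe (fun m n => g m n * (X₀ ^ m * Y₀ ^ n)) fun _ _ => 1) {X Y : ℝ} (hX : 0 ≤ X)
    (hY : 0 ≤ Y) (hX₀ : X < X₀) (hY₀ : Y < Y₀) : Dominated t X Y := by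
  obtain ⟨X', h1, h2⟩ := exists_between hX₀
  obtain ⟨Y', h3, h4⟩ := exists_between hY₀
  have hX' := hX.trans_lt h1
  have hY' := hY.trans_lt h3
  have hX0 := hX'.trans h2
  have hY0 := hY'.trans h4
  obtain ⟨q, hq, hq1⟩ : ∃ q, max (X' / X₀) (Y' / Y₀) < q ∧ q < 1 :=
    exists_between (max_lt ((div_lt_one hX0).2 h2) ((div_lt_one hY0).2 h4))
  have hqX : X' ≤ q * X₀ := (div_le_iff₀ hX0).1 ((le_max_left _ _).trans hq.le)
  have hqY : Y' ≤ q * Y₀ := (div_le_iff₀ hY0).1 ((le_max_right _ _).trans hq.le)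
  have hq0 : 0 < q := lt_of_le_of_lt (le_max_of_le_left (by positivity)) hq
  obtain ⟨C, p, hC, h⟩ := h
  obtain ⟨D, p', hD, hg⟩ := hg
  obtain ⟨B, -, hB⟩ := exists_bound_pow_mul_geometric (p + p') hq0.le hq1
  refine ⟨X', Y', C * D * B, h1, h3, fun m n => ?_⟩
  calc ‖t m n‖ * (X' ^ m * Y' ^ n) ≤ ‖t m n‖ * ((q * X₀) ^ m * (q * Y₀) ^ n) := by gcongr
    _ = ‖t m n‖ * (X₀ ^ m * Y₀ ^ n * q ^ (m + n)) := by rw [mul_pow, mul_pow, pow_add]; ring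
    _ ≤ (C * ((m : ℝ) + n + 1) ^ p * g m n) * (X₀ ^ m * Y₀ ^ n * q ^ (m + n)) := by
        gcongr
        exact h m n
    _ = C * ((m : ℝ) + n + 1) ^ p * q ^ (m + n) * (g m n * (X₀ ^ m * Y₀ ^ n)) := by ring
    _ ≤ C * ((m : ℝ) + n + 1) ^ p * q ^ (m + n) * (D * ((m : ℝ) + n + 1) ^ p' * 1) := by
        exact mul_le_mul_of_nonneg_left (hg m n) (by positivity)
    _ = C * D * ((((m + n : ℕ) : ℝ) + 1) ^ (p + p') * q ^ (m + n)) := by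
        rw [pow_add]; push_cast; ring
    _ ≤ C * D * B := by gcongr; exact hB _

/-! ### The regions of convergence -/

theorem sq_rpow_three_halves {s : ℝ} (hs : 0 ≤ s) : (s ^ 2) ^ (3 / 2 : ℝ) = s ^ 3 := by
  rw [← Real.rpow_natCast s 2, ← Real.rpow_mul hs, ← Real.rpow_natCast s 3]
  norm_num

theorem dominated_firstCoef {a b : ℂ} (c : ℂ) (hab : ∀ k : ℤ, a - b ≠ (k : ℂ)) {μ X Y : ℝ}
    (h0 : 0 ≤ μ) (h1 : μ ≤ 1 / 2) (hX : 0 ≤ X) (hY : 0 ≤ Y) (hXμ : X < μ * (1 + μ) ^ 3)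
    (hYμ : Y < (1 - 2 * μ) * (1 + μ)) : Dominated (firstCoef a b c) X Y := by
  refine dominated_of_polyLe (polyLe_firstCoef c hab) ?_ hX hY hXμ hYμ
  refine ⟨Real.exp 1 ^ 2 * 4, 2, by positivity, fun m n => (firstFac_le h0 h1 m n).trans ?_⟩
  rw [mul_one, mul_assoc]
  gcongr
  have : (0 : ℝ) ≤ n := n.cast_nonneg
  have : (0 : ℝ) ≤ m := m.cast_nonneg
  push_cast
  nlinarith

/-- The index quadrant splits along `n = m` and `n = 3m` into three cones: `μ` serves the upper one,
`ν` the lower one, and together they control the middle one. -/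
theorem dominated_secondCoef {a b c : ℂ} (hb : ∀ k : ℤ, b ≠ (k : ℂ))
    (hab : ∀ k : ℤ, a - b ≠ (k : ℂ)) (hcb : ∀ k : ℕ, c - b ≠ -(k : ℂ)) {μ ν X Y : ℝ}
    (hμ : 0 < μ) (hμ' : μ < 1 / 2) (hν : 0 < ν) (hX : 0 ≤ X) (hY : 0 ≤ Y)
    (hXμ : X * (1 - 2 * μ) ^ 3 < μ) (hYμ : Y < (1 + μ) * (1 - 2 * μ))
    (hXν : X * (3 + 2 * ν) ^ 3 < 1 + ν) (hYν : Y < ν * (3 + 2 * ν)) :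
    Dominated (secondCoef a b c) X Y := by
  have hp : 0 < 1 - 2 * μ := by linarith
  have hp' : 0 < (1 - 2 * μ) ^ 3 := by positivity
  have hn' : 0 < (3 + 2 * ν) ^ 3 := by positivity
  set X₀ := min (μ / (1 - 2 * μ) ^ 3) ((1 + ν) / (3 + 2 * ν) ^ 3) with hX₀
  set Y₀ := min ((1 + μ) * (1 - 2 * μ)) (ν * (3 + 2 * ν)) with hY₀
  have hX0 : 0 < X₀ := by positivity
  have hY0 : 0 < Y₀ := by positivity
  have k1 : X₀ * (1 - 2 * μ) ^ 3 ≤ μ := (le_div_iff₀ hp').1 (min_le_left _ _)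
  have k2 : X₀ * (3 + 2 * ν) ^ 3 ≤ 1 + ν := (le_div_iff₀ hn').1 (min_le_right _ _)
  have k3 : Y₀ ≤ (1 + μ) * (1 - 2 * μ) := min_le_left _ _
  have k4 : Y₀ ≤ ν * (3 + 2 * ν) := min_le_right _ _
  -- The condition on the edge `n = m` follows from the lower-cone bounds.
  have k5 : 4 * (X₀ * Y₀) ≤ 1 := by
    have hn2 : 0 < (3 + 2 * ν) ^ 2 := by positivity
    refine le_of_mul_le_mul_right ?_ hn2
    calc 4 * (X₀ * Y₀) * (3 + 2 * ν) ^ 2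
        ≤ 4 * (X₀ * (ν * (3 + 2 * ν))) * (3 + 2 * ν) ^ 2 := by gcongr
      _ = 4 * ν * (X₀ * (3 + 2 * ν) ^ 3) := by ring
      _ ≤ 4 * ν * (1 + ν) := by gcongr
      _ ≤ 1 * (3 + 2 * ν) ^ 2 := by nlinarith
  -- The condition on the edge `n = 3m` follows from the upper-cone bounds and `μ < 1/2`.
  have k6 : 16 * (X₀ * Y₀ ^ 3) ≤ 27 := by
    calc 16 * (X₀ * Y₀ ^ 3) ≤ 16 * (X₀ * ((1 + μ) * (1 - 2 * μ)) ^ 3) := by gcongr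
      _ = 16 * ((X₀ * (1 - 2 * μ) ^ 3) * (1 + μ) ^ 3) := by ring
      _ ≤ 16 * (1 / 2 * (1 + 1 / 2) ^ 3) := by
          gcongr
          exact k1.trans hμ'.le
      _ = 27 := by norm_num
  have he : (1 : ℝ) ≤ Real.exp 1 := Real.one_le_exp zero_le_one
  refine dominated_of_polyLe (polyLe_secondCoef hb hab hcb) (X₀ := X₀) (Y₀ := Y₀) ?_ hX hY
    (lt_min ((lt_div_iff₀ hp').2 hXμ) ((lt_div_iff₀ hn').2 hXν)) (lt_min hYμ hYν)
  refine ⟨Real.exp 1 ^ 2 * 4, 2, by positivity, fun m n => ?_⟩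
  have n0 : (0 : ℝ) ≤ n := n.cast_nonneg
  have m0 : (0 : ℝ) ≤ m := m.cast_nonneg
  rw [mul_one, mul_assoc (Real.exp 1 ^ 2)]
  rcases le_total (3 * m) n with h | h
  · refine (secondFac_le_upper hμ.le hμ'.le hX0.le hY0.le k1 k3 h).trans ?_
    gcongr
    push_cast
    nlinarith
  rcases le_total n m with h' | h'
  · refine (secondFac_le_lower hν hX0.le hY0.le k2 k4 h').trans ?_
    exact one_le_mul_of_one_le_of_one_le (one_le_pow₀ he) (by nlinarith)
  · refine (secondFac_le_middle hX0 hY0 k5 k6 h' h).trans ?_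
    gcongr
    push_cast
    nlinarith

/-- The parametrisation of the curve that bounds the first region. -/
theorem exists_param {Y : ℝ} (hY : 0 < Y) (hY1 : Y < 1) : ∃ μ : ℝ, 0 < μ ∧ μ < 1 / 2 ∧
    Y = (1 - 2 * μ) * (1 + μ) ∧
    1 / 32 * ((9 - 8 * Y) ^ (3 / 2 : ℝ) - 36 * Y + 8 * Y ^ 2 + 27) = μ * (1 + μ) ^ 3 := by
  obtain ⟨s, hs, hs2⟩ : ∃ s, 0 ≤ s ∧ s ^ 2 = 9 - 8 * Y :=
    ⟨√(9 - 8 * Y), Real.sqrt_nonneg _, Real.sq_sqrt (by linarith)⟩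
  have h1 : 1 < s := by nlinarith
  have h3 : s < 3 := by nlinarith
  have hYs : Y = (9 - s ^ 2) / 8 := by linarith
  -- The positive root of `(1 - 2μ)(1 + μ) = Y`, whose discriminant is `s² = 9 - 8Y`.
  refine ⟨(s - 1) / 4, by linarith, by linarith, by rw [hYs]; ring, ?_⟩
  rw [← hs2, sq_rpow_three_halves hs, hYs]
  ring

theorem dominated_of_mem_firstRegion {a b : ℂ} (c : ℂ) (hab : ∀ k : ℤ, a - b ≠ (k : ℂ)) {x y : ℂ}
    (h : (x, y) ∈ firstRegion) : Dominated (firstCoef a b c) ‖x / y ^ 2‖ (1 / ‖y‖) := by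
  obtain ⟨hy, -, h2, h3⟩ := h
  simp only at hy h2 h3
  obtain ⟨μ, h0, hμ, hY, hφ⟩ := exists_param (one_div_pos.2 (norm_pos_iff.2 hy)) h3
  rw [show (9 - 8 / ‖y‖) = 9 - 8 * (1 / ‖y‖) by ring, show 36 / ‖y‖ = 36 * (1 / ‖y‖) by ring,
    show 8 / ‖y‖ ^ 2 = 8 * (1 / ‖y‖) ^ 2 by ring, hφ] at h2
  have hcont : ContinuousAt (fun μ : ℝ => μ * (1 + μ) ^ 3) μ := by fun_prop
  -- `μ` itself gives equality in the bound on `1 / |y|`. A slightly smaller `μ'` makes it strict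
  -- and, by continuity, keeps the strict bound on `|x / y²|`.
  obtain ⟨μ', h4, h5⟩ := ((hcont.tendsto.eventually (lt_mem_nhds h2)).filter_mono
    nhdsWithin_le_nhds |>.and (Ioo_mem_nhdsLT h0)).exists
  refine dominated_firstCoef c hab h5.1.le (by linarith [h5.2]) (norm_nonneg _) (by positivity)
    h4 ?_
  rw [hY]
  nlinarith [h5.1, h5.2]

theorem dominated_of_mem_secondRegion {a b c : ℂ} (hb : ∀ k : ℤ, b ≠ (k : ℂ))
    (hab : ∀ k : ℤ, a - b ≠ (k : ℂ)) (hcb : ∀ k : ℕ, c - b ≠ -(k : ℂ)) {x y : ℂ}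
    (h : (x, y) ∈ secondRegion) : Dominated (secondCoef a b c) ‖x * y‖ (1 / ‖y‖) := by
  obtain ⟨-, h1, h2⟩ := h
  simp only at h1 h2
  have hX0 := norm_nonneg (x * y)
  generalize ‖x * y‖ = X at *
  have ht0 := norm_nonneg y
  generalize ‖y‖ = t at *
  have ht : 1 < t := by
    by_contra h
    nlinarith
  have htp : 0 < t := by linarith
  obtain ⟨Y, hY⟩ : ∃ Y, Y = 1 / t := ⟨_, rfl⟩
  have hY0 : 0 < Y := by rw [hY]; positivity
  have hY1 : Y < 1 := by rw [hY, div_lt_one htp]; exact ht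
  have htY : t = 1 / Y := by rw [hY]; field_simp
  obtain ⟨h3, h4⟩ := lt_min_iff.1 h2
  rw [← hY]
  obtain ⟨μ, m0, hμ, hYμ, hφ⟩ := exists_param hY0 hY1
  rw [show (9 - 8 / t) = 9 - 8 * Y by rw [hY]; ring, show 36 / t = 36 * Y by rw [hY]; ring,
    show 8 / t ^ 2 = 8 * Y ^ 2 by rw [hY]; ring, hφ] at h3
  have hp : 0 < 1 - 2 * μ := by linarith
  have k1 : X * (1 - 2 * μ) ^ 3 < μ := by
    have : μ * (1 + μ) ^ 3 * t ^ 3 = μ / (1 - 2 * μ) ^ 3 := by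
      rw [htY, hYμ]
      field_simp
    rw [this, lt_div_iff₀ (by positivity)] at h3
    exact h3
  -- `ν = (w - 3) / 4` is the positive root of `ν (3 + 2ν) = Y`. It turns the second entry of the
  -- minimum into `(1 + ν) / (3 + 2ν)³`, the lower-cone radius.
  obtain ⟨w, hw, hw2⟩ : ∃ w, 0 ≤ w ∧ w ^ 2 = 9 + 8 * Y :=
    ⟨√(9 + 8 * Y), Real.sqrt_nonneg _, Real.sq_sqrt (by linarith)⟩
  have hw3 : 3 < w := by nlinarith
  obtain ⟨ν, hν⟩ : ∃ ν, ν = (w - 3) / 4 := ⟨_, rfl⟩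
  have hwν : w = 3 + 4 * ν := by linarith
  have n0 : 0 < ν := by linarith
  have hYν : Y = ν * (3 + 2 * ν) := by
    have : Y = (w ^ 2 - 9) / 8 := by linarith
    rw [this, hwν]; ring
  have hr : √t * (9 * t + 8) ^ (3 / 2 : ℝ) = t ^ 2 * w ^ 3 := by
    obtain ⟨s, hs, hs2⟩ : ∃ s, 0 ≤ s ∧ s ^ 2 = t := ⟨√t, Real.sqrt_nonneg _, Real.sq_sqrt ht0⟩
    have : 9 * t + 8 = (s * w) ^ 2 := by
      rw [mul_pow, hs2, hw2, hY]
      field_simp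
    rw [this, sq_rpow_three_halves (by positivity), ← hs2, Real.sqrt_sq hs]
    ring
  have k2 : X * (3 + 2 * ν) ^ 3 < 1 + ν := by
    have : 1 / 32 * t * (-(√t * (9 * t + 8) ^ (3 / 2 : ℝ)) + 36 * t + 27 * t ^ 2 + 8) =
        (1 + ν) / (3 + 2 * ν) ^ 3 := by
      rw [hr, hwν, htY, hYν]
      field_simp
      ring
    rw [this, lt_div_iff₀ (by positivity)] at h4
    exact h4
  -- Moving `μ` down and `ν` up makes both bounds on `Y` strict, while the bounds on `X` survive by
  -- continuity.
  have c1 : ContinuousAt (fun μ : ℝ => μ - X * (1 - 2 * μ) ^ 3) μ := by fun_prop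
  obtain ⟨μ', h5, h6⟩ := ((c1.tendsto.eventually (lt_mem_nhds (sub_pos.2 k1))).filter_mono
    nhdsWithin_le_nhds |>.and (Ioo_mem_nhdsLT m0)).exists
  have c2 : ContinuousAt (fun ν : ℝ => 1 + ν - X * (3 + 2 * ν) ^ 3) ν := by fun_prop
  obtain ⟨ν', h7, h8⟩ := ((c2.tendsto.eventually (lt_mem_nhds (sub_pos.2 k2))).filter_mono
    nhdsWithin_le_nhds |>.and (self_mem_nhdsWithin (s := Set.Ioi ν))).exists
  have h8' : ν < ν' := h8
  refine dominated_secondCoef hb hab hcb h6.1 (h6.2.trans hμ) (n0.trans h8') hX0 hY0.le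
    (sub_pos.1 h5) ?_ (sub_pos.1 h7) ?_
  · rw [hYμ]; nlinarith [h6.1, h6.2]
  · rw [hYν]; nlinarith

/-! ### Convergence of Horn's series near and inside its region -/

theorem dominated_hornCoef {a b c : ℂ} (hb : ∀ k : ℤ, b ≠ (k : ℂ)) (hc : ∀ k : ℕ, c ≠ -(k : ℂ)) :
    Dominated (hornCoef a b c) 0 0 := by
  refine dominated_of_polyLe (polyLe_hornCoef hb hc) (X₀ := 1 / 32) (Y₀ := 1 / 2) ?_ le_rfl le_rfl
    (by norm_num) (by norm_num)
  refine ⟨1, 0, one_pos, fun m n => ?_⟩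
  rw [pow_zero, mul_one, mul_one]
  exact hornFac_le m n

theorem exists_norm_gt_near (x : ℂ) {δ : ℝ} (hδ : 0 < δ) : ∃ x' : ℂ, ‖x‖ < ‖x'‖ ∧ dist x' x < δ := by
  by_cases hx : x = 0
  · refine ⟨((δ / 2 : ℝ) : ℂ), ?_, ?_⟩
    · rw [hx, norm_zero, Complex.norm_of_nonneg (by positivity)]; positivity
    · rw [hx, dist_zero_right, Complex.norm_of_nonneg (by positivity)]; linarith
  · have hx' : 0 < ‖x‖ := norm_pos_iff.2 hx
    set e : ℝ := δ / (2 * ‖x‖) with he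
    have he0 : 0 < e := by positivity
    refine ⟨((1 + e : ℝ) : ℂ) * x, ?_, ?_⟩
    · rw [norm_mul, Complex.norm_of_nonneg (by positivity)]
      nlinarith
    · rw [dist_eq_norm, show ((1 + e : ℝ) : ℂ) * x - x = (e : ℂ) * x by push_cast; ring, norm_mul,
        Complex.norm_of_nonneg he0.le, he]
      field_simp
      linarith

/-- In the interior both moduli can be increased at once without losing convergence; the terms at
the enlarged point are bounded. -/
theorem dominated_of_mem_hornH5Region {a b c x y : ℂ} (h : (x, y) ∈ hornH5Region a b c) :
    Dominated (hornCoef a b c) ‖x‖ ‖y‖ := by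
  rw [hornH5Region, mem_interior_iff_mem_nhds, Metric.mem_nhds_iff] at h
  obtain ⟨δ, hδ, h⟩ := h
  obtain ⟨x', h1, h2⟩ := exists_norm_gt_near x hδ
  obtain ⟨y', h3, h4⟩ := exists_norm_gt_near y hδ
  have hmem : (x', y') ∈ ball (x, y) δ := by
    rw [mem_ball, Prod.dist_eq]
    exact max_lt h2 h4
  have hs := h hmem
  rw [Set.mem_ofPred_eq] at hs
  obtain ⟨C, hC⟩ : ∃ C, ∀ p, ‖hornH5Term a b c x' y' p‖ ≤ C :=
    ⟨_, fun p => hs.norm.le_tsum p fun _ _ => norm_nonneg _⟩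
  refine ⟨‖x'‖, ‖y'‖, C, h1, h3, fun m n => ?_⟩
  have := hC (m, n)
  rwa [hornH5Term_eq, norm_mul, norm_mul, norm_pow, norm_pow] at this

theorem zero_mem_hornH5Region {a b c : ℂ} (hb : ∀ k : ℤ, b ≠ (k : ℂ))
    (hc : ∀ k : ℕ, c ≠ -(k : ℂ)) : ((0, 0) : ℂ × ℂ) ∈ hornH5Region a b c := by
  obtain ⟨X, Y, hX, hY, h⟩ := (dominated_hornCoef (a := a) hb hc).exists_gt
  rw [hornH5Region, mem_interior_iff_mem_nhds]
  filter_upwards [prod_mem_nhds (ball_mem_nhds (0 : ℂ) hX) (ball_mem_nhds (0 : ℂ) hY)] with q hq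
  refine (h.summable (mem_ball_zero_iff.1 hq.1).le (mem_ball_zero_iff.1 hq.2).le).congr fun p => ?_
  exact (hornH5Term_eq a b c q.1 q.2 p).symm

end HornH5
end

noncomputable section
namespace HornH5
open Filter Metric

/-! ### Shifted Pochhammer symbols and Gamma factors -/

theorem asc_add (z : ℂ) (k n : ℕ) : (ascPochhammer ℂ (k + n)).eval z =
    (ascPochhammer ℂ k).eval z * (ascPochhammer ℂ n).eval (z + k) := by
  rw [← ascPochhammer_mul]
  simp [Polynomial.eval_comp]

theorem poch_sub {z : ℂ} (hz : ∀ k : ℕ, 1 - z ≠ -k) (m n : ℕ) :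
    poch z ((n : ℤ) - m) = poch z (-(m : ℤ)) * (ascPochhammer ℂ n).eval (z - m) := by
  have key : ∀ k : ℕ, poch z (-(k : ℤ)) = ((ascPochhammer ℂ k).eval (z - k))⁻¹ := fun k => by
    rw [poch_neg_natCast, asc_reflect, mul_inv, ← inv_pow]
    norm_num
  have hne : ∀ k : ℕ, (ascPochhammer ℂ k).eval (z - k) ≠ 0 := fun k => by
    rw [asc_reflect]
    exact mul_ne_zero (pow_ne_zero _ (by norm_num)) (asc_ne_zero hz k)
  rcases le_total m n with h | h
  · obtain ⟨j, rfl⟩ := Nat.exists_eq_add_of_le h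
    rw [show ((m + j : ℕ) : ℤ) - m = (j : ℕ) by push_cast; ring, poch_natCast, key, asc_add,
      inv_mul_cancel_left₀ (hne m), sub_add_cancel]
  · obtain ⟨j, rfl⟩ := Nat.exists_eq_add_of_le h
    rw [show (n : ℤ) - (n + j : ℕ) = -(j : ℕ) by push_cast; ring, key, key]
    have h1 := asc_add (z - (n + j : ℕ)) n j
    rw [show z - ((n + j : ℕ) : ℂ) + n = z - j by push_cast; ring] at h1
    have h2 := hne (n + j)
    rw [h1] at h2 ⊢
    have h3 := left_ne_zero_of_mul h2
    have h4 := right_ne_zero_of_mul h2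
    field_simp

/-- Because `1 / Γ` is entire, this and its consequences `inv_Gamma_sub` and `Gamma_sub` hold for
every `z`, with Mathlib's value `Γ = 0` at the poles. -/
theorem inv_Gamma_eq (z : ℂ) (n : ℕ) :
    (Complex.Gamma z)⁻¹ = (ascPochhammer ℂ n).eval z * (Complex.Gamma (z + n))⁻¹ := by
  induction n with
  | zero => simp
  | succ n ih =>
    have := Complex.one_div_Gamma_eq_self_mul_one_div_Gamma_add_one (z + n)
    rw [ih, this, ascPochhammer_succ_eval, mul_assoc]
    push_cast
    rw [add_assoc]

theorem inv_Gamma_sub (z : ℂ) (n : ℕ) : (Complex.Gamma (z - n))⁻¹ =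
    (-1) ^ n * (ascPochhammer ℂ n).eval (1 - z) * (Complex.Gamma z)⁻¹ := by
  rw [inv_Gamma_eq (z - n) n, asc_reflect, sub_add_cancel]

theorem Gamma_sub (z : ℂ) (n : ℕ) : Complex.Gamma (z - n) =
    (-1) ^ n * ((ascPochhammer ℂ n).eval (1 - z))⁻¹ * Complex.Gamma z := by
  have := congrArg (·⁻¹) (inv_Gamma_sub z n)
  simp only [inv_inv, mul_inv] at this
  rw [this, ← inv_pow]
  norm_num

theorem Gamma_add {z : ℂ} (hz : ∀ k : ℕ, z ≠ -k) (n : ℕ) :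
    Complex.Gamma (z + n) = (ascPochhammer ℂ n).eval z * Complex.Gamma z := by
  have h := congrArg (·⁻¹) (inv_Gamma_eq z n)
  simp only [inv_inv, mul_inv] at h
  rw [h, mul_inv_cancel_left₀ (asc_ne_zero hz n)]

theorem inv_Gamma_add {z : ℂ} (hz : ∀ k : ℕ, z ≠ -k) (n : ℕ) :
    (Complex.Gamma (z + n))⁻¹ = ((ascPochhammer ℂ n).eval z)⁻¹ * (Complex.Gamma z)⁻¹ := by
  rw [Gamma_add hz, mul_inv]

/-! ### The rows of Horn's series -/

/-- The coefficient of `x ^ m` in Horn's series at `y = 0`. -/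
def colCoef (a b : ℂ) (m : ℕ) : ℂ :=
  (ascPochhammer ℂ (2 * m)).eval a * poch b (-(m : ℤ)) / m.factorial

/-- The coefficient of `x ^ m` in Horn's series, continued to the slit plane in `y`. -/
def row (a b c : ℂ) (m : ℕ) (y : ℂ) : ℂ := colCoef a b m * hyp (a + 2 * m) (b - m) c y

theorem poch_two_mul_add (z : ℂ) (m n : ℕ) : poch z (2 * m + n) =
    (ascPochhammer ℂ (2 * m)).eval z * (ascPochhammer ℂ n).eval (z + 2 * m) := by
  rw [show (2 * (m : ℤ) + n) = ((2 * m + n : ℕ) : ℤ) by push_cast; rfl, poch_natCast, asc_add]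
  push_cast
  rfl

theorem hornCoef_eq {a b : ℂ} (c : ℂ) (hb : ∀ k : ℤ, b ≠ (k : ℂ)) (m n : ℕ) :
    hornCoef a b c m n = colCoef a b m * hypCoef (a + 2 * m) (b - m) c n := by
  rw [hornCoef, colCoef, hypCoef, poch_two_mul_add,
    poch_sub (fun k e => hb (k + 1) (by push_cast; linear_combination -e)), poch_natCast]
  field_simp

theorem hornCoef_zero_right {a b : ℂ} (c : ℂ) (hb : ∀ k : ℤ, b ≠ (k : ℂ)) (m : ℕ) :
    hornCoef a b c m 0 = colCoef a b m := by
  rw [hornCoef_eq c hb, hypCoef_zero, mul_one]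

theorem psum_hornCoef {a b c : ℂ} (hb : ∀ k : ℤ, b ≠ (k : ℂ)) (hc : ∀ k : ℕ, c ≠ -(k : ℂ)) (m : ℕ)
    {y : ℂ} (hy : ‖y‖ < 1) : psum (hornCoef a b c m) y = row a b c m y := by
  rw [row, hyp_eq_psum _ _ hc hy, ← psum_const_mul]
  congr 1
  funext n
  exact hornCoef_eq c hb m n

/-- The prefactor of the first series at infinity. -/
def firstFactor (a b c : ℂ) : ℂ :=
  Complex.Gamma c * Complex.Gamma (b - a) / (Complex.Gamma b * Complex.Gamma (c - a))

/-- The prefactor of the second series at infinity. -/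
def secondFactor (a b c : ℂ) : ℂ :=
  Complex.Gamma c * Complex.Gamma (a - b) / (Complex.Gamma a * Complex.Gamma (c - b))

/-- Shifting `b`, `c - a` and `b - a` down by `m`, `2m` and `3m` produces exactly the Pochhammer
symbols of the first series. What is left over is the prefactor for `m = 0` and a sign. -/
theorem colCoef_mul_first {a b : ℂ} (c : ℂ) (hb : ∀ k : ℤ, b ≠ (k : ℂ)) (m n : ℕ) :
    colCoef a b m * (firstFactor (a + 2 * m) (b - m) c *
      hypCoef (a + 2 * m) (a + 2 * m - c + 1) (a + 2 * m - (b - m) + 1) n) =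
      firstFactor a b c * ((-1) ^ m * firstCoef a b c m n) := by
  have hb' : (ascPochhammer ℂ m).eval (1 - b) ≠ 0 :=
    asc_ne_zero (fun k e => hb (k + 1) (by push_cast; linear_combination -e)) m
  have e1 : (Complex.Gamma (b - m))⁻¹ = _ := inv_Gamma_sub b m
  have e2 : (Complex.Gamma (c - (a + 2 * m)))⁻¹ =
      (ascPochhammer ℂ (2 * m)).eval (a - c + 1) * (Complex.Gamma (c - a))⁻¹ := by
    rw [show c - (a + 2 * (m : ℂ)) = c - a - (2 * m : ℕ) by push_cast; ring, inv_Gamma_sub,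
      pow_mul, show 1 - (c - a) = a - c + 1 by ring]
    norm_num
  have e3 : Complex.Gamma (b - m - (a + 2 * m)) =
      (-1) ^ m * ((ascPochhammer ℂ (3 * m)).eval (a - b + 1))⁻¹ * Complex.Gamma (b - a) := by
    rw [show b - (m : ℂ) - (a + 2 * (m : ℂ)) = b - a - (3 * m : ℕ) by push_cast; ring, Gamma_sub,
      show 1 - (b - a) = a - b + 1 by ring, pow_mul]
    norm_num
  have e4 : poch (a - b + 1) (3 * m + n) = (ascPochhammer ℂ (3 * m)).eval (a - b + 1) *
      (ascPochhammer ℂ n).eval (a + 2 * m - (b - m) + 1) := by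
    rw [show (3 * (m : ℤ) + n) = ((3 * m + n : ℕ) : ℤ) by push_cast; rfl, poch_natCast, asc_add]
    congr 2
    push_cast
    ring
  rw [firstFactor, firstFactor, colCoef, hypCoef, firstCoef, poch_two_mul_add, poch_two_mul_add, e4,
    e3, poch_neg_natCast, div_eq_mul_inv (Complex.Gamma c * _), mul_inv, e1, e2,
    show a - c + 1 + 2 * (m : ℂ) = a + 2 * m - c + 1 by ring]
  -- `(b)₋ₘ` and `1 / Γ(b - m)` cancel up to `1 / Γ(b)`, signs included; the surviving sign comes
  -- from `Γ(b - a - 3m)`.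
  have hs : ((-1 : ℂ) ^ m) * (-1) ^ m * (((ascPochhammer ℂ m).eval (1 - b))⁻¹ *
      (ascPochhammer ℂ m).eval (1 - b)) = 1 := by
    rw [inv_mul_cancel₀ hb', ← mul_pow]
    norm_num
  refine Eq.trans ?_ (one_mul _)
  refine Eq.trans ?_ (congrArg (· * _) hs)
  simp only [div_eq_mul_inv, mul_inv]
  ring

/-- Here `(a)₂ₘ` cancels against `Γ(a + 2m)`, and the signs of the two symbols of negative index in
the coefficient cancel each other. -/
theorem colCoef_mul_second {a b c : ℂ} (ha : ∀ k : ℕ, a ≠ -(k : ℂ)) (hb : ∀ k : ℤ, b ≠ (k : ℂ))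
    (hab : ∀ k : ℤ, a - b ≠ (k : ℂ)) (hcb : ∀ k : ℕ, c - b ≠ -(k : ℂ)) (m n : ℕ) :
    colCoef a b m * (secondFactor (a + 2 * m) (b - m) c *
      hypCoef (b - m) (b - m - c + 1) (b - m - (a + 2 * m) + 1) n) =
      secondFactor a b c * secondCoef a b c m n := by
  have ha' : (ascPochhammer ℂ (2 * m)).eval a ≠ 0 := asc_ne_zero ha _
  have e1 : (Complex.Gamma (a + 2 * m))⁻¹ =
      ((ascPochhammer ℂ (2 * m)).eval a)⁻¹ * (Complex.Gamma a)⁻¹ := by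
    rw [show a + 2 * (m : ℂ) = a + (2 * m : ℕ) by push_cast; ring, inv_Gamma_add ha]
  have e2 : (Complex.Gamma (c - (b - m)))⁻¹ =
      ((ascPochhammer ℂ m).eval (c - b))⁻¹ * (Complex.Gamma (c - b))⁻¹ := by
    rw [show c - (b - (m : ℂ)) = c - b + m by ring, inv_Gamma_add hcb]
  have e3 : Complex.Gamma (a + 2 * m - (b - m)) =
      (ascPochhammer ℂ (3 * m)).eval (a - b) * Complex.Gamma (a - b) := by
    rw [show a + 2 * (m : ℂ) - (b - m) = a - b + (3 * m : ℕ) by push_cast; ring,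
      Gamma_add fun k e => hab (-k) (by push_cast; exact e)]
  have e4 : poch (-a + b + 1) (n - 3 * m) = (-1) ^ m * ((ascPochhammer ℂ (3 * m)).eval (a - b))⁻¹ *
      (ascPochhammer ℂ n).eval (b - m - (a + 2 * m) + 1) := by
    rw [show ((n : ℤ) - 3 * m) = n - (3 * m : ℕ) by push_cast; rfl,
      poch_sub (fun k e => hab (-k) (by push_cast; linear_combination e)), poch_neg_natCast,
      show 1 - (-a + b + 1) = a - b by ring, pow_mul, show ((-1 : ℂ) ^ 3) = -1 by norm_num]
    congr 2
    push_cast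
    ring
  have e5 : poch (b - c + 1) (n - m) = (-1) ^ m * ((ascPochhammer ℂ m).eval (c - b))⁻¹ *
      (ascPochhammer ℂ n).eval (b - m - c + 1) := by
    rw [poch_sub (fun k e => hcb k (by linear_combination e)), poch_neg_natCast,
      show 1 - (b - c + 1) = c - b by ring]
    congr 2
    ring
  have e6 : poch b (n - m) = poch b (-(m : ℤ)) * (ascPochhammer ℂ n).eval (b - m) :=
    poch_sub (fun k e => hb (k + 1) (by push_cast; linear_combination -e)) m n
  have hs : ((-1 : ℂ) ^ m) * ((-1) ^ m)⁻¹ = 1 := mul_inv_cancel₀ (pow_ne_zero _ (by norm_num))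
  rw [secondFactor, secondFactor, colCoef, hypCoef, secondCoef, e3, e4, e5, e6,
    div_eq_mul_inv (Complex.Gamma c * _), mul_inv, e1, e2]
  have h1 : (ascPochhammer ℂ (2 * m)).eval a * ((ascPochhammer ℂ (2 * m)).eval a)⁻¹ = 1 :=
    mul_inv_cancel₀ ha'
  generalize (ascPochhammer ℂ (2 * m)).eval a = A at *
  generalize (-1 : ℂ) ^ m = S at *
  refine Eq.trans ?_ ((congrArg (· * _) h1).trans (one_mul _))
  refine (one_mul _).symm.trans ((congrArg (· * _) hs.symm).trans ?_)
  simp only [div_eq_mul_inv, mul_inv, inv_inv]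
  ring

end HornH5
end

noncomputable section
namespace HornH5
open Filter Metric

/-! ### The continuation -/

/-- With `l = log (-y)`, `e^(-(a + 2m) l)` is `e^(-a l) y^(-2m)` and `e^(-(b - m) l)` is `e^(-b l)
(-y)ᵐ`. Hence only the factors carrying `xᵐ` to `(-x / y²)ᵐ` and `(-x y)ᵐ` depend on `m`. -/
theorem row_eq {a b c : ℂ} (ha : ∀ k : ℕ, a ≠ -(k : ℂ)) (hb : ∀ k : ℤ, b ≠ (k : ℂ))
    (hc : ∀ k : ℕ, c ≠ -(k : ℂ)) (hab : ∀ k : ℤ, a - b ≠ (k : ℂ))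
    (hcb : ∀ k : ℕ, c - b ≠ -(k : ℂ)) (m : ℕ) {y : ℂ} (hy : y ∈ exterior) :
    row a b c m y =
      Complex.exp (-a * Complex.log (-y)) * firstFactor a b c *
        ((-(1 / y ^ 2)) ^ m * psum (firstCoef a b c m) (1 / y)) +
      Complex.exp (-b * Complex.log (-y)) * secondFactor a b c *
        ((-y) ^ m * psum (secondCoef a b c m) (1 / y)) := by
  have hy0 : -y ≠ 0 := Complex.slitPlane_ne_zero hy.2
  have hab' : ∀ k : ℤ, a + 2 * m - (b - m) ≠ k := fun k e =>
    hab (k - 3 * m) (by push_cast; linear_combination e)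
  have s1 : solInf (a + 2 * m) (b - m) c y = Complex.exp (-a * Complex.log (-y)) *
      ((1 / y ^ 2) ^ m * psum (hypCoef (a + 2 * m) (a + 2 * m - c + 1) (a + 2 * m - (b - m) + 1))
        (1 / y)) := by
    rw [solInf, laurent, show -(a + 2 * (m : ℂ)) * Complex.log (-y) =
      -a * Complex.log (-y) + (2 * m : ℕ) * (-Complex.log (-y)) by push_cast; ring, Complex.exp_add,
      Complex.exp_nat_mul, Complex.exp_neg, Complex.exp_log hy0, pow_mul,
      show (-y)⁻¹ ^ 2 = 1 / y ^ 2 by rw [inv_pow, neg_sq, one_div]]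
    ring
  have s2 : solInf (b - m) (a + 2 * m) c y = Complex.exp (-b * Complex.log (-y)) *
      ((-y) ^ m * psum (hypCoef (b - m) (b - m - c + 1) (b - m - (a + 2 * m) + 1)) (1 / y)) := by
    rw [solInf, laurent, show -(b - (m : ℂ)) * Complex.log (-y) =
      -b * Complex.log (-y) + m * Complex.log (-y) by ring, Complex.exp_add,
      Complex.exp_nat_mul, Complex.exp_log hy0]
    ring
  have h1 : colCoef a b m * firstFactor (a + 2 * m) (b - m) c *
      psum (hypCoef (a + 2 * m) (a + 2 * m - c + 1) (a + 2 * m - (b - m) + 1)) (1 / y) =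
      firstFactor a b c * (-1) ^ m * psum (firstCoef a b c m) (1 / y) := by
    rw [← psum_const_mul, ← psum_const_mul]
    congr 1
    funext n
    linear_combination colCoef_mul_first c hb m n
  have h2 : colCoef a b m * secondFactor (a + 2 * m) (b - m) c *
      psum (hypCoef (b - m) (b - m - c + 1) (b - m - (a + 2 * m) + 1)) (1 / y) =
      secondFactor a b c * psum (secondCoef a b c m) (1 / y) := by
    rw [← psum_const_mul, ← psum_const_mul]
    congr 1
    funext n
    linear_combination colCoef_mul_second ha hb hab hcb m n
  rw [row, hyp_eq_solInf hc hab' hy, s1, s2, neg_pow (1 / y ^ 2)]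
  change _ * (firstFactor (a + 2 * m) (b - m) c * _ + secondFactor (a + 2 * m) (b - m) c * _) = _
  linear_combination Complex.exp (-a * Complex.log (-y)) * (1 / y ^ 2) ^ m * h1 +
    Complex.exp (-b * Complex.log (-y)) * (-y) ^ m * h2

/-- The domain of the continuation: the points near which the series in powers of `x`, with
coefficients continued in `y`, is dominated by a convergent geometric series. -/
def contDomain (a b c : ℂ) : Set (ℂ × ℂ) :=
  {q | ∃ r ε C : ℝ, ‖q.1‖ < r ∧ 0 < ε ∧ ball q.2 ε ⊆ slit ∧
    ∀ y ∈ ball q.2 ε, ∀ m, ‖row a b c m y‖ * r ^ m ≤ C}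

/-- The continuation of Horn's function. -/
def cont (a b c : ℂ) (q : ℂ × ℂ) : ℂ := ∑' m, q.1 ^ m * row a b c m q.2

theorem isOpen_contDomain (a b c : ℂ) : IsOpen (contDomain a b c) := by
  rw [isOpen_iff_mem_nhds]
  rintro ⟨x, y⟩ ⟨r, ε, C, hr, hε, hs, h⟩
  have hx : ball (0 : ℂ) r ∈ 𝓝 x := isOpen_ball.mem_nhds (by simpa using hr)
  filter_upwards [prod_mem_nhds hx (ball_mem_nhds y (half_pos hε))] with q hq
  have hsub : ball q.2 (ε / 2) ⊆ ball y ε := by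
    refine ball_subset_ball' ?_
    linarith [mem_ball.1 hq.2]
  exact ⟨r, ε / 2, C, by simpa using hq.1, half_pos hε, hsub.trans hs, fun y' hy' =>
    h y' (hsub hy')⟩

theorem analyticOnNhd_cont (a b : ℂ) {c : ℂ} (hc : ∀ k : ℕ, c ≠ -(k : ℂ)) :
    AnalyticOnNhd ℂ (cont a b c) (contDomain a b c) := by
  rintro ⟨x, y⟩ ⟨r, ε, C, hr, hε, hs, h⟩
  refine analyticAt_tsum_pow_mul hε ((norm_nonneg x).trans_lt hr) (fun m => ?_)
    (fun m y' hy' => h y' hy' m) hr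
  exact ((differentiableOn_hyp _ _ hc).mono hs).const_mul _

theorem locally_bounded {f : ℂ → ℂ} {y : ℂ} (h : ContinuousAt f y) :
    ∀ᶠ y' in 𝓝 y, ‖f y'‖ ≤ ‖f y‖ + 1 :=
  (h.norm.tendsto.eventually (gt_mem_nhds (lt_add_one _))).mono fun _ h => h.le

/-- Near `y` the row grows at most exponentially in `m`: the prefactor contributes `quadFactor 1` to
the power `2m`, the disc series `K^(M (m + 1))`, and `colCoef` is geometric because Horn's series
converges near the origin. -/
theorem zero_prod_mem_contDomain {a b c : ℂ} (hb : ∀ k : ℤ, b ≠ (k : ℂ))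
    (hc : ∀ k : ℕ, c ≠ -(k : ℂ)) {y : ℂ} (hy : y ∈ slit) : ((0 : ℂ), y) ∈ contDomain a b c := by
  have hq : ∀ α, ContinuousAt (quadFactor α) y := fun α =>
    ((thetaOn_quadFactor α).differentiableOn.differentiableAt (isOpen_slit.mem_nhds hy)).continuousAt
  have hd : ContinuousAt discMap y :=
    (thetaOn_discMap.differentiableOn.differentiableAt (isOpen_slit.mem_nhds hy)).continuousAt
  obtain ⟨ρ', h1, h2⟩ := exists_between (norm_discMap_lt hy)
  obtain ⟨ρ, h3, h4⟩ := exists_between h2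
  have hρ' : 0 < ρ' := (norm_nonneg _).trans_lt h1
  have hρ : 0 < ρ := hρ'.trans h3
  obtain ⟨K, hK, hu⟩ := exists_quadCoef_bound hc hρ h4
  -- Then `M (m + 1)` bounds both `‖a + 2m‖` and `‖b - m‖`.
  obtain ⟨M, hM⟩ := exists_nat_ge (max ‖a‖ ‖b‖ + 2)
  have hMa : ‖a‖ + 2 ≤ M := le_trans (by gcongr; exact le_max_left _ _) hM
  have hMb : ‖b‖ + 2 ≤ M := le_trans (by gcongr; exact le_max_right _ _) hM
  obtain ⟨X, Y, C, hX, hY, hA⟩ := dominated_hornCoef (a := a) hb hc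
  obtain ⟨ε, hε, hball⟩ := Metric.eventually_nhds_iff_ball.1
    ((isOpen_slit.eventually_mem hy).and ((locally_bounded (hq a)).and ((locally_bounded (hq 1)).and
      (hd.norm.tendsto.eventually (gt_mem_nhds h1)))))
  set Q := ‖quadFactor 1 y‖ + 1 with hQ
  set Q' := ‖quadFactor a y‖ + 1 with hQ'
  have hQ0 : 0 < Q := by positivity
  have hK0 : 0 < K := by linarith
  have hfac : ∀ (m : ℕ) (y' : ℂ), quadFactor (a + 2 * m) y' = quadFactor a y' * quadFactor 1 y' ^ (2 * m) :=
    fun m y' => by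
      rw [quadFactor, quadFactor, quadFactor, ← Complex.exp_nat_mul, ← Complex.exp_add]
      congr 1
      push_cast
      ring
  have hρρ : 0 < 1 - ρ' / ρ := by rw [sub_pos, div_lt_one hρ]; exact h3
  -- The radius divides the one of `colCoef` by the exponential growth rates of the other two
  -- factors.
  refine ⟨X / (Q ^ 2 * K ^ M), ε, C * Q' * K ^ M * (1 - ρ' / ρ)⁻¹, ?_, hε,
    fun y' hy' => (hball y' hy').1, fun y' hy' m => ?_⟩
  · rw [norm_zero]; positivity
  obtain ⟨-, b1, b2, b3⟩ := hball y' hy'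
  have hp : ‖psum (quadCoef (a + 2 * m) (b - m) c) (discMap y')‖ ≤
      K ^ (M * (m + 1)) * (1 - ρ' / ρ)⁻¹ := by
    have m0 : (0 : ℝ) ≤ m := m.cast_nonneg
    have hMm : 1 ≤ M * (m + 1) := by
      have : (1 : ℝ) ≤ M := by linarith [norm_nonneg a]
      have : 1 ≤ M := by exact_mod_cast this
      exact Nat.one_le_iff_ne_zero.2 (by positivity)
    have na : ‖a + 2 * m‖ ≤ (M * (m + 1) : ℕ) := by
      refine (norm_add_le _ _).trans ?_
      rw [norm_mul, Complex.norm_natCast, Complex.norm_ofNat]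
      push_cast
      nlinarith [norm_nonneg a]
    have nb : ‖b - m‖ ≤ (M * (m + 1) : ℕ) := by
      refine (norm_sub_le _ _).trans ?_
      rw [Complex.norm_natCast]
      push_cast
      nlinarith [norm_nonneg b]
    refine (norm_psum_le (b3.trans h3) (hu _ hMm _ _ na nb)).trans ?_
    gcongr
  have hcol : ‖colCoef a b m‖ * X ^ m ≤ C := by
    have := hA m 0
    rwa [pow_zero, mul_one, hornCoef_zero_right c hb] at this
  rw [row, hyp, hfac, norm_mul, norm_mul, norm_mul, norm_pow]
  have hP := norm_nonneg (psum (quadCoef (a + 2 * m) (b - m) c) (discMap y'))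
  calc ‖colCoef a b m‖ * (‖quadFactor a y'‖ * ‖quadFactor 1 y'‖ ^ (2 * m) *
        ‖psum (quadCoef (a + 2 * m) (b - m) c) (discMap y')‖) * (X / (Q ^ 2 * K ^ M)) ^ m
      ≤ ‖colCoef a b m‖ * (Q' * Q ^ (2 * m) * (K ^ (M * (m + 1)) * (1 - ρ' / ρ)⁻¹)) *
          (X / (Q ^ 2 * K ^ M)) ^ m := by gcongr
    _ = (‖colCoef a b m‖ * X ^ m) * (Q' * K ^ M * (1 - ρ' / ρ)⁻¹) := by
        rw [div_pow, mul_pow, ← pow_mul, ← pow_mul, mul_add, mul_one, pow_add]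
        field_simp
    _ ≤ C * (Q' * K ^ M * (1 - ρ' / ρ)⁻¹) := by gcongr
    _ = _ := by ring

/-- The domain condition depends on `x` only through `|x|`, so shrinking `x` leads to `(0, y)`
inside it; the segment from `(0, y)` to the origin lies in `{0}` times the star-shaped slit plane.
-/
theorem isConnected_contDomain {a b c : ℂ} (hb : ∀ k : ℤ, b ≠ (k : ℂ))
    (hc : ∀ k : ℕ, c ≠ -(k : ℂ)) : IsConnected (contDomain a b c) := by
  refine ⟨⟨_, zero_prod_mem_contDomain hb hc zero_mem_slit⟩,
    isPreconnected_of_forall (0, 0) ?_⟩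
  rintro ⟨x, y⟩ hq
  obtain ⟨r, ε, C, hr, hε, hs, h⟩ := hq
  have hy : y ∈ slit := hs (mem_ball_self hε)
  have c1 : IsPreconnected ((fun t : ℝ => ((t : ℂ) * x, y)) '' Set.Icc 0 1) :=
    isPreconnected_Icc.image _ (by fun_prop)
  have c2 : IsPreconnected ((fun t : ℝ => ((0 : ℂ), (t : ℂ) * y)) '' Set.Icc 0 1) :=
    isPreconnected_Icc.image _ (by fun_prop)
  refine ⟨_, ?_, ?_, ?_, IsPreconnected.union (0, y) ?_ ?_ c1 c2⟩
  · rintro _ (⟨t, ht, rfl⟩ | ⟨t, ht, rfl⟩)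
    · refine ⟨r, ε, C, lt_of_le_of_lt ?_ hr, hε, hs, h⟩
      rw [norm_mul, Complex.norm_of_nonneg ht.1]
      exact mul_le_of_le_one_left (norm_nonneg _) ht.2
    · exact zero_prod_mem_contDomain hb hc (smul_mem_slit hy ht.1 ht.2)
  · exact Or.inr ⟨0, by simp, by simp⟩
  · exact Or.inl ⟨1, by simp, by simp⟩
  · exact ⟨0, by simp, by simp⟩
  · exact ⟨1, by simp, by simp⟩

/-! ### Comparison with Horn's series -/

/-- The row `m = 0` is `₂F₁(a, b; c; y)`, which does not terminate as `a` and `b` are not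
non-positive integers. Its coefficients decay at most polynomially. -/
theorem lt_one_of_dominated {a b c : ℂ} (ha : ∀ k : ℕ, a ≠ -(k : ℂ))
    (hb : ∀ k : ℤ, b ≠ (k : ℂ)) (hc : ∀ k : ℕ, c ≠ -(k : ℂ)) {X Y : ℝ}
    (h : Dominated (hornCoef a b c) X Y) :
    Y < 1 := by
  obtain ⟨X', Y', C, -, hY', h⟩ := h
  refine hY'.trans_le ?_
  obtain ⟨A, p, hA, ha⟩ := exists_le_norm_asc ha
  obtain ⟨B, q, hB, hb⟩ := exists_le_norm_asc (z := b) fun k e => hb (-k) (by push_cast; exact e)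
  obtain ⟨r, hr⟩ := exists_norm_asc_le c
  by_contra hlt
  push Not at hlt
  have hC : 0 ≤ C := by
    have := h 0 0
    simp only [pow_zero, mul_one] at this
    exact (norm_nonneg _).trans this
  have hY0 : 0 < Y' := by linarith
  have h1 : ∀ n : ℕ, Y' ^ n ≤ A * B * C * ((n : ℝ) + 1) ^ (p + q + r) := fun n => by
    have hn : (0 : ℝ) < n.factorial := by positivity
    have hcn : 0 < ‖(ascPochhammer ℂ n).eval c‖ := norm_pos_iff.2 (asc_ne_zero hc n)
    have e : ‖hornCoef a b c 0 n‖ = ‖(ascPochhammer ℂ n).eval a‖ * ‖(ascPochhammer ℂ n).eval b‖ /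
        (‖(ascPochhammer ℂ n).eval c‖ * n.factorial) := by
      simp only [hornCoef, Nat.cast_zero, mul_zero, zero_add, sub_zero, poch_natCast,
        Nat.factorial_zero, Nat.cast_one, one_mul, norm_div, norm_mul, Complex.norm_natCast]
      rw [div_div]
    have h2 := h 0 n
    rw [pow_zero, one_mul, e, div_mul_eq_mul_div, div_le_iff₀ (by positivity)] at h2
    refine le_of_mul_le_mul_right ?_ (mul_pos hn hn)
    calc Y' ^ n * (n.factorial * n.factorial)
        ≤ Y' ^ n * ((A * ((n : ℝ) + 1) ^ p * ‖(ascPochhammer ℂ n).eval a‖) *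
          (B * ((n : ℝ) + 1) ^ q * ‖(ascPochhammer ℂ n).eval b‖)) := by
          gcongr
          exacts [ha n, hb n]
      _ = A * B * ((n : ℝ) + 1) ^ (p + q) *
          (‖(ascPochhammer ℂ n).eval a‖ * ‖(ascPochhammer ℂ n).eval b‖ * Y' ^ n) := by
          rw [pow_add]; ring
      _ ≤ A * B * ((n : ℝ) + 1) ^ (p + q) *
          (C * ((((n : ℝ) + 1) ^ r * n.factorial) * n.factorial)) := by
          refine mul_le_mul_of_nonneg_left (h2.trans ?_) (by positivity)
          gcongr
          exact hr n
      _ = _ := by rw [pow_add _ (p + q)]; ring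
  -- The exponent is one more than that of the polynomial bound on `Y'ⁿ`, so the extra factor `N +
  -- 1` yields the contradiction.
  obtain ⟨D, hD, hD'⟩ := exists_bound_pow_mul_geometric (p + q + r + 1) (q := Y'⁻¹) (by positivity)
    (inv_lt_one_of_one_lt₀ hlt)
  obtain ⟨N, hN⟩ := exists_nat_gt (D * (A * B * C))
  have h3 := hD' N
  rw [inv_pow, ← div_eq_mul_inv, div_le_iff₀ (by positivity)] at h3
  have hN1 : (0 : ℝ) < ((N : ℝ) + 1) ^ (p + q + r) := by positivity
  have h4 : ((N : ℝ) + 1) * ((N : ℝ) + 1) ^ (p + q + r) ≤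
      D * (A * B * C) * ((N : ℝ) + 1) ^ (p + q + r) := by
    calc _ = ((N : ℝ) + 1) ^ (p + q + r + 1) := by ring
      _ ≤ D * Y' ^ N := h3
      _ ≤ D * (A * B * C * ((N : ℝ) + 1) ^ (p + q + r)) := by gcongr; exact h1 N
      _ = _ := by ring
  linarith [le_of_mul_le_mul_right h4 hN1]

/-- In Horn's region `|y| < 1`, where the continued rows are the original power series, so
domination of the double series bounds them. -/
theorem mem_contDomain_of_mem_hornH5Region {a b c : ℂ} (ha : ∀ k : ℕ, a ≠ -(k : ℂ))
    (hb : ∀ k : ℤ, b ≠ (k : ℂ)) (hc : ∀ k : ℕ, c ≠ -(k : ℂ)) {x y : ℂ}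
    (h : (x, y) ∈ hornH5Region a b c) :
    (x, y) ∈ contDomain a b c ∧ cont a b c (x, y) = hornH5 a b c x y := by
  have hd := dominated_of_mem_hornH5Region h
  have hy1 := lt_one_of_dominated ha hb hc hd
  obtain ⟨X, Y, hX, hY, hd'⟩ := hd.exists_gt
  have hX0 := (norm_nonneg x).trans_lt hX
  obtain ⟨C, -, hC⟩ := hd'.exists_row_bound hX0.le ((norm_nonneg y).trans_lt hY).le
  constructor
  · have hlt : 0 < min 1 Y - ‖y‖ := sub_pos.2 (lt_min hy1 hY)
    have hsub : ∀ y' ∈ ball y (min 1 Y - ‖y‖), ‖y'‖ < min 1 Y := fun y' hy' => by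
      have h1 := norm_le_norm_add_norm_sub' y' y
      rw [mem_ball, dist_eq_norm] at hy'
      linarith
    refine ⟨X, _, C, hX, hlt, fun y' hy' => ball_subset_slit ?_, fun y' hy' m => ?_⟩
    · exact mem_ball_zero_iff.2 ((hsub y' hy').trans_le (min_le_left _ _))
    · rw [← psum_hornCoef hb hc m ((hsub y' hy').trans_le (min_le_left _ _))]
      exact hC y' ((hsub y' hy').trans_le (min_le_right _ _)).le m
  · rw [hornH5, tsum_congr (hornH5Term_eq a b c x y), hd.tsum_eq le_rfl le_rfl]
    exact tsum_congr fun m => by rw [psum_hornCoef hb hc m hy1]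

/-! ### Comparison with the series at infinity -/

theorem hornH5AtInfinity_eq (a b c x y l : ℂ) : hornH5AtInfinity a b c x y l =
    Complex.exp (-a * l) * firstFactor a b c * (∑' p : ℕ × ℕ, firstCoef a b c p.1 p.2 *
      ((-(x / y ^ 2)) ^ p.1 * (1 / y) ^ p.2)) +
    Complex.exp (-b * l) * secondFactor a b c * ∑' p : ℕ × ℕ, secondCoef a b c p.1 p.2 *
      ((-(x * y)) ^ p.1 * (1 / y) ^ p.2) := by
  rw [hornH5AtInfinity, tsum_congr (firstTerm_eq a b c x y), tsum_congr (secondTerm_eq a b c x y)]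
  rfl

/-- Absolute convergence lets both double series be summed by rows, and the rows agree by `row_eq`.
-/
theorem cont_eq_atInfinity {a b c : ℂ} (ha : ∀ k : ℕ, a ≠ -(k : ℂ)) (hb : ∀ k : ℤ, b ≠ (k : ℂ))
    (hc : ∀ k : ℕ, c ≠ -(k : ℂ)) (hab : ∀ k : ℤ, a - b ≠ (k : ℂ))
    (hcb : ∀ k : ℕ, c - b ≠ -(k : ℂ)) {x y : ℂ} (hy : y ∈ exterior)
    (h₁ : Dominated (firstCoef a b c) ‖x / y ^ 2‖ (1 / ‖y‖))
    (h₂ : Dominated (secondCoef a b c) ‖x * y‖ (1 / ‖y‖)) :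
    cont a b c (x, y) = hornH5AtInfinity a b c x y (Complex.log (-y)) := by
  have hv : ‖1 / y‖ ≤ 1 / ‖y‖ := by rw [norm_div, norm_one]
  have hu₁ : ‖-(x / y ^ 2)‖ ≤ ‖x / y ^ 2‖ := (norm_neg _).le
  have hu₂ : ‖-(x * y)‖ ≤ ‖x * y‖ := (norm_neg _).le
  rw [hornH5AtInfinity_eq, h₁.tsum_eq hu₁ hv, h₂.tsum_eq hu₂ hv, ← tsum_mul_left, ← tsum_mul_left,
    ← ((h₁.summable_rows hu₁ hv).mul_left _).tsum_add ((h₂.summable_rows hu₂ hv).mul_left _)]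
  refine tsum_congr fun m => ?_
  change x ^ m * row a b c m y = _
  rw [row_eq ha hb hc hab hcb m hy, show -(x / y ^ 2) = x * (-(1 / y ^ 2)) by ring,
    show -(x * y) = x * (-y) by ring, mul_pow, mul_pow]
  ring

theorem mem_contDomain_of_dominated {a b c : ℂ} (ha : ∀ k : ℕ, a ≠ -(k : ℂ))
    (hb : ∀ k : ℤ, b ≠ (k : ℂ)) (hc : ∀ k : ℕ, c ≠ -(k : ℂ)) (hab : ∀ k : ℤ, a - b ≠ (k : ℂ))
    (hcb : ∀ k : ℕ, c - b ≠ -(k : ℂ)) {x y : ℂ} (hy : y ∈ exterior)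
    (h₁ : Dominated (firstCoef a b c) ‖x / y ^ 2‖ (1 / ‖y‖))
    (h₂ : Dominated (secondCoef a b c) ‖x * y‖ (1 / ‖y‖)) : (x, y) ∈ contDomain a b c := by
  have hy0 : 0 < ‖y‖ := zero_lt_one.trans hy.1
  obtain ⟨X₁, Y₁, hX₁, hY₁, h₁'⟩ := h₁.exists_gt
  obtain ⟨X₂, Y₂, hX₂, hY₂, h₂'⟩ := h₂.exists_gt
  rw [norm_div, norm_pow] at hX₁
  rw [norm_mul] at hX₂
  have hX₁0 : 0 ≤ X₁ := le_trans (by positivity) hX₁.le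
  have hX₂0 : 0 ≤ X₂ := le_trans (by positivity) hX₂.le
  have hY₁0 : 0 ≤ Y₁ := le_trans (by positivity) hY₁.le
  have hY₂0 : 0 ≤ Y₂ := le_trans (by positivity) hY₂.le
  obtain ⟨C₁, hC₁, hb₁⟩ := h₁'.exists_row_bound hX₁0 hY₁0
  obtain ⟨C₂, hC₂, hb₂⟩ := h₂'.exists_row_bound hX₂0 hY₂0
  have cr₁ : ContinuousAt (fun r : ℝ => r / ‖y‖ ^ 2) ‖x‖ := by fun_prop
  have cr₂ : ContinuousAt (fun r : ℝ => r * ‖y‖) ‖x‖ := by fun_prop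
  -- A radius slightly above `|x|` keeps both `r / |y|²` and `r |y|` within the enlarged radii;
  -- these strict inequalities persist for `y'` near `y`.
  obtain ⟨r, ⟨hr₁, hr₂⟩, hr⟩ := (((cr₁.tendsto.eventually (gt_mem_nhds hX₁)).and
    (cr₂.tendsto.eventually (gt_mem_nhds hX₂))).filter_mono nhdsWithin_le_nhds |>.and
      (self_mem_nhdsWithin (s := Set.Ioi ‖x‖))).exists
  have hr' : ‖x‖ < r := hr
  have hr0 : 0 < r := (norm_nonneg x).trans_lt hr'
  have cl : ContinuousAt (fun y : ℂ => Complex.log (-y)) y :=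
    continuousAt_neg.clog hy.2
  have cE : ∀ s : ℂ, ContinuousAt (fun y : ℂ => Complex.exp (-s * Complex.log (-y))) y := fun s =>
    (continuousAt_const.mul cl).cexp
  have hsq : ‖y‖ ^ 2 ≠ 0 := by positivity
  have cy₁ : ContinuousAt (fun y : ℂ => r / ‖y‖ ^ 2) y :=
    continuousAt_const.div (continuous_norm.pow 2).continuousAt hsq
  have cy₂ : ContinuousAt (fun y : ℂ => r * ‖y‖) y := by fun_prop
  have cy₃ : ContinuousAt (fun y : ℂ => 1 / ‖y‖) y :=
    continuousAt_const.div continuous_norm.continuousAt hy0.ne'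
  obtain ⟨ε, hε, hball⟩ := Metric.eventually_nhds_iff_ball.1
    ((isOpen_exterior.eventually_mem hy).and ((locally_bounded (cE a)).and
      ((locally_bounded (cE b)).and ((cy₁.tendsto.eventually (gt_mem_nhds hr₁)).and
        ((cy₂.tendsto.eventually (gt_mem_nhds hr₂)).and
          ((cy₃.tendsto.eventually (gt_mem_nhds hY₁)).and
            (cy₃.tendsto.eventually (gt_mem_nhds hY₂))))))))
  refine ⟨r, ε, (‖Complex.exp (-a * Complex.log (-y))‖ + 1) * ‖firstFactor a b c‖ * C₁ +
    (‖Complex.exp (-b * Complex.log (-y))‖ + 1) * ‖secondFactor a b c‖ * C₂, hr', hε,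
    fun y' hy' => exterior_subset_slit (hball y' hy').1, fun y' hy' m => ?_⟩
  obtain ⟨he, k1, k2, k3, k4, k5, k6⟩ := hball y' hy'
  have hv : ‖1 / y'‖ = 1 / ‖y'‖ := by rw [norm_div, norm_one]
  rw [row_eq ha hb hc hab hcb m he]
  have hrm : 0 ≤ r ^ m := by positivity
  refine (mul_le_mul_of_nonneg_right (norm_add_le _ _) hrm).trans ?_
  rw [add_mul]
  have p1 : ‖psum (firstCoef a b c m) (1 / y')‖ * (r / ‖y'‖ ^ 2) ^ m ≤ C₁ :=
    le_trans (by gcongr) (hb₁ (1 / y') (hv.trans_le k5.le) m)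
  have p2 : ‖psum (secondCoef a b c m) (1 / y')‖ * (r * ‖y'‖) ^ m ≤ C₂ :=
    le_trans (by gcongr) (hb₂ (1 / y') (hv.trans_le k6.le) m)
  gcongr ?_ + ?_
  · calc _ = ‖Complex.exp (-a * Complex.log (-y'))‖ * ‖firstFactor a b c‖ *
          (‖psum (firstCoef a b c m) (1 / y')‖ * (r / ‖y'‖ ^ 2) ^ m) := by
          rw [norm_mul, norm_mul, norm_mul, norm_pow, norm_neg, norm_div, norm_one, norm_pow,
            div_pow, div_pow, one_pow]
          ring
      _ ≤ _ := by gcongr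
  · calc _ = ‖Complex.exp (-b * Complex.log (-y'))‖ * ‖secondFactor a b c‖ *
          (‖psum (secondCoef a b c m) (1 / y')‖ * (r * ‖y'‖) ^ m) := by
          rw [norm_mul, norm_mul, norm_mul, norm_pow, norm_neg, mul_pow]
          ring
      _ ≤ _ := by gcongr

/-! ### Boundary values on the cut -/

theorem one_lt_norm_of_mem_secondRegion {x y : ℂ} (h : (x, y) ∈ secondRegion) : 1 < ‖y‖ := by
  obtain ⟨-, h1, -⟩ := h
  simp only at h1
  by_contra hle
  nlinarith [norm_nonneg y]

theorem Dominated.eventually {t : ℕ → ℕ → ℂ} {α : Type*} [TopologicalSpace α] {X Y : α → ℝ} {q : α}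
    (h : Dominated t (X q) (Y q)) (hX : ContinuousAt X q) (hY : ContinuousAt Y q) :
    ∀ᶠ p in 𝓝 q, Dominated t (X p) (Y p) := by
  obtain ⟨X', Y', C, h1, h2, h⟩ := h
  filter_upwards [hX.tendsto.eventually (gt_mem_nhds h1),
    hY.tendsto.eventually (gt_mem_nhds h2)] with p hp1 hp2
  exact ⟨X', Y', C, hp1, hp2, h⟩

/-- Boundary values of the continuation on a cut: the logarithm of `-y` may be replaced by its
limit. -/
theorem tendsto_cont {a b c : ℂ} (ha : ∀ k : ℕ, a ≠ -(k : ℂ)) (hb : ∀ k : ℤ, b ≠ (k : ℂ))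
    (hc : ∀ k : ℕ, c ≠ -(k : ℂ)) (hab : ∀ k : ℤ, a - b ≠ (k : ℂ))
    (hcb : ∀ k : ℕ, c - b ≠ -(k : ℂ)) {x y l : ℂ} (hy : 1 < ‖y‖)
    (h₁ : Dominated (firstCoef a b c) ‖x / y ^ 2‖ (1 / ‖y‖))
    (h₂ : Dominated (secondCoef a b c) ‖x * y‖ (1 / ‖y‖)) {s : Set (ℂ × ℂ)}
    (hs : ∀ q ∈ s, q.2.im ≠ 0)
    (hl : Tendsto (fun q : ℂ × ℂ => Complex.log (-q.2)) (𝓝[s] (x, y)) (𝓝 l)) :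
    Tendsto (cont a b c) (𝓝[s] (x, y)) (𝓝 (hornH5AtInfinity a b c x y l)) := by
  have hy0 : y ≠ 0 := norm_pos_iff.1 (zero_lt_one.trans hy)
  have c0 : ContinuousAt (fun q : ℂ × ℂ => q.2) (x, y) := continuousAt_snd
  have c1 : ContinuousAt (fun q : ℂ × ℂ => q.1 / q.2 ^ 2) (x, y) :=
    continuousAt_fst.div (c0.pow 2) (pow_ne_zero 2 hy0)
  have c2 : ContinuousAt (fun q : ℂ × ℂ => q.1 * q.2) (x, y) := continuousAt_fst.mul c0
  have c3 : ContinuousAt (fun q : ℂ × ℂ => 1 / q.2) (x, y) := continuousAt_const.div c0 hy0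
  have c4 : ContinuousAt (fun q : ℂ × ℂ => 1 / ‖q.2‖) (x, y) :=
    continuousAt_const.div c0.norm (norm_ne_zero_iff.2 hy0)
  have e1 := Dominated.eventually (q := (x, y)) (X := fun q : ℂ × ℂ => ‖q.1 / q.2 ^ 2‖)
    (Y := fun q : ℂ × ℂ => 1 / ‖q.2‖) h₁ c1.norm c4
  have e2 := Dominated.eventually (q := (x, y)) (X := fun q : ℂ × ℂ => ‖q.1 * q.2‖)
    (Y := fun q : ℂ × ℂ => 1 / ‖q.2‖) h₂ c2.norm c4
  have e3 := c0.norm.tendsto.eventually (lt_mem_nhds hy)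
  -- Domination is an open condition, so the formula off the cut holds at all nearby points with
  -- nonreal `y`. Its only discontinuous ingredient is `log (-y)`.
  have heq : (fun q : ℂ × ℂ => hornH5AtInfinity a b c q.1 q.2 (Complex.log (-q.2))) =ᶠ[𝓝[s] (x, y)]
      cont a b c := by
    filter_upwards [e1.filter_mono nhdsWithin_le_nhds, e2.filter_mono nhdsWithin_le_nhds,
      e3.filter_mono nhdsWithin_le_nhds, self_mem_nhdsWithin] with q k1 k2 k3 k4
    refine (cont_eq_atInfinity ha hb hc hab hcb ⟨k3, Or.inr ?_⟩ k1 k2).symm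
    rw [Complex.neg_im]
    exact neg_ne_zero.2 (hs q k4)
  refine Tendsto.congr' heq ?_
  simp_rw [hornH5AtInfinity_eq]
  have d1 : Dominated (firstCoef a b c) ‖-(x / y ^ 2)‖ ‖1 / y‖ := by
    rwa [norm_neg, norm_div 1 y, norm_one]
  have d2 : Dominated (secondCoef a b c) ‖-(x * y)‖ ‖1 / y‖ := by
    rwa [norm_neg, norm_div 1 y, norm_one]
  have t1 := d1.continuousAt.comp_of_eq (f := fun q : ℂ × ℂ => (-(q.1 / q.2 ^ 2), 1 / q.2))
    (x := (x, y)) (c1.neg.prodMk c3) rfl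
  have t2 := d2.continuousAt.comp_of_eq (f := fun q : ℂ × ℂ => (-(q.1 * q.2), 1 / q.2))
    (x := (x, y)) (c2.neg.prodMk c3) rfl
  exact (((hl.const_mul (-a)).cexp.mul_const _).mul (t1.tendsto.mono_left nhdsWithin_le_nhds)).add
    (((hl.const_mul (-b)).cexp.mul_const _).mul (t2.tendsto.mono_left nhdsWithin_le_nhds))

/-- For `y` above the cut, `-y` approaches the negative axis from below, where the argument tends to
`-π`. -/
theorem tendsto_log_neg_of_im_pos (x : ℂ) {t : ℝ} (ht : 0 < t) :
    Tendsto (fun q : ℂ × ℂ => Complex.log (-q.2)) (𝓝[{q : ℂ × ℂ | 0 < q.2.im}] (x, (t : ℂ)))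
      (𝓝 (Real.log t - Real.pi * Complex.I)) := by
  have h := Complex.tendsto_log_nhdsWithin_im_neg_of_re_neg_of_im_zero (z := -(t : ℂ))
    (by simpa using ht) (by simp)
  rw [norm_neg, Complex.norm_of_nonneg ht.le] at h
  refine h.comp (tendsto_nhdsWithin_iff.2 ⟨?_, ?_⟩)
  · exact (continuous_snd.neg.tendsto (x, (t : ℂ))).mono_left nhdsWithin_le_nhds
  · filter_upwards [self_mem_nhdsWithin] with q hq
    simpa using hq

theorem tendsto_log_neg_of_im_neg (x : ℂ) {t : ℝ} (ht : 0 < t) :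
    Tendsto (fun q : ℂ × ℂ => Complex.log (-q.2)) (𝓝[{q : ℂ × ℂ | q.2.im < 0}] (x, (t : ℂ)))
      (𝓝 (Real.log t + Real.pi * Complex.I)) := by
  have h := Complex.tendsto_log_nhdsWithin_im_nonneg_of_re_neg_of_im_zero (z := -(t : ℂ))
    (by simpa using ht) (by simp)
  rw [norm_neg, Complex.norm_of_nonneg ht.le] at h
  refine h.comp (tendsto_nhdsWithin_iff.2 ⟨?_, ?_⟩)
  · exact (continuous_snd.neg.tendsto (x, (t : ℂ))).mono_left nhdsWithin_le_nhds
  · filter_upwards [self_mem_nhdsWithin] with q hq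
    simpa using (le_of_lt hq : q.2.im ≤ 0)

theorem summable_firstTerm {a b : ℂ} (c : ℂ) (hab : ∀ k : ℤ, a - b ≠ (k : ℂ)) {x y : ℂ}
    (h : (x, y) ∈ firstRegion) : Summable (firstTerm a b c x y) :=
  ((dominated_of_mem_firstRegion c hab h).summable (norm_neg _).le
    (by rw [norm_div, norm_one])).congr fun p => (firstTerm_eq a b c x y p).symm

theorem summable_secondTerm {a b c : ℂ} (hb : ∀ k : ℤ, b ≠ (k : ℂ))
    (hab : ∀ k : ℤ, a - b ≠ (k : ℂ)) (hcb : ∀ k : ℕ, c - b ≠ -(k : ℂ)) {x y : ℂ}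
    (h : (x, y) ∈ secondRegion) : Summable (secondTerm a b c x y) :=
  ((dominated_of_mem_secondRegion hb hab hcb h).summable (norm_neg _).le
    (by rw [norm_div, norm_one])).congr fun p => (secondTerm_eq a b c x y p).symm

end HornH5
end

/-! ### The main theorem -/

open scoped Topology
theorem mainTheorem4 (a b c : ℂ)
    (ha : ∀ k : ℕ, a ≠ -(k : ℂ)) (hb : ∀ k : ℤ, b ≠ (k : ℂ)) (hc : ∀ k : ℕ, c ≠ -(k : ℂ))
    (hab : ∀ k : ℤ, a - b ≠ (k : ℂ))
    (hca : ∀ k : ℕ, c - a ≠ -(k : ℂ)) (hcb : ∀ k : ℕ, c - b ≠ -(k : ℂ)) :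
    (∀ x y : ℂ, (x, y) ∈ firstRegion → Summable (firstTerm a b c x y)) ∧
    (∀ x y : ℂ, (x, y) ∈ secondRegion → Summable (secondTerm a b c x y)) ∧
    ((0, 0) : ℂ × ℂ) ∈ hornH5Region a b c ∧
    ∃ (U : Set (ℂ × ℂ)) (F : ℂ × ℂ → ℂ),
      IsOpen U ∧ IsConnected U ∧ AnalyticOnNhd ℂ F U ∧
      hornH5Region a b c ⊆ U ∧
      (∀ y : ℂ, 1 - y ∈ Complex.slitPlane → ((0 : ℂ), y) ∈ U) ∧
      (∀ x y : ℂ, (x, y) ∈ hornH5Region a b c → F (x, y) = hornH5 a b c x y) ∧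
      (∀ x y : ℂ, (x, y) ∈ firstRegion ∩ secondRegion → -y ∈ Complex.slitPlane →
        (x, y) ∈ U ∧ F (x, y) = hornH5AtInfinity a b c x y (Complex.log (-y))) ∧
      (∀ (x : ℂ) (t : ℝ), 0 < t → (x, (t : ℂ)) ∈ firstRegion ∩ secondRegion →
        Filter.Tendsto F (𝓝[{q : ℂ × ℂ | 0 < q.2.im}] (x, (t : ℂ)))
          (𝓝 (hornH5AtInfinity a b c x t (Real.log t - Real.pi * Complex.I))) ∧
        Filter.Tendsto F (𝓝[{q : ℂ × ℂ | q.2.im < 0}] (x, (t : ℂ)))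
          (𝓝 (hornH5AtInfinity a b c x t (Real.log t + Real.pi * Complex.I)))) := by
  refine ⟨fun x y h => HornH5.summable_firstTerm c hab h,
    fun x y h => HornH5.summable_secondTerm hb hab hcb h, HornH5.zero_mem_hornH5Region hb hc,
    HornH5.contDomain a b c, HornH5.cont a b c, HornH5.isOpen_contDomain a b c,
    HornH5.isConnected_contDomain hb hc, HornH5.analyticOnNhd_cont a b hc,
    fun q h => (HornH5.mem_contDomain_of_mem_hornH5Region ha hb hc h).1,
    fun y hy => HornH5.zero_prod_mem_contDomain hb hc hy,
    fun x y h => (HornH5.mem_contDomain_of_mem_hornH5Region ha hb hc h).2, ?_, ?_⟩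
  · rintro x y ⟨h1, h2⟩ hy
    have d1 := HornH5.dominated_of_mem_firstRegion c hab h1
    have d2 := HornH5.dominated_of_mem_secondRegion hb hab hcb h2
    have he : y ∈ HornH5.exterior := ⟨HornH5.one_lt_norm_of_mem_secondRegion h2, hy⟩
    exact ⟨HornH5.mem_contDomain_of_dominated ha hb hc hab hcb he d1 d2,
      HornH5.cont_eq_atInfinity ha hb hc hab hcb he d1 d2⟩
  · rintro x t ht ⟨h1, h2⟩
    have d1 := HornH5.dominated_of_mem_firstRegion c hab h1
    have d2 := HornH5.dominated_of_mem_secondRegion hb hab hcb h2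
    have hn := HornH5.one_lt_norm_of_mem_secondRegion h2
    exact ⟨HornH5.tendsto_cont ha hb hc hab hcb hn d1 d2 (fun q hq => ne_of_gt hq)
      (HornH5.tendsto_log_neg_of_im_pos x ht), HornH5.tendsto_cont ha hb hc hab hcb hn d1 d2
        (fun q hq => ne_of_lt hq) (HornH5.tendsto_log_neg_of_im_neg x ht)⟩
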